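/- Let $M$ be a smooth 3-manifold (Hausdorff, second countable, without boundary, not necessarily compact or connected), and let $\xi=\ker\alpha\subset TM$ be a contact structure on $M$ cooriented by a contact form $\alpha$, i.e. $\alpha$ is a smooth 1-form on $M$ such that $\alpha\wedge d\alpha$ vanishes nowhere. A knot in $M$ is a smooth embedding $S^1\to M$. A knot $\gamma$ is Legendrian if its tangent lines are contained in $\xi$; it is positively (respectively negatively) transverse if $\alpha(\dot\gamma)>0$ (respectively $\alpha(\dot\gamma)<0$) everywhere, where $\dot\gamma(t)=\frac{d}{dt}\gamma(e^{it})$. Two knots are isotopic if they are joined by a smooth family $(\gamma_t)_{t\in[0,1]}$ of knots. Let $\gamma\colon S^1\to M$ be a knot, and let $U$ be a neighbourhood of $\gamma$ in the space $C^0(S^1,M)$ of continuous maps with the $C^0$ (i.e. compact-open) topology. Then 1. $U$ contains a Legendrian knot isotopic to $\gamma$; 2. $U$ contains a positively transverse knot; 3. $U$ contains a negatively transverse knot. -/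

import Mathlib

open scoped Manifold ContDiff Topology

namespace ContactKnot

noncomputable section

/-- Coordinate space of a 3-manifold. -/
abbrev E3 : Type := EuclideanSpace ℝ (Fin 3)

/-- A (not necessarily smooth) differential 1-form on `E3`, regarded as an alternating 1-form. -/
def toAlt (a : E3 → E3 →L[ℝ] ℝ) : E3 → E3 [⋀^Fin 1]→L[ℝ] ℝ :=
  fun y => ContinuousAlternatingMap.ofSubsingleton ℝ E3 ℝ (0 : Fin 1) (a y)

/-- The exterior product `a ∧ b` of a covector `a` and an alternating 2-form `b`, evaluated on the
triple `(u, v, w)`. -/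
def wedge₁₂ (a : E3 →L[ℝ] ℝ) (b : E3 [⋀^Fin 2]→L[ℝ] ℝ) (u v w : E3) : ℝ :=
  a u * b ![v, w] - a v * b ![u, w] + a w * b ![u, v]

variable {M : Type*} [TopologicalSpace M] [ChartedSpace E3 M]

/-- The expression `(φ⁻¹)^* α` of the 1-form `α` in the coordinate chart `φ` at `x₀`. -/
def localForm (α : ∀ x : M, TangentSpace (𝓡 3) x →L[ℝ] ℝ) (x₀ : M) (y : E3) : E3 →L[ℝ] ℝ :=
  (α ((extChartAt (𝓡 3) x₀).symm y)).comp
    (mfderiv 𝓘(ℝ, E3) (𝓡 3) (extChartAt (𝓡 3) x₀).symm y)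

/-- `α` is a contact form on the 3-manifold `M`: a smooth 1-form such that `α ∧ dα` vanishes
nowhere. Both conditions are expressed in the coordinate charts of `M`. -/
structure IsContactForm (α : ∀ x : M, TangentSpace (𝓡 3) x →L[ℝ] ℝ) : Prop where
  smooth : ∀ x₀ : M, ContDiffOn ℝ ∞ (localForm α x₀) (extChartAt (𝓡 3) x₀).target
  wedge_ne_zero : ∀ x₀ : M, ∀ y ∈ (extChartAt (𝓡 3) x₀).target,
    ∃ u v w : E3, wedge₁₂ (localForm α x₀ y) (extDeriv (toAlt (localForm α x₀)) y) u v w ≠ 0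

/-- A knot: a smooth embedding of the circle, that is, a smooth immersion which is a homeomorphism
onto its image. -/
structure IsKnot (γ : Circle → M) : Prop where
  smooth : ContMDiff (𝓡 1) (𝓡 3) ∞ γ
  immersion : ∀ z : Circle, Function.Injective (mfderiv (𝓡 1) (𝓡 3) γ z)
  isEmbedding : Topology.IsEmbedding γ

/-- The velocity vector `d/dt γ(e^{it})`, where the circle carries its standard orientation. -/
def velocity (γ : Circle → M) (t : ℝ) : TangentSpace (𝓡 3) (γ (Circle.exp t)) :=
  mfderiv 𝓘(ℝ, ℝ) (𝓡 3) (fun s : ℝ => γ (Circle.exp s)) t (1 : ℝ)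

/-- A Legendrian knot: a knot whose tangent lines are contained in the plane field `ξ`. -/
def IsLegendrianKnot (ξ : ∀ x : M, Submodule ℝ (TangentSpace (𝓡 3) x)) (γ : Circle → M) : Prop :=
  IsKnot γ ∧ ∀ (z : Circle) (v : TangentSpace (𝓡 1) z), mfderiv (𝓡 1) (𝓡 3) γ z v ∈ ξ (γ z)

/-- A knot positively transverse to the plane field `ker α` cooriented by `α`. -/
def IsPosTransverseKnot (α : ∀ x : M, TangentSpace (𝓡 3) x →L[ℝ] ℝ) (γ : Circle → M) : Prop :=
  IsKnot γ ∧ ∀ t : ℝ, 0 < α (γ (Circle.exp t)) (velocity γ t)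

/-- A knot negatively transverse to the plane field `ker α` cooriented by `α`. -/
def IsNegTransverseKnot (α : ∀ x : M, TangentSpace (𝓡 3) x →L[ℝ] ℝ) (γ : Circle → M) : Prop :=
  IsKnot γ ∧ ∀ t : ℝ, α (γ (Circle.exp t)) (velocity γ t) < 0

/-- Two knots are isotopic if they are joined by a smooth family of knots parametrised by
`[0, 1]`. -/
def IsotopicKnots (γ₀ γ₁ : Circle → M) : Prop :=
  ∃ H : ℝ × Circle → M,
    ContMDiffOn (𝓘(ℝ, ℝ).prod (𝓡 1)) (𝓡 3) ∞ H (Set.Icc (0 : ℝ) 1 ×ˢ Set.univ) ∧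
    (∀ t ∈ Set.Icc (0 : ℝ) 1, IsKnot fun z => H (t, z)) ∧
    (∀ z, H (0, z) = γ₀ z) ∧ ∀ z, H (1, z) = γ₁ z

end

end ContactKnot

namespace ContactKnot

noncomputable section

open Set Filter MeasureTheory intervalIntegral

set_option linter.unusedSectionVars false

variable {M : Type*} [TopologicalSpace M] [ChartedSpace E3 M]

/-! ### Smooth dependence of scalar differential equations on parameters -/

/-- Differentiation under the integral, iterated. The target `F` is quantified inside the induction
because each derivative takes values in a new space `E →L[ℝ] F`. -/
theorem contDiff_nat_integral_unit {E : Type} [NormedAddCommGroup E] [NormedSpace ℝ E]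
    [ProperSpace E] (n : ℕ) : ∀ {F : Type} [NormedAddCommGroup F] [NormedSpace ℝ F]
    [CompleteSpace F] {G : E × ℝ → F}, ContDiff ℝ n G →
    ContDiff ℝ n fun q => ∫ s in (0 : ℝ)..1, G (q, s) := by
  induction n with
  | zero =>
    intro F _ _ _ G hG
    have hc : Continuous G := hG.continuous
    exact contDiff_zero.2 (continuous_parametric_intervalIntegral_of_continuous' (by fun_prop) _ _)
  | succ n ih =>
    intro F _ _ _ G hG
    have hc : Continuous G := hG.continuous
    have hc' : Continuous (fderiv ℝ G) := hG.continuous_fderiv (by simp)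
    have hd : Differentiable ℝ G := hG.differentiable (by simp)
    let G' : E × ℝ → E →L[ℝ] F := fun x => (fderiv ℝ G x).comp (ContinuousLinearMap.inl ℝ E ℝ)
    have hG'c : Continuous G' := by fun_prop
    have key : ∀ q, HasFDerivAt (fun q => ∫ s in (0 : ℝ)..1, G (q, s))
        (∫ s in (0 : ℝ)..1, G' (q, s)) q := by
      intro q
      obtain ⟨C, hC⟩ := ((isCompact_closedBall q 1).prod
        (isCompact_Icc (a := (0 : ℝ)) (b := 1))).exists_bound_of_continuousOn hG'c.continuousOn
      refine hasFDerivAt_integral_of_dominated_of_fderiv_le (bound := fun _ => C)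
        (F' := fun x t => G' (x, t)) (Metric.closedBall_mem_nhds q one_pos) ?_ ?_ ?_ ?_ ?_ ?_
      · exact Eventually.of_forall fun x =>
          (hc.comp (by fun_prop : Continuous fun s : ℝ => (x, s))).aestronglyMeasurable
      · exact (hc.comp (by fun_prop : Continuous fun s : ℝ => (q, s))).intervalIntegrable _ _
      · exact (hG'c.comp (by fun_prop : Continuous fun s : ℝ => (q, s))).aestronglyMeasurable
      · refine Eventually.of_forall fun t ht x hx => hC (x, t) ⟨hx, ?_⟩
        rw [uIoc_of_le zero_le_one] at ht
        exact ⟨ht.1.le, ht.2⟩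
      · exact intervalIntegrable_const
      · refine Eventually.of_forall fun t _ x _ => ?_
        exact (hd (x, t)).hasFDerivAt.comp x (hasFDerivAt_prodMk_left x t)
    have h2 : ContDiff ℝ n fun q => ∫ s in (0 : ℝ)..1, G' (q, s) := by
      apply ih
      have : ContDiff ℝ n (fderiv ℝ G) := hG.fderiv_right (by simp)
      exact this.clm_comp contDiff_const
    rw [show ((n + 1 : ℕ) : WithTop ℕ∞) = (n : WithTop ℕ∞) + 1 by push_cast; rfl,
      contDiff_succ_iff_hasFDerivAt]
    exact ⟨_, h2, key⟩

/-- Rescaling the integration variable moves the variable endpoint into the integrand. -/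
theorem contDiff_nat_integral {E : Type} [NormedAddCommGroup E] [NormedSpace ℝ E]
    [ProperSpace E] (n : ℕ) {F : Type} [NormedAddCommGroup F] [NormedSpace ℝ F]
    [CompleteSpace F] {G : E × ℝ → F} (hG : ContDiff ℝ n G) :
    ContDiff ℝ n fun q : E × ℝ => ∫ s in (0 : ℝ)..q.2, G (q.1, s) := by
  have h : ∀ q : E × ℝ, ∫ s in (0 : ℝ)..q.2, G (q.1, s) =
      q.2 • ∫ s in (0 : ℝ)..1, G (q.1, q.2 * s) := by
    intro q
    rw [smul_integral_comp_mul_left (fun s => G (q.1, s))]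
    simp
  simp_rw [h]
  refine contDiff_snd.smul ?_
  exact contDiff_nat_integral_unit n (G := fun x : (E × ℝ) × ℝ => G (x.1.1, x.1.2 * x.2))
    (hG.comp (by fun_prop))

/-- Bounded Lipschitz scalar equations have global solutions. -/
theorem exists_global_solution {f : ℝ → ℝ → ℝ} (hf : Continuous (Function.uncurry f))
    {L K : NNReal} (hL : ∀ t x, ‖f t x‖ ≤ L) (hK : ∀ t, LipschitzWith K (f t)) :
    ∃ u : ℝ → ℝ, u 0 = 0 ∧ ∀ t, HasDerivAt u (f t (u t)) t := by
  have loc : ∀ n : ℕ, ∃ u : ℝ → ℝ, u 0 = 0 ∧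
      ∀ t ∈ Ioo (-(n + 1 : ℝ)) (n + 1), HasDerivAt u (f t (u t)) t := by
    intro n
    have hn : (0 : ℝ) ≤ n + 1 := by positivity
    -- At speed at most `L` the ball of radius `L (n + 1)` cannot be left within time `n + 1`, so
    -- the local existence theorem covers the whole interval.
    have : IsPicardLindelof f (tmin := -(n + 1 : ℝ)) (tmax := n + 1) ⟨0, by constructor <;> linarith⟩ 0
        (L * (n + 1)) 0 L K :=
      { lipschitzOnWith := fun t _ => (hK t).lipschitzOnWith
        continuousOn := fun x _ =>
          (hf.comp (by fun_prop : Continuous fun t : ℝ => (t, x))).continuousOn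
        norm_le := fun t _ x _ => hL t x
        mul_max_le := by simp [max_self] }
    obtain ⟨u, h0, hu⟩ := this.exists_eq_forall_mem_Icc_hasDerivWithinAt₀
    exact ⟨u, h0, fun t ht => (hu t (Ioo_subset_Icc_self ht)).hasDerivAt
      (Icc_mem_nhds ht.1 ht.2)⟩
  choose u hu0 hu using loc
  have hcons : ∀ m n : ℕ, m ≤ n → EqOn (u m) (u n) (Ioo (-(m + 1 : ℝ)) (m + 1)) := by
    intro m n hmn
    have hmn' : (m : ℝ) ≤ n := by exact_mod_cast hmn
    have hm : (0 : ℝ) ≤ m := by positivity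
    refine ODE_solution_unique_of_mem_Ioo (v := f) (s := fun _ => univ) (K := K) (t₀ := 0)
      (fun t _ => (hK t).lipschitzOnWith) (by constructor <;> linarith)
      (fun t ht => ⟨hu m t ht, mem_univ _⟩)
      (fun t ht => ⟨hu n t ⟨by linarith [ht.1], by linarith [ht.2]⟩, mem_univ _⟩)
      (by rw [hu0, hu0])
  refine ⟨fun t => u ⌊|t|⌋₊ t, by simp [hu0], fun t => ?_⟩
  have hlt : |t| < (⌊|t|⌋₊ + 1 : ℕ) + 1 := by
    push_cast; linarith [Nat.lt_floor_add_one |t|]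
  have hev : (fun t => u ⌊|t|⌋₊ t) =ᶠ[𝓝 t] u (⌊|t|⌋₊ + 1) := by
    have h1' : ∀ᶠ s : ℝ in 𝓝 t, |s| < ((⌊|t|⌋₊ + 1 : ℕ) : ℝ) := by
      refine (continuous_abs.tendsto t).eventually_lt_const ?_
      push_cast; exact Nat.lt_floor_add_one |t|
    filter_upwards [h1'] with s hs
    refine hcons _ _ ?_ ?_
    · exact (Nat.floor_lt (abs_nonneg _)).2 hs |>.le
    · have := Nat.lt_floor_add_one |s|
      exact abs_lt.1 this
  have := hu (⌊|t|⌋₊ + 1) t (abs_lt.1 (by exact_mod_cast hlt))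
  rw [hev.hasDerivAt_iff]
  have h2 : u ⌊|t|⌋₊ t = u (⌊|t|⌋₊ + 1) t := hev.eq_of_nhds
  simpa only [h2] using this

/-- Variation of constants: the integrating factor turns the equation into a constancy statement. -/
theorem linear_ode_formula {δ A B : ℝ → ℝ} (hA : Continuous A) (hB : Continuous B)
    (h0 : δ 0 = 0) (h : ∀ t, HasDerivAt δ (A t + B t * δ t) t) (t : ℝ) :
    δ t = Real.exp (∫ s in (0 : ℝ)..t, B s) *
      ∫ s in (0 : ℝ)..t, Real.exp (-∫ r in (0 : ℝ)..s, B r) * A s := by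
  have hβ : ∀ t, HasDerivAt (fun t => ∫ s in (0 : ℝ)..t, B s) (B t) t := fun t =>
    (hB.integral_hasStrictDerivAt 0 t).hasDerivAt
  have hβc : Continuous fun t => ∫ s in (0 : ℝ)..t, B s :=
    continuous_iff_continuousAt.2 fun t => (hβ t).continuousAt
  have hI : ∀ t, HasDerivAt (fun t => ∫ s in (0 : ℝ)..t, Real.exp (-∫ r in (0 : ℝ)..s, B r) * A s)
      (Real.exp (-∫ r in (0 : ℝ)..t, B r) * A t) t := fun t =>
    (Continuous.integral_hasStrictDerivAt (by fun_prop) 0 t).hasDerivAt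
  have hD : ∀ t, HasDerivAt (fun t => Real.exp (-∫ r in (0 : ℝ)..t, B r) * δ t -
      ∫ s in (0 : ℝ)..t, Real.exp (-∫ r in (0 : ℝ)..s, B r) * A s) 0 t := by
    intro t
    refine (((hβ t).neg.exp.mul (h t)).sub (hI t)).congr_deriv ?_
    simp only [Pi.neg_apply]
    ring
  have hconst := is_const_of_deriv_eq_zero (fun t => (hD t).differentiableAt)
    (fun t => (hD t).deriv) t 0
  simp only [h0, integral_same, mul_zero, sub_zero] at hconst
  have hx : ∫ s in (0 : ℝ)..t, Real.exp (-∫ r in (0 : ℝ)..s, B r) * A s =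
      Real.exp (-∫ r in (0 : ℝ)..t, B r) * δ t := by linarith
  rw [hx, ← mul_assoc, ← Real.exp_add]
  simp

/-- The mean of the derivative of `F` along a segment. -/
def segMean {E : Type} [NormedAddCommGroup E] [NormedSpace ℝ E] (F : E × ℝ × ℝ → ℝ)
    (x : E × E × ℝ × ℝ × ℝ) : E × ℝ × ℝ →L[ℝ] ℝ :=
  ∫ θ in (0 : ℝ)..1,
    fderiv ℝ F (x.1 + θ • x.2.1, x.2.2.1, x.2.2.2.1 + θ * x.2.2.2.2)

section dependence

variable {E : Type} [NormedAddCommGroup E] [NormedSpace ℝ E] {F : E × ℝ × ℝ → ℝ}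

theorem continuous_segMean (hF : ContDiff ℝ ∞ F) : Continuous (segMean F) := by
  have hc : Continuous (fderiv ℝ F) := hF.continuous_fderiv (by simp)
  exact continuous_parametric_intervalIntegral_of_continuous' (by fun_prop) _ _

theorem norm_segMean_le {K : ℝ} (hK : ∀ x, ‖fderiv ℝ F x‖ ≤ K) (x) : ‖segMean F x‖ ≤ K := by
  refine (intervalIntegral.norm_integral_le_of_norm_le_const (C := K) fun θ _ => hK _).trans (by simp)

theorem segMean_apply (hF : ContDiff ℝ ∞ F) (p h : E) (s z δ : ℝ) :
    segMean F (p, h, s, z, δ) (h, 0, δ) = F (p + h, s, z + δ) - F (p, s, z) := by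
  have hc : Continuous (fderiv ℝ F) := hF.continuous_fderiv (by simp)
  have hd : Differentiable ℝ F := hF.differentiable (by simp)
  unfold segMean
  rw [ContinuousLinearMap.intervalIntegral_apply
    (Continuous.intervalIntegrable (by fun_prop) _ _)]
  have : ∀ θ ∈ uIcc (0 : ℝ) 1, HasDerivAt (fun θ : ℝ => F (p + θ • h, s, z + θ * δ))
      (fderiv ℝ F (p + θ • h, s, z + θ * δ) (h, 0, δ)) θ := by
    intro θ _
    refine (hd _).hasFDerivAt.comp_hasDerivAt θ ?_
    refine HasDerivAt.prodMk ?_ ((hasDerivAt_const _ _).prodMk ?_)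
    · simpa using ((hasDerivAt_id θ).smul_const h).const_add p
    · simpa using ((hasDerivAt_id θ).mul_const δ).const_add z
  rw [integral_eq_sub_of_hasDerivAt this (Continuous.intervalIntegrable (by fun_prop) _ _)]
  simp

variable {φ : E → ℝ → ℝ}

/-- The coefficients of the linear equation satisfied by the difference of two solutions. -/
def diffCoeff (F : E × ℝ × ℝ → ℝ) (φ : E → ℝ → ℝ) (p h : E) (s : ℝ) : E × ℝ × ℝ →L[ℝ] ℝ :=
  segMean F (p, h, s, φ p s, φ (p + h) s - φ p s)

/-- By the mean value formula `segMean_apply`, the difference of two solutions solves a linear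
equation. Its explicit solution gives both the Lipschitz bound and the derivative in the parameter.
-/
theorem sub_eq_exp_mul_integral (hF : ContDiff ℝ ∞ F) (h0 : ∀ p, φ p 0 = 0)
    (hφ : ∀ p t, HasDerivAt (φ p) (F (p, t, φ p t)) t) (p h : E) (t : ℝ) :
    φ (p + h) t - φ p t = Real.exp (∫ s in (0 : ℝ)..t, diffCoeff F φ p h s (0, 0, 1)) *
      ∫ s in (0 : ℝ)..t, Real.exp (-∫ r in (0 : ℝ)..s, diffCoeff F φ p h r (0, 0, 1)) *
        diffCoeff F φ p h s (h, 0, 0) := by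
  have hc : ∀ p, Continuous (φ p) := fun p =>
    continuous_iff_continuousAt.2 fun t => (hφ p t).continuousAt
  have hcp := hc p
  have hcq := hc (p + h)
  have hseg := continuous_segMean hF
  have hdc : Continuous fun s => diffCoeff F φ p h s := by unfold diffCoeff; fun_prop
  refine linear_ode_formula (δ := fun t => φ (p + h) t - φ p t) (by fun_prop) (by fun_prop)
    (by simp [h0]) (fun t => ?_) t
  refine ((hφ (p + h) t).sub (hφ p t)).congr_deriv ?_
  have := segMean_apply hF p h t (φ p t) (φ (p + h) t - φ p t)
  rw [add_sub_cancel] at this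
  rw [← this, ← mul_comm (φ (p + h) t - φ p t), ← smul_eq_mul, ← map_smul]
  unfold diffCoeff
  rw [← map_add]
  simp

/-- A Gronwall-type bound read off the explicit formula: solutions are Lipschitz in `p`, locally
uniformly in `t`, and each is continuous in `t`. -/
theorem continuous_solution (hF : ContDiff ℝ ∞ F) {K : ℝ} (hK : ∀ x, ‖fderiv ℝ F x‖ ≤ K)
    (h0 : ∀ p, φ p 0 = 0) (hφ : ∀ p t, HasDerivAt (φ p) (F (p, t, φ p t)) t) :
    Continuous fun x : E × ℝ => φ x.1 x.2 := by
  have hK0 : 0 ≤ K := (norm_nonneg _).trans (hK 0)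
  let C : ℝ → ℝ := fun t => Real.exp (K * |t|) * (Real.exp (K * |t|) * K * |t|)
  have hCc : Continuous C := by fun_prop
  have bound : ∀ p h s v, ‖diffCoeff F φ p h s v‖ ≤ K * ‖v‖ := fun p h s v =>
    (ContinuousLinearMap.le_opNorm _ _).trans
      (mul_le_mul_of_nonneg_right (norm_segMean_le hK _) (norm_nonneg _))
  have bound1 : ∀ p h t, ‖∫ s in (0 : ℝ)..t, diffCoeff F φ p h s (0, 0, 1)‖ ≤ K * |t| := by
    intro p h t
    refine (intervalIntegral.norm_integral_le_of_norm_le_const (C := K) fun s _ => ?_).trans (by simp)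
    simpa using bound p h s (0, 0, 1)
  have hlip : ∀ p h t, |φ (p + h) t - φ p t| ≤ C t * ‖h‖ := by
    intro p h t
    rw [sub_eq_exp_mul_integral hF h0 hφ, abs_mul, Real.abs_exp]
    have e1 : Real.exp (∫ s in (0 : ℝ)..t, diffCoeff F φ p h s (0, 0, 1)) ≤ Real.exp (K * |t|) :=
      Real.exp_le_exp.2 ((le_abs_self _).trans (bound1 p h t))
    have e2 : |∫ s in (0 : ℝ)..t, Real.exp (-∫ r in (0 : ℝ)..s, diffCoeff F φ p h r (0, 0, 1)) *
        diffCoeff F φ p h s (h, 0, 0)| ≤ Real.exp (K * |t|) * (K * ‖h‖) * |t - 0| := by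
      rw [← Real.norm_eq_abs]
      refine intervalIntegral.norm_integral_le_of_norm_le_const fun s hs => ?_
      rw [norm_mul, Real.norm_eq_abs, Real.abs_exp]
      have hst : |s| ≤ |t| := by
        rcases le_total 0 t with ht | ht
        · rw [uIoc_of_le ht] at hs
          rw [abs_of_pos hs.1, abs_of_nonneg ht]; exact hs.2
        · rw [uIoc_of_ge ht] at hs
          rw [abs_of_nonpos hs.2, abs_of_nonpos ht]; linarith [hs.1]
      refine mul_le_mul (Real.exp_le_exp.2 ?_) ?_ (norm_nonneg _) (Real.exp_pos _).le
      · exact (neg_le_abs _).trans ((bound1 p h s).trans (mul_le_mul_of_nonneg_left hst hK0))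
      · refine (bound p h s _).trans (le_of_eq ?_)
        simp [Prod.norm_def]
    calc _ ≤ Real.exp (K * |t|) * (Real.exp (K * |t|) * (K * ‖h‖) * |t - 0|) :=
          mul_le_mul e1 e2 (abs_nonneg _) (Real.exp_pos _).le
      _ = C t * ‖h‖ := by simp only [C, sub_zero]; ring
  rw [continuous_iff_continuousAt]
  rintro ⟨p, t⟩
  have hcp : Continuous (φ p) := continuous_iff_continuousAt.2 fun t => (hφ p t).continuousAt
  have h1 : Tendsto (fun x : E × ℝ => C x.2 * ‖x.1 - p‖ + |φ p x.2 - φ p t|) (𝓝 (p, t)) (𝓝 0) := by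
    have : Continuous fun x : E × ℝ => C x.2 * ‖x.1 - p‖ + |φ p x.2 - φ p t| := by fun_prop
    simpa using this.tendsto (p, t)
  rw [ContinuousAt, tendsto_iff_dist_tendsto_zero]
  refine squeeze_zero (fun _ => dist_nonneg) (fun x => ?_) h1
  rw [Real.dist_eq]
  have := hlip p (x.1 - p) x.2
  rw [add_sub_cancel] at this
  calc |φ x.1 x.2 - φ p t| = |(φ x.1 x.2 - φ p x.2) + (φ p x.2 - φ p t)| := by ring_nf
    _ ≤ _ := (abs_add_le _ _).trans (by linarith)

/-- Carathéodory's form of differentiability. -/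
theorem hasFDerivAt_of_sub_eq {f : E → ℝ} {p : E} {L : E → E →L[ℝ] ℝ}
    (h : ∀ h, f (p + h) - f p = L h h) (hL : ContinuousAt L 0) : HasFDerivAt f (L 0) p := by
  rw [hasFDerivAt_iff_isLittleO_nhds_zero, Asymptotics.isLittleO_iff]
  intro c hc
  filter_upwards [Metric.continuousAt_iff'.1 hL c hc] with v hv
  rw [h, ← sub_apply]
  refine (ContinuousLinearMap.le_opNorm _ _).trans ?_
  rw [dist_eq_norm] at hv
  exact mul_le_mul_of_nonneg_right hv.le (norm_nonneg _)

/-- The partial derivative of the solution with respect to the parameter. -/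
def solDeriv (F : E × ℝ × ℝ → ℝ) (φ : E → ℝ → ℝ) (p : E) (t : ℝ) : E →L[ℝ] ℝ :=
  Real.exp (∫ s in (0 : ℝ)..t, fderiv ℝ F (p, s, φ p s) (0, 0, 1)) •
    ∫ s in (0 : ℝ)..t, Real.exp (-∫ r in (0 : ℝ)..s, fderiv ℝ F (p, r, φ p r) (0, 0, 1)) •
      (fderiv ℝ F (p, s, φ p s)).comp (ContinuousLinearMap.inl ℝ E (ℝ × ℝ))

/-- The explicit formula for the increment is linear in the explicit `h` once the coefficients,
which also depend on `h`, are frozen. They depend continuously on `h`, and their value at `h = 0`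
gives the derivative. -/
theorem hasFDerivAt_solution (hF : ContDiff ℝ ∞ F) {K : ℝ} (hK : ∀ x, ‖fderiv ℝ F x‖ ≤ K)
    (h0 : ∀ p, φ p 0 = 0) (hφ : ∀ p t, HasDerivAt (φ p) (F (p, t, φ p t)) t) (p : E) (t : ℝ) :
    HasFDerivAt (fun p => φ p t) (solDeriv F φ p t) p := by
  have hc := continuous_solution hF hK h0 hφ
  have hseg := continuous_segMean hF
  have hd2 : Continuous fun x : E × ℝ => diffCoeff F φ p x.1 x.2 := by
    unfold diffCoeff
    have h1 : Continuous fun x : E × ℝ => φ (p + x.1) x.2 :=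
      hc.comp (by fun_prop : Continuous fun x : E × ℝ => (p + x.1, x.2))
    have h2 : Continuous fun x : E × ℝ => φ p x.2 :=
      hc.comp (by fun_prop : Continuous fun x : E × ℝ => (p, x.2))
    fun_prop
  let L : E → E →L[ℝ] ℝ := fun h =>
    Real.exp (∫ s in (0 : ℝ)..t, diffCoeff F φ p h s (0, 0, 1)) •
      ∫ s in (0 : ℝ)..t, Real.exp (-∫ r in (0 : ℝ)..s, diffCoeff F φ p h r (0, 0, 1)) •
        (diffCoeff F φ p h s).comp (ContinuousLinearMap.inl ℝ E (ℝ × ℝ))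
  have hint : Continuous fun x : E × ℝ =>
      ∫ r in (0 : ℝ)..x.2, diffCoeff F φ p x.1 r (0, 0, 1) := by
    refine continuous_parametric_intervalIntegral_of_continuous
      (f := fun (x : E × ℝ) r => diffCoeff F φ p x.1 r (0, 0, 1)) ?_ continuous_snd
    exact (hd2.comp (by fun_prop : Continuous fun y : (E × ℝ) × ℝ => (y.1.1, y.2))).clm_apply
      continuous_const
  have hL : Continuous L := by
    have e0 : Continuous fun h : E => Real.exp (∫ s in (0 : ℝ)..t, diffCoeff F φ p h s (0, 0, 1)) :=
      Real.continuous_exp.comp (hint.comp (by fun_prop : Continuous fun h : E => (h, t)))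
    refine e0.smul (?_ : Continuous fun h : E => ∫ s in (0 : ℝ)..t,
      Real.exp (-∫ r in (0 : ℝ)..s, diffCoeff F φ p h r (0, 0, 1)) •
        (diffCoeff F φ p h s).comp (ContinuousLinearMap.inl ℝ E (ℝ × ℝ)))
    · refine continuous_parametric_intervalIntegral_of_continuous' ?_ _ _
      have e1 : Continuous fun x : E × ℝ =>
          (diffCoeff F φ p x.1 x.2).comp (ContinuousLinearMap.inl ℝ E (ℝ × ℝ)) :=
        hd2.clm_comp continuous_const
      have e2 : Continuous fun x : E × ℝ =>
          Real.exp (-∫ r in (0 : ℝ)..x.2, diffCoeff F φ p x.1 r (0, 0, 1)) :=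
        Real.continuous_exp.comp hint.neg
      exact e2.smul e1
  have hcoef : ∀ s, diffCoeff F φ p 0 s = fderiv ℝ F (p, s, φ p s) := by
    intro s; simp [diffCoeff, segMean]
  have hL0 : L 0 = solDeriv F φ p t := by simp only [L, hcoef, solDeriv]
  rw [← hL0]
  refine hasFDerivAt_of_sub_eq (fun h => ?_) hL.continuousAt
  rw [sub_eq_exp_mul_integral hF h0 hφ]
  have hi : IntervalIntegrable (fun s =>
      Real.exp (-∫ r in (0 : ℝ)..s, diffCoeff F φ p h r (0, 0, 1)) •
        (diffCoeff F φ p h s).comp (ContinuousLinearMap.inl ℝ E (ℝ × ℝ))) volume 0 t := by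
    refine Continuous.intervalIntegrable ?_ _ _
    have e1 := hint.comp (by fun_prop : Continuous fun s : ℝ => (h, s))
    have e2 := hd2.comp (by fun_prop : Continuous fun s : ℝ => (h, s))
    exact (Real.continuous_exp.comp e1.neg).smul (e2.clm_comp continuous_const)
  simp only [L, smul_apply, smul_eq_mul]
  rw [ContinuousLinearMap.intervalIntegral_apply hi]
  simp [Prod.zero_eq_mk]

/-- Smooth dependence on parameters of the solutions of a scalar equation. -/
theorem contDiff_solution [ProperSpace E] (hF : ContDiff ℝ ∞ F) {K : ℝ}
    (hK : ∀ x, ‖fderiv ℝ F x‖ ≤ K)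
    (h0 : ∀ p, φ p 0 = 0) (hφ : ∀ p t, HasDerivAt (φ p) (F (p, t, φ p t)) t) :
    ContDiff ℝ ∞ fun x : E × ℝ => φ x.1 x.2 := by
  rw [contDiff_infty]
  intro n
  induction n with
  | zero => exact contDiff_zero.2 (continuous_solution hF hK h0 hφ)
  | succ n ih =>
    have hcurve : ContDiff ℝ n fun x : E × ℝ => (x.1, x.2, φ x.1 x.2) :=
      contDiff_fst.prodMk (contDiff_snd.prodMk ih)
    have hFd : ContDiff ℝ n (fderiv ℝ F) := hF.fderiv_right (by exact_mod_cast le_top)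
    have hg : ContDiff ℝ n fun x : E × ℝ => fderiv ℝ F (x.1, x.2, φ x.1 x.2) := hFd.comp hcurve
    have hβ : ContDiff ℝ n fun x : E × ℝ =>
        ∫ s in (0 : ℝ)..x.2, fderiv ℝ F (x.1, s, φ x.1 s) (0, 0, 1) :=
      contDiff_nat_integral n (G := fun x : E × ℝ => fderiv ℝ F (x.1, x.2, φ x.1 x.2) (0, 0, 1))
        (hg.clm_apply contDiff_const)
    -- Bootstrap: the partial derivatives are integrals of expressions in `φ` itself, so they are as
    -- smooth as `φ` is already known to be.
    have hS : ContDiff ℝ n fun x : E × ℝ => solDeriv F φ x.1 x.2 := by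
      refine (Real.contDiff_exp.comp hβ).smul ?_
      exact contDiff_nat_integral n (G := fun x : E × ℝ =>
        Real.exp (-∫ r in (0 : ℝ)..x.2, fderiv ℝ F (x.1, r, φ x.1 r) (0, 0, 1)) •
          (fderiv ℝ F (x.1, x.2, φ x.1 x.2)).comp (ContinuousLinearMap.inl ℝ E (ℝ × ℝ)))
        ((Real.contDiff_exp.comp hβ.neg).smul (hg.clm_comp contDiff_const))
    have hT : ContDiff ℝ n fun x : E × ℝ =>
        ContinuousLinearMap.toSpanSingleton ℝ (F (x.1, x.2, φ x.1 x.2)) :=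
      (ContinuousLinearMap.toSpanSingletonCLE (𝕜 := ℝ) (E := ℝ)).contDiff.comp
        ((hF.of_le (by exact_mod_cast le_top)).comp hcurve)
    have hder : ∀ x : E × ℝ, HasFDerivAt (fun x : E × ℝ => φ x.1 x.2)
        ((solDeriv F φ x.1 x.2).coprod
          (ContinuousLinearMap.toSpanSingleton ℝ (F (x.1, x.2, φ x.1 x.2)))) x := by
      intro x
      exact (hasStrictFDerivAt_uncurry_coprod (𝕜 := ℝ) (f := φ) (u := x)
        (f₁ := solDeriv F φ)
        (f₂ := fun p t => ContinuousLinearMap.toSpanSingleton ℝ (F (p, t, φ p t)))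
        (Eventually.of_forall fun v => hasFDerivAt_solution hF hK h0 hφ v.1 v.2)
        (Eventually.of_forall fun v => (hφ v.1 v.2).hasFDerivAt)
        hS.continuous.continuousAt hT.continuous.continuousAt).hasFDerivAt
    rw [show ((n + 1 : ℕ) : WithTop ℕ∞) = (n : WithTop ℕ∞) + 1 by push_cast; rfl,
      contDiff_succ_iff_hasFDerivAt]
    refine ⟨_, ?_, hder⟩
    have e1 : ContDiff ℝ n fun x : E × ℝ =>
        (solDeriv F φ x.1 x.2).comp (ContinuousLinearMap.fst ℝ E ℝ) := hS.clm_comp contDiff_const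
    have e2 := hT.clm_comp (contDiff_const (c := ContinuousLinearMap.snd ℝ E ℝ))
    convert e1.add e2 using 2 with x
    ext <;> simp

end dependence

/-! ### Darboux coordinates with a prescribed first coordinate -/

/-- The point of `E3` with given coordinates. -/
def vec3 (a b c : ℝ) : E3 := !₂[a, b, c]

@[simp] theorem vec3_zero (a b c : ℝ) : vec3 a b c 0 = a := rfl
@[simp] theorem vec3_one (a b c : ℝ) : vec3 a b c 1 = b := rfl
@[simp] theorem vec3_two (a b c : ℝ) : vec3 a b c 2 = c := rfl

theorem vec3_eta (v : E3) : vec3 (v 0) (v 1) (v 2) = v := by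
  ext i; fin_cases i <;> rfl

theorem E3.ext3 {v w : E3} (h0 : v 0 = w 0) (h1 : v 1 = w 1) (h2 : v 2 = w 2) : v = w := by
  rw [← vec3_eta v, ← vec3_eta w, h0, h1, h2]

theorem contDiffAt_vec3 {X : Type*} [NormedAddCommGroup X] [NormedSpace ℝ X] {n : ℕ∞ω}
    {a b c : X → ℝ} {x : X} (ha : ContDiffAt ℝ n a x) (hb : ContDiffAt ℝ n b x)
    (hc : ContDiffAt ℝ n c x) : ContDiffAt ℝ n (fun x => vec3 (a x) (b x) (c x)) x := by
  rw [contDiffAt_euclidean]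
  intro i
  fin_cases i <;> assumption

theorem contDiff_vec3 {X : Type*} [NormedAddCommGroup X] [NormedSpace ℝ X] {n : ℕ∞ω}
    {a b c : X → ℝ} (ha : ContDiff ℝ n a) (hb : ContDiff ℝ n b)
    (hc : ContDiff ℝ n c) : ContDiff ℝ n (fun x => vec3 (a x) (b x) (c x)) :=
  contDiff_iff_contDiffAt.2 fun _ => contDiffAt_vec3 ha.contDiffAt hb.contDiffAt hc.contDiffAt

theorem contDiff_coord {n : ℕ∞ω} (i : Fin 3) : ContDiff ℝ n fun v : E3 => v i :=
  (EuclideanSpace.proj (𝕜 := ℝ) (ι := Fin 3) i).contDiff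

/-- A smooth function on an open set can be modified away from a ball to be smooth everywhere. -/
theorem exists_contDiff_extension {E F : Type} [NormedAddCommGroup E] [InnerProductSpace ℝ E]
    [FiniteDimensional ℝ E] [NormedAddCommGroup F] [NormedSpace ℝ F] {Ω : Set E} (hΩ : IsOpen Ω)
    {f : E → F} (hf : ContDiffOn ℝ ∞ f Ω) {q : E} (hq : q ∈ Ω) :
    ∃ g : E → F, ContDiff ℝ ∞ g ∧ HasCompactSupport g ∧ g =ᶠ[𝓝 q] f := by
  obtain ⟨r, hr, hrΩ⟩ := Metric.nhds_basis_closedBall.mem_iff.1 (hΩ.mem_nhds hq)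
  let B : ContDiffBump q := ⟨r / 2, r, by positivity, by linarith⟩
  have hts : tsupport B = Metric.closedBall q r := B.tsupport_eq
  refine ⟨fun x => B x • f x, ?_, ?_, ?_⟩
  · rw [contDiff_iff_contDiffAt]
    intro x
    by_cases hx : x ∈ tsupport B
    · rw [hts] at hx
      exact B.contDiffAt.smul (hf.contDiffAt (hΩ.mem_nhds (hrΩ hx)))
    · have : (fun x => B x • f x) =ᶠ[𝓝 x] fun _ => 0 := by
        filter_upwards [notMem_tsupport_iff_eventuallyEq.1 hx] with y hy
        simp [hy]
      exact contDiffAt_const.congr_of_eventuallyEq this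
  · exact B.hasCompactSupport.smul_right
  · filter_upwards [Metric.closedBall_mem_nhds q (half_pos hr)] with x hx
    rw [B.one_of_mem_closedBall hx, one_smul]

/-- A first integral of the field `e₁ + b e₂` with `y e₁ = z e₂ = 1` and `y e₂ = z e₁ = 0`. -/
theorem exists_first_integral {b : E3 → ℝ} (hb : ContDiff ℝ ∞ b) (hbs : HasCompactSupport b)
    {e₁ e₂ : E3} {y z : E3 →L[ℝ] ℝ} (hy₁ : y e₁ = 1) (hy₂ : y e₂ = 0) (hz₁ : z e₁ = 0)
    (hz₂ : z e₂ = 1) (q : E3) :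
    ∃ w : E3 → ℝ, ContDiff ℝ ∞ w ∧ (∀ x, fderiv ℝ w x (e₁ + b x • e₂) = 0) ∧
      fderiv ℝ w q e₂ = 1 := by
  obtain ⟨Cb, hCb⟩ := hbs.exists_bound_of_continuous hb.continuous
  obtain ⟨Cd, hCd⟩ := (hbs.fderiv (𝕜 := ℝ)).exists_bound_of_continuous
    (hb.continuous_fderiv (by simp))
  have hbd : Differentiable ℝ b := hb.differentiable (by simp)
  let Λ : E3 × ℝ × ℝ →L[ℝ] E3 := (ContinuousLinearMap.id ℝ E3).coprod
    ((ContinuousLinearMap.toSpanSingleton ℝ e₁).coprod (ContinuousLinearMap.toSpanSingleton ℝ e₂))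
  have hΛ : ∀ p s ζ, Λ (p, s, ζ) = p + (s • e₁ + ζ • e₂) := fun p s ζ => by simp [Λ]
  let F : E3 × ℝ × ℝ → ℝ := fun x => b (Λ x)
  have hF : ContDiff ℝ ∞ F := hb.comp Λ.contDiff
  have hFd : ∀ x, ‖fderiv ℝ F x‖ ≤ Cd * ‖Λ‖ := by
    intro x
    have : fderiv ℝ F x = (fderiv ℝ b (Λ x)).comp Λ :=
      ((hbd _).hasFDerivAt.comp x Λ.hasFDerivAt).fderiv
    rw [this]
    exact (ContinuousLinearMap.opNorm_comp_le _ _).trans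
      (mul_le_mul_of_nonneg_right (hCd _) (norm_nonneg _))
  have hFlip : LipschitzWith (Real.toNNReal (Cd * ‖Λ‖)) F :=
    lipschitzWith_of_nnnorm_fderiv_le (hF.differentiable (by simp)) fun x => by
      rw [← NNReal.coe_le_coe, coe_nnnorm]
      exact (hFd x).trans (Real.le_coe_toNNReal _)
  have hFlip' : ∀ p t, LipschitzWith (Real.toNNReal (Cd * ‖Λ‖)) fun ζ => F (p, t, ζ) := by
    intro p t
    have := hFlip.comp ((LipschitzWith.prodMk_left p).comp (LipschitzWith.prodMk_left t))
    rw [mul_one, mul_one] at this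
    exact this
  have hex : ∀ p : E3, ∃ u : ℝ → ℝ, u 0 = 0 ∧ ∀ t, HasDerivAt u (F (p, t, u t)) t := fun p =>
    exists_global_solution (f := fun t ζ => F (p, t, ζ)) (L := Real.toNNReal Cb)
      (hF.continuous.comp (by fun_prop : Continuous fun x : ℝ × ℝ => (p, x.1, x.2)))
      (fun t x => (hCb _).trans (Real.le_coe_toNNReal _)) (hFlip' p)
  choose φ h0 hφ using hex
  have hφs := contDiff_solution hF hFd h0 hφ
  -- The flow line of the field through `p` is `s ↦ p + s e₁ + φ p s e₂`. The value `w p` is the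
  -- `z`-coordinate, relative to `q`, of its intersection with the plane `y = y q`.
  let w : E3 → ℝ := fun p => z (p - q) + φ p (-y (p - q))
  have hw : ContDiff ℝ ∞ w := by
    refine (z.contDiff.comp (contDiff_id.sub contDiff_const)).add ?_
    exact hφs.comp (contDiff_id.prodMk
      ((y.contDiff.comp (contDiff_id.sub contDiff_const)).neg))
  have hwd : Differentiable ℝ w := hw.differentiable (by simp)
  refine ⟨w, hw, fun p => ?_, ?_⟩
  · let c : ℝ → E3 := fun r => p + (r • e₁ + φ p r • e₂)
    have hc : HasDerivAt c (e₁ + b p • e₂) 0 := by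
      have h1 : HasDerivAt (fun r => φ p r • e₂) (b p • e₂) 0 := by
        have := (hφ p 0).smul_const e₂
        simpa [F, hΛ, h0] using this
      have h2 : HasDerivAt (fun r : ℝ => r • e₁) e₁ 0 := by
        simpa using (hasDerivAt_id (0 : ℝ)).smul_const e₁
      exact (h2.add h1).const_add p
    -- Points of one flow line have the same flow line, by uniqueness; hence `w` is constant along
    -- it.
    have hflow : ∀ r s, φ (c r) s = φ p (r + s) - φ p r := by
      intro r
      refine congrFun (ODE_solution_unique_univ (v := fun s ζ => F (c r, s, ζ))
        (s := fun _ => univ) (t₀ := 0) (fun t => (hFlip' _ t).lipschitzOnWith)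
        (fun t => ⟨hφ _ t, mem_univ _⟩) (g := fun s => φ p (r + s) - φ p r)
        (fun t => ⟨?_, mem_univ _⟩) (by simp [h0]))
      have := ((hφ p (r + t)).comp_const_add r t).sub_const (φ p r)
      refine this.congr_deriv ?_
      simp only [F, hΛ, c]
      congr 1
      module
    have hconst : ∀ r, w (c r) = w p := by
      intro r
      have hy : y (c r - q) = y (p - q) + r := by
        simp only [c, map_sub, map_add, map_smul, hy₁, hy₂, smul_eq_mul]; ring
      have hz : z (c r - q) = z (p - q) + φ p r := by
        simp only [c, map_sub, map_add, map_smul, hz₁, hz₂, smul_eq_mul]; ring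
      simp only [w, hy, hz, hflow]
      rw [show r + -(y (p - q) + r) = -y (p - q) by ring]
      ring
    have hc0 : c 0 = p := by simp [c, h0]
    have h1 : HasDerivAt (fun r => w (c r)) (fderiv ℝ w p (e₁ + b p • e₂)) 0 := by
      have := (hwd (c 0)).hasFDerivAt.comp_hasDerivAt (0 : ℝ) hc
      rwa [hc0] at this
    rw [show (fun r => w (c r)) = fun _ => w p from funext hconst] at h1
    exact h1.unique (hasDerivAt_const _ _)
  · have h1 : HasDerivAt (fun r : ℝ => w (q + r • e₂)) (fderiv ℝ w q e₂) 0 := by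
      have hl : HasDerivAt (fun r : ℝ => q + r • e₂) e₂ 0 := by
        simpa using ((hasDerivAt_id (0 : ℝ)).smul_const e₂).const_add q
      have := (hwd (q + (0 : ℝ) • e₂)).hasFDerivAt.comp_hasDerivAt (0 : ℝ) hl
      rwa [zero_smul, add_zero] at this
    have : (fun r : ℝ => w (q + r • e₂)) = id := by
      funext r; simp [w, hy₂, hz₂, h0]
    rw [this] at h1
    exact h1.unique (hasDerivAt_id _)

theorem extDeriv_toAlt {β : E3 → E3 →L[ℝ] ℝ} {q : E3} (hβ : DifferentiableAt ℝ β q) (v w : E3) :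
    extDeriv (toAlt β) q ![v, w] = fderiv ℝ β q v w - fderiv ℝ β q w v := by
  have hd : DifferentiableAt ℝ (toAlt β) q :=
    (ContinuousAlternatingMap.ofSubsingletonLIE (𝕜 := ℝ) (E := E3) (F := ℝ)
      (0 : Fin 1)).toContinuousLinearEquiv.differentiableAt.comp q hβ
  have key : ∀ u v : E3, fderiv ℝ (fun x => β x u) q v = fderiv ℝ β q v u := by
    intro u v
    have := (hβ.hasFDerivAt.clm_apply (hasFDerivAt_const u q)).fderiv
    rw [this]; simp
  rw [extDeriv_apply hd, Fin.sum_univ_two]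
  simp only [toAlt, ContinuousAlternatingMap.ofSubsingleton_apply_apply]
  simp only [Fin.removeNth, Fin.isValue, Fin.succAbove]
  simp [key]
  ring

/-- A frame adapted to two independent covectors. -/
theorem exists_adapted_frame {a l : E3 →L[ℝ] ℝ} (ha : a ≠ 0) (hl : ∃ v, a v = 0 ∧ l v ≠ 0) :
    ∃ (e₀ e₁ e₂ : E3) (y : E3 →L[ℝ] ℝ), l e₀ = 1 ∧ l e₁ = 0 ∧ l e₂ = 0 ∧ y e₀ = 0 ∧ y e₁ = 1 ∧
      y e₂ = 0 ∧ a e₀ = 0 ∧ a e₁ = 0 ∧ a e₂ = 1 ∧ ∀ v, v = l v • e₀ + y v • e₁ + a v • e₂ := by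
  obtain ⟨v₀, hv₀, hlv⟩ := hl
  obtain ⟨v₂, hv₂⟩ : ∃ v, a v ≠ 0 := by
    by_contra! h; exact ha (by ext v; simpa using h v)
  let e₀ : E3 := (l v₀)⁻¹ • v₀
  have hl0 : l e₀ = 1 := by simp [e₀, hlv]
  have ha0 : a e₀ = 0 := by simp [e₀, hv₀]
  let e₂ : E3 := (a v₂)⁻¹ • (v₂ - l v₂ • e₀)
  have hl2 : l e₂ = 0 := by simp [e₂, hl0]
  have ha2 : a e₂ = 1 := by simp [e₂, ha0, hv₂]
  obtain ⟨e₁, he₁, he₁0⟩ : ∃ e₁ ∈ ((l : E3 →ₗ[ℝ] ℝ).prod (a : E3 →ₗ[ℝ] ℝ)).ker, e₁ ≠ 0 :=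
    Submodule.exists_mem_ne_zero_of_ne_bot (LinearMap.ker_ne_bot_of_finrank_lt (by simp))
  obtain ⟨hl1, ha1⟩ : l e₁ = 0 ∧ a e₁ = 0 := by simpa using he₁
  let y' : E3 →L[ℝ] ℝ := (‖e₁‖ ^ 2)⁻¹ • innerSL ℝ e₁
  have hy' : y' e₁ = 1 := by
    have : ‖e₁‖ ≠ 0 := norm_ne_zero_iff.2 he₁0
    simp [y', this]
  let y : E3 →L[ℝ] ℝ := y' - y' e₀ • l - y' e₂ • a
  have hy0 : y e₀ = 0 := by simp [y, hl0, ha0]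
  have hy1 : y e₁ = 1 := by simp [y, hl1, ha1, hy']
  have hy2 : y e₂ = 0 := by simp [y, hl2, ha2]
  refine ⟨e₀, e₁, e₂, y, hl0, hl1, hl2, hy0, hy1, hy2, ha0, ha1, ha2, fun v => ?_⟩
  let T : E3 →ₗ[ℝ] E3 :=
    { toFun := fun v => vec3 (l v) (y v) (a v)
      map_add' := fun v w => by apply E3.ext3 <;> simp
      map_smul' := fun c v => by apply E3.ext3 <;> simp }
  have hT : Function.Surjective T := by
    intro v
    refine ⟨v 0 • e₀ + v 1 • e₁ + v 2 • e₂, ?_⟩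
    apply E3.ext3 <;> simp [T, *]
  apply LinearMap.injective_iff_surjective.2 hT
  apply E3.ext3 <;> simp [T, *]

/-- The antisymmetric part of `B` is a combination of `l ∧ y`, `l ∧ a` and `y ∧ a`. The first
coefficient vanishes by `hB`, and the other two terms are killed by wedging with `a`. -/
theorem contact_apply_frame {a : E3 →L[ℝ] ℝ} {B : E3 →L[ℝ] E3 →L[ℝ] ℝ} {l y : E3 →L[ℝ] ℝ}
    {e₀ e₁ e₂ : E3} (h : ∀ v, v = l v • e₀ + y v • e₁ + a v • e₂)
    (hB : B e₀ e₁ - B e₁ e₀ = 0) (u v w : E3) :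
    a u * (B v w - B w v) - a v * (B u w - B w u) + a w * (B u v - B v u) = 0 := by
  have e : ∀ v w, B v w - B w v = (l v * a w - a v * l w) * (B e₀ e₂ - B e₂ e₀) +
      (y v * a w - a v * y w) * (B e₁ e₂ - B e₂ e₁) := by
    intro v w
    conv_lhs => rw [h v, h w]
    simp only [map_add, map_smul, add_apply, smul_apply, smul_eq_mul]
    linear_combination (l v * y w - y v * l w) * hB
  rw [e v w, e u w, e u v]; ring

/-- For `β = G (dw - A l)` and vectors in `ker β`, the terms with `dG` drop out of `dβ` and those
with the second derivative of `w` cancel by symmetry. Thus `dβ(e₀, e₁) = G dA(e₁)` at `q`, and if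
this vanished, `β ∧ dβ` would vanish too. -/
theorem fderiv_ne_zero_of_contact {β : E3 → E3 →L[ℝ] ℝ} {q : E3} {G A w : E3 → ℝ}
    {l y : E3 →L[ℝ] ℝ} {e₀ e₁ e₂ : E3} (hβ : DifferentiableAt ℝ β q)
    (hG : DifferentiableAt ℝ G q) (hA : DifferentiableAt ℝ A q) (hw : ContDiff ℝ ∞ w)
    (hcontact : ∃ u v w : E3, wedge₁₂ (β q) (extDeriv (toAlt β) q) u v w ≠ 0)
    (hframe : ∀ v, v = l v • e₀ + y v • e₁ + β q v • e₂)
    (hl0 : l e₀ = 1) (hl1 : l e₁ = 0) (ha0 : β q e₀ = 0) (ha1 : β q e₁ = 0) (hGq : G q ≠ 0)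
    (hid : ∀ᶠ x in 𝓝 q, ∀ v, β x v = G x * (fderiv ℝ w x v - A x * l v)) :
    fderiv ℝ A q e₁ ≠ 0 := by
  intro h0
  obtain ⟨u, v, w', huvw⟩ := hcontact
  refine huvw ?_
  unfold wedge₁₂
  rw [extDeriv_toAlt hβ, extDeriv_toAlt hβ, extDeriv_toAlt hβ]
  refine contact_apply_frame hframe ?_ u v w'
  have hsymm := (hw.contDiffAt (x := q)).isSymmSndFDerivAt
    (by rw [minSmoothness_of_isRCLikeNormedField]; exact WithTop.coe_le_coe.2 le_top)
  have hw2 : DifferentiableAt ℝ (fderiv ℝ w) q :=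
    (hw.fderiv_right (m := ∞) (by simp)).differentiable (by simp) q
  have key : ∀ v, β q v = 0 → ∀ u, fderiv ℝ β q u v =
      G q * (fderiv ℝ (fderiv ℝ w) q u v - fderiv ℝ A q u * l v) := by
    intro v hv u
    have h1 := hβ.hasFDerivAt.clm_apply (hasFDerivAt_const v q)
    have h2 : (fun x => β x v) =ᶠ[𝓝 q] fun x => G x * (fderiv ℝ w x v - A x * l v) := by
      filter_upwards [hid] with x hx using hx v
    have h3 := hG.hasFDerivAt.mul ((hw2.hasFDerivAt.clm_apply (hasFDerivAt_const v q)).sub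
      (hA.hasFDerivAt.mul_const (l v)))
    have h4 := (h1.congr_of_eventuallyEq h2.symm).unique h3
    have h5 : fderiv ℝ w q v - A q * l v = 0 := by
      have := hid.self_of_nhds v
      rw [hv] at this
      exact (mul_eq_zero.1 this.symm).resolve_left hGq
    have h6 := congrArg (fun T => T u) h4
    simp [h5] at h6
    rw [h6]
    ring
  rw [key _ ha1, key _ ha0, hl0, hl1, hsymm.eq e₀ e₁, h0]
  ring

/-- **Darboux's theorem** for contact forms in dimension three, with a prescribed first
coordinate. -/
theorem exists_darboux_coordinates {β : E3 → E3 →L[ℝ] ℝ} {Ω : Set E3} (hΩ : IsOpen Ω) {q : E3}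
    (hq : q ∈ Ω) (hβ : ContDiffOn ℝ ∞ β Ω)
    (hcontact : ∃ u v w : E3, wedge₁₂ (β q) (extDeriv (toAlt β) q) u v w ≠ 0)
    {l : E3 →L[ℝ] ℝ} (hl : ∃ v, β q v = 0 ∧ l v ≠ 0) :
    ∃ D : OpenPartialHomeomorph E3 E3, q ∈ D.source ∧ D.source ⊆ Ω ∧
      ContDiffOn ℝ ∞ D D.source ∧ ContDiffOn ℝ ∞ D.symm D.target ∧ (∀ x, D x 0 = l x) ∧
      ∀ x ∈ D.source, ∃ G : ℝ, 0 < G ∧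
        ∀ v, β x v = G * (fderiv ℝ D x v 2 - D x 1 * fderiv ℝ D x v 0) := by
  have ha : β q ≠ 0 := by
    rintro h
    obtain ⟨u, v, w, huvw⟩ := hcontact
    simp [wedge₁₂, h] at huvw
  obtain ⟨e₀, e₁, e₂, y, hl0, hl1, hl2, hy0, hy1, hy2, ha0, ha1, ha2, hframe⟩ :=
    exists_adapted_frame ha hl
  have hβc : ContinuousOn β Ω := hβ.continuousOn
  have hβe : ∀ e : E3, ContDiffOn ℝ ∞ (fun x => β x e) Ω := fun e =>
    hβ.clm_apply contDiffOn_const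
  let Ω₁ : Set E3 := {x ∈ Ω | 0 < β x e₂}
  have hΩ₁ : IsOpen Ω₁ := (hβe e₂).continuousOn.isOpen_inter_preimage hΩ isOpen_Ioi
  have hq₁ : q ∈ Ω₁ := ⟨hq, by rw [ha2]; exact one_pos⟩
  -- With this coefficient `b`, the field `e₁ + b e₂` spans `ker β ∩ ker l`. A first integral `w` of
  -- it then has differential proportional to `β` on each plane `l = const`.
  have hb₀ : ContDiffOn ℝ ∞ (fun x => -(β x e₁ / β x e₂)) Ω₁ :=
    (((hβe e₁).mono fun x hx => hx.1).div ((hβe e₂).mono fun x hx => hx.1)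
      fun x hx => hx.2.ne').neg
  obtain ⟨b, hb, hbs, hbq⟩ := exists_contDiff_extension hΩ₁ hb₀ hq₁
  obtain ⟨w, hw, hwY, hwe⟩ := exists_first_integral hb hbs hy1 hy2
    (z := β q) ha1 ha2 q
  have hwd : ContDiff ℝ ∞ (fderiv ℝ w) := hw.fderiv_right (by simp)
  have hwde : ∀ e : E3, ContDiff ℝ ∞ fun x => fderiv ℝ w x e := fun e =>
    hwd.clm_apply contDiff_const
  -- On `ker l` the forms `dw` and `β` are already proportional; this `A` makes `dw - A l`
  -- proportional to `β` on `e₀` as well.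
  let A : E3 → ℝ := fun x => fderiv ℝ w x e₀ - fderiv ℝ w x e₂ / β x e₂ * β x e₀
  have hA : ContDiffOn ℝ ∞ A Ω₁ :=
    ((hwde e₀).contDiffOn).sub (((hwde e₂).contDiffOn.div ((hβe e₂).mono fun x hx => hx.1)
      fun x hx => hx.2.ne').mul ((hβe e₀).mono fun x hx => hx.1))
  let D : E3 → E3 := fun x => vec3 (l x) (A x) (w x)
  have hD : ∀ x ∈ Ω₁, ContDiffAt ℝ ∞ D x := fun x hx =>
    contDiffAt_vec3 l.contDiff.contDiffAt (hA.contDiffAt (hΩ₁.mem_nhds hx)) hw.contDiffAt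
  obtain ⟨Ω₂, hΩ₂b, hΩ₂, hq₂⟩ := mem_nhds_iff.1 hbq
  let Ω₃ : Set E3 := (Ω₁ ∩ Ω₂) ∩ {x | 0 < fderiv ℝ w x e₂}
  have hΩ₃ : IsOpen Ω₃ :=
    (hΩ₁.inter hΩ₂).inter (isOpen_lt continuous_const (hwde e₂).continuous)
  have hq₃ : q ∈ Ω₃ := ⟨⟨hq₁, hq₂⟩, by simp [hwe]⟩
  have hid : ∀ x ∈ Ω₃, ∀ v, β x v =
      β x e₂ / fderiv ℝ w x e₂ * (fderiv ℝ w x v - A x * l v) := by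
    rintro x ⟨⟨⟨hxΩ, hx1⟩, hx2⟩, hx3⟩ v
    have hbx : b x = -(β x e₁ / β x e₂) := hΩ₂b hx2
    have h1 := hwY x
    rw [map_add, map_smul, smul_eq_mul, hbx] at h1
    have h2 : fderiv ℝ w x v = l v * fderiv ℝ w x e₀ + y v * fderiv ℝ w x e₁ +
        β q v * fderiv ℝ w x e₂ := by
      conv_lhs => rw [hframe v]
      simp
    have h3 : β x v = l v * β x e₀ + y v * β x e₁ + β q v * β x e₂ := by
      conv_lhs => rw [hframe v]
      simp
    have hx1' := hx1.ne'
    have hx3' : fderiv ℝ w x e₂ ≠ 0 := ne_of_gt hx3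
    have h4 : fderiv ℝ w x e₁ = β x e₁ / β x e₂ * fderiv ℝ w x e₂ := by linarith
    rw [h2, h3, h4]
    simp only [A]
    field_simp
    ring
  have hAe : fderiv ℝ A q e₁ ≠ 0 := by
    refine fderiv_ne_zero_of_contact (G := fun x => β x e₂ / fderiv ℝ w x e₂) (w := w)
      ((hβ.contDiffAt (hΩ.mem_nhds hq)).differentiableAt (by simp)) ?_
      ((hA.contDiffAt (hΩ₁.mem_nhds hq₁)).differentiableAt (by simp)) hw hcontact hframe hl0 hl1
      ha0 ha1 (by simp [ha2, hwe]) ?_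
    · exact (((hβe e₂).contDiffAt (hΩ.mem_nhds hq)).div (hwde e₂).contDiffAt
        (by rw [hwe]; exact one_ne_zero)).differentiableAt (by simp)
    · filter_upwards [hΩ₃.mem_nhds hq₃] with x hx using hid x hx
  have hcoord : ∀ x ∈ Ω₁, ∀ v, fderiv ℝ D x v 0 = l v ∧ fderiv ℝ D x v 1 = fderiv ℝ A x v ∧
      fderiv ℝ D x v 2 = fderiv ℝ w x v := by
    intro x hx v
    have hd : HasFDerivAt D (fderiv ℝ D x) x :=
      ((hD x hx).differentiableAt (by simp)).hasFDerivAt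
    have hp : ∀ i : Fin 3, HasFDerivAt (fun x => D x i)
        ((EuclideanSpace.proj (𝕜 := ℝ) (ι := Fin 3) i).comp (fderiv ℝ D x)) x := fun i =>
      (EuclideanSpace.proj (𝕜 := ℝ) (ι := Fin 3) i).hasFDerivAt.comp x hd
    have h0 := (hp 0).unique l.hasFDerivAt
    have h1 := (hp 1).unique
      ((hA.contDiffAt (hΩ₁.mem_nhds hx)).differentiableAt (by simp)).hasFDerivAt
    have h2 := (hp 2).unique (hw.differentiable (by simp) x).hasFDerivAt
    exact ⟨congrArg (fun T => T v) h0, congrArg (fun T => T v) h1, congrArg (fun T => T v) h2⟩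
  have hinj : Function.Injective (fderiv ℝ D q) := by
    rw [injective_iff_map_eq_zero]
    intro v hv
    obtain ⟨h0, h1, h2⟩ := hcoord q hq₁ v
    rw [hv] at h0 h1 h2
    have h0' : l v = 0 := h0.symm
    have h1' : fderiv ℝ A q v = 0 := h1.symm
    have h2' : fderiv ℝ w q v = 0 := h2.symm
    have h3 : β q v = 0 := by rw [hid q hq₃, h0', h2']; simp
    have h4 := hframe v
    rw [h0', h3, zero_smul, zero_smul, zero_add, add_zero] at h4
    rw [h4, map_smul, smul_eq_mul] at h1'
    rw [h4, (mul_eq_zero.1 h1').resolve_right hAe, zero_smul]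
  let D' : E3 ≃L[ℝ] E3 :=
    (LinearEquiv.ofInjectiveEndo (fderiv ℝ D q : E3 →ₗ[ℝ] E3) hinj).toContinuousLinearEquiv
  have hD' : HasFDerivAt D (D' : E3 →L[ℝ] E3) q := by
    have e : (D' : E3 →L[ℝ] E3) = fderiv ℝ D q := by ext v; rfl
    rw [e]
    exact ((hD q hq₁).differentiableAt (by simp)).hasFDerivAt
  let P := (hD q hq₁).toOpenPartialHomeomorph D hD' (by simp)
  have hPq : q ∈ P.source := (hD q hq₁).mem_toOpenPartialHomeomorph_source hD' (by simp)
  -- Shrinking to the points where the derivative is invertible makes the inverse smooth on the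
  -- whole target, not only at the image of `q`.
  let Ω₄ : Set E3 := Ω₃ ∩
    {x ∈ Ω₁ | fderiv ℝ D x ∈ range ((↑) : (E3 ≃L[ℝ] E3) → E3 →L[ℝ] E3)}
  have hDd : ContinuousOn (fderiv ℝ D) Ω₁ := fun x hx =>
    ((hD x hx).fderiv_right (m := ∞) (by simp)).continuousAt.continuousWithinAt
  have hΩ₄ : IsOpen Ω₄ :=
    hΩ₃.inter (hDd.isOpen_inter_preimage hΩ₁ ContinuousLinearEquiv.isOpen)
  have hq₄ : q ∈ Ω₄ := ⟨hq₃, hq₁, D', hD'.fderiv.symm⟩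
  have hsrc : (P.restrOpen Ω₄ hΩ₄).source = P.source ∩ Ω₄ := P.restrOpen_source Ω₄ hΩ₄
  refine ⟨P.restrOpen Ω₄ hΩ₄, ?_, ?_, ?_, ?_, fun x => rfl, ?_⟩
  · rw [hsrc]; exact ⟨hPq, hq₄⟩
  · rw [hsrc]; exact fun x hx => hx.2.2.1.1
  · rw [hsrc]; exact fun x hx => (hD x hx.2.2.1).contDiffWithinAt
  · intro z hz
    have hx := (P.restrOpen Ω₄ hΩ₄).map_target hz
    set x := (P.restrOpen Ω₄ hΩ₄).symm z with hxdef
    rw [hsrc] at hx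
    obtain ⟨T, hT⟩ := hx.2.2.2
    refine ((P.restrOpen Ω₄ hΩ₄).contDiffAt_symm (f₀' := T) hz ?_
      (hD x hx.2.2.1)).contDiffWithinAt
    rw [hT]
    exact ((hD x hx.2.2.1).differentiableAt (by simp)).hasFDerivAt
  · intro x hx
    rw [hsrc] at hx
    refine ⟨β x e₂ / fderiv ℝ w x e₂, div_pos hx.2.2.1.2 hx.2.1.2, fun v => ?_⟩
    obtain ⟨h0, h1, h2⟩ := hcoord x hx.2.2.1 v
    change _ = _ * (fderiv ℝ D x v 2 - A x * fderiv ℝ D x v 0)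
    rw [h0, h2]
    exact hid x hx.2.1 v

/-! ### Knots as periodic curves -/

/-- The angle `t₀ + arg (e^{-it₀} z)`, a smooth inverse of the exponential near `e^{it₀}`. -/
def localAngle (t₀ : ℝ) (z : Circle) : ℝ :=
  t₀ + Complex.arg ((z : ℂ) * (Circle.exp (-t₀) : ℂ))

theorem exp_localAngle (t₀ : ℝ) (z : Circle) : Circle.exp (localAngle t₀ z) = z := by
  unfold localAngle
  rw [Circle.exp_add, ← Circle.coe_mul, Circle.exp_arg, mul_comm, mul_assoc, ← Circle.exp_add]
  simp

theorem localAngle_exp_eventually (t₀ : ℝ) : ∀ᶠ t in 𝓝 t₀, localAngle t₀ (Circle.exp t) = t := by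
  filter_upwards [Ioo_mem_nhds (show t₀ - Real.pi < t₀ by linarith [Real.pi_pos])
    (show t₀ < t₀ + Real.pi by linarith [Real.pi_pos])] with t ht
  unfold localAngle
  rw [← Circle.coe_mul, ← Circle.exp_add, Circle.arg_exp (by linarith [ht.1]) (by linarith [ht.2])]
  ring

theorem contMDiffAt_localAngle (t₀ : ℝ) :
    ContMDiffAt (𝓡 1) 𝓘(ℝ, ℝ) ∞ (localAngle t₀) (Circle.exp t₀) := by
  have : Fact (Module.finrank ℝ ℂ = 1 + 1) := ⟨Complex.finrank_real_complex⟩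
  have h1 : ContMDiffAt (𝓡 1) 𝓘(ℝ, ℂ) ∞ (fun z : Circle => (z : ℂ)) (Circle.exp t₀) :=
    (contMDiff_coe_sphere (E := ℂ) (n := 1)).contMDiffAt
  have h2 : ContDiffAt ℝ ∞ (fun z : ℂ => t₀ + (Complex.log (z * (Circle.exp (-t₀) : ℂ))).im)
      (Circle.exp t₀ : ℂ) := by
    have hs : (Circle.exp t₀ : ℂ) * (Circle.exp (-t₀) : ℂ) ∈ Complex.slitPlane := by
      rw [← Circle.coe_mul, ← Circle.exp_add]; simp
    have h3 : ContDiffAt ℝ ∞ (fun z : ℂ => Complex.log (z * (Circle.exp (-t₀) : ℂ)))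
        (Circle.exp t₀ : ℂ) :=
      ContDiffAt.comp (g := Complex.log) (Circle.exp t₀ : ℂ)
        ((Complex.contDiffAt_log hs).restrict_scalars ℝ)
        (contDiffAt_id.mul contDiffAt_const)
    exact contDiffAt_const.add (Complex.imCLM.contDiff.contDiffAt.comp _ h3)
  have h3 := (contMDiffAt_iff_contDiffAt.2 h2).comp (Circle.exp t₀) h1
  refine h3.congr_of_eventuallyEq (Eventually.of_forall fun z => ?_)
  simp only [localAngle, Complex.log_im]
  rfl

/-- The velocity of a curve. -/
def vel (f : ℝ → M) (t : ℝ) : TangentSpace (𝓡 3) (f t) := mfderiv 𝓘(ℝ, ℝ) (𝓡 3) f t (1 : ℝ)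

/-- The value of a 1-form on the velocity of a curve. -/
def lev (α : ∀ x : M, TangentSpace (𝓡 3) x →L[ℝ] ℝ) (f : ℝ → M) (t : ℝ) : ℝ := α (f t) (vel f t)

theorem lev_congr {α : ∀ x : M, TangentSpace (𝓡 3) x →L[ℝ] ℝ} {f g : ℝ → M} {t : ℝ}
    (h : f =ᶠ[𝓝 t] g) : lev α f t = lev α g t := by
  have h1 := h.mfderiv_eq (I := 𝓘(ℝ, ℝ)) (I' := 𝓡 3)
  have h2 := h.self_of_nhds
  have key : ∀ (x y : M) (e : x = y) (A : ℝ →L[ℝ] E3) , α x (A 1) = α y (A 1) := by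
    rintro x _ rfl A; rfl
  unfold lev vel
  rw [h1]
  exact key _ _ h2 _

/-- A knot, as a `2π`-periodic curve. -/
structure PKnot (f : ℝ → M) : Prop where
  smooth : ContMDiff 𝓘(ℝ, ℝ) (𝓡 3) ∞ f
  periodic : Function.Periodic f (2 * Real.pi)
  inj : ∀ s t, f s = f t → Circle.exp s = Circle.exp t
  imm : ∀ t, vel f t ≠ 0

theorem eq_of_circleExp_eq {X : Type*} {f : ℝ → X} (hf : Function.Periodic f (2 * Real.pi)) {s t : ℝ}
    (h : Circle.exp s = Circle.exp t) : f s = f t := by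
  obtain ⟨m, hm⟩ := Circle.exp_eq_exp.1 h
  rw [hm]
  exact hf.int_mul m t

/-- The map on the circle induced by a periodic curve. -/
def descend (f : ℝ → M) (z : Circle) : M := f (Complex.arg z)

theorem descend_exp {f : ℝ → M} (hf : Function.Periodic f (2 * Real.pi)) (t : ℝ) :
    descend f (Circle.exp t) = f t :=
  eq_of_circleExp_eq hf (Circle.exp_arg _)

theorem descend_localAngle {f : ℝ → M} (hf : Function.Periodic f (2 * Real.pi)) (t₀ : ℝ)
    (z : Circle) : descend f z = f (localAngle t₀ z) :=
  eq_of_circleExp_eq hf ((Circle.exp_arg _).trans (exp_localAngle _ _).symm)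

theorem contMDiff_descend {f : ℝ → M} (hf : ContMDiff 𝓘(ℝ, ℝ) (𝓡 3) ∞ f)
    (hp : Function.Periodic f (2 * Real.pi)) : ContMDiff (𝓡 1) (𝓡 3) ∞ (descend f) := by
  intro z
  obtain ⟨t, rfl⟩ := Circle.exp_surjective z
  rw [show descend f = f ∘ localAngle t from funext (descend_localAngle hp t)]
  exact hf.contMDiffAt.comp _ (contMDiffAt_localAngle t)

/-- The exponential has the local left inverse `localAngle t`, so its differential is injective. -/
theorem mfderiv_circleExp_ne_zero (t : ℝ) :
    mfderiv 𝓘(ℝ, ℝ) (𝓡 1) (fun t => Circle.exp t) t (1 : ℝ) ≠ 0 := by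
  intro h
  have h1 : MDifferentiableAt 𝓘(ℝ, ℝ) (𝓡 1) (fun t => Circle.exp t) t :=
    (contMDiff_circleExp (m := ∞)).mdifferentiable (by simp) t
  have h2 : MDifferentiableAt (𝓡 1) 𝓘(ℝ, ℝ) (localAngle t) (Circle.exp t) :=
    (contMDiffAt_localAngle t).mdifferentiableAt (by simp)
  have h3 := mfderiv_comp t h2 h1
  have h4 : (localAngle t ∘ fun t => Circle.exp t) =ᶠ[𝓝 t] id := localAngle_exp_eventually t
  rw [h4.mfderiv_eq] at h3
  have h5 := congrArg (fun T : ℝ →L[ℝ] ℝ => T 1) h3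
  rw [mfderiv_id] at h5
  change (1 : ℝ) = mfderiv (𝓡 1) 𝓘(ℝ, ℝ) (localAngle t) (Circle.exp t)
    (mfderiv 𝓘(ℝ, ℝ) (𝓡 1) (fun t => Circle.exp t) t (1 : ℝ)) at h5
  rw [h, map_zero] at h5
  exact (one_ne_zero : (1 : ℝ) ≠ 0) h5

theorem tangent_circle_eq_smul (t : ℝ) (v : TangentSpace (𝓡 1) (Circle.exp t)) :
    ∃ r : ℝ, v = r • mfderiv 𝓘(ℝ, ℝ) (𝓡 1) (fun t => Circle.exp t) t (1 : ℝ) := by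
  have key : ∀ e v : EuclideanSpace ℝ (Fin 1), e ≠ 0 → ∃ r : ℝ, v = r • e := by
    intro e v he
    have h0 : e 0 ≠ 0 := by
      intro h; apply he; ext i; rw [Subsingleton.elim i 0]; exact h
    refine ⟨v 0 / e 0, ?_⟩
    ext i; rw [Subsingleton.elim i 0]
    simp [h0]
  exact key _ v (mfderiv_circleExp_ne_zero t)

theorem vel_comp_exp {γ : Circle → M} (hγ : ContMDiff (𝓡 1) (𝓡 3) ∞ γ) (t : ℝ) :
    vel (fun t => γ (Circle.exp t)) t =
      mfderiv (𝓡 1) (𝓡 3) γ (Circle.exp t)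
        (mfderiv 𝓘(ℝ, ℝ) (𝓡 1) (fun t => Circle.exp t) t (1 : ℝ)) := by
  have h1 : MDifferentiableAt 𝓘(ℝ, ℝ) (𝓡 1) (fun t => Circle.exp t) t :=
    (contMDiff_circleExp (m := ∞)).mdifferentiable (by simp) t
  have h2 : MDifferentiableAt (𝓡 1) (𝓡 3) γ (Circle.exp t) :=
    hγ.mdifferentiable (by simp) _
  exact congrArg (fun T : ℝ →L[ℝ] E3 => T 1) (mfderiv_comp t h2 h1)

theorem IsKnot.pKnot {γ : Circle → M} (hγ : IsKnot γ) : PKnot fun t => γ (Circle.exp t) where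
  smooth := hγ.smooth.comp contMDiff_circleExp
  periodic := fun t => by simp
  inj := fun s t h => hγ.isEmbedding.injective h
  imm := fun t h => by
    rw [vel_comp_exp hγ.smooth] at h
    exact mfderiv_circleExp_ne_zero t (hγ.immersion _ (h.trans (map_zero _).symm))

/-- The tangent line of the circle is spanned by the velocity of the exponential, which gives the
immersion. An injective continuous map from a compact space to a Hausdorff space is an embedding. -/
theorem PKnot.isKnot_of_comp [T2Space M] {γ : Circle → M} (hs : ContMDiff (𝓡 1) (𝓡 3) ∞ γ)
    (h : PKnot fun t => γ (Circle.exp t)) : IsKnot γ where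
  smooth := hs
  immersion := fun z => by
    obtain ⟨t, rfl⟩ := Circle.exp_surjective z
    rw [injective_iff_map_eq_zero]
    intro v hv
    obtain ⟨r, rfl⟩ := tangent_circle_eq_smul t v
    have h1 := h.imm t
    rw [vel_comp_exp hs] at h1
    have h2 : r • mfderiv (𝓡 1) (𝓡 3) γ (Circle.exp t)
        (mfderiv 𝓘(ℝ, ℝ) (𝓡 1) (fun t => Circle.exp t) t (1 : ℝ)) = 0 :=
      (map_smul _ _ _).symm.trans hv
    rcases smul_eq_zero.1 h2 with h3 | h3
    · rw [h3, zero_smul]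
    · exact absurd h3 h1
  isEmbedding := by
    refine (hs.continuous.isClosedEmbedding fun z w hzw => ?_).isEmbedding
    obtain ⟨t, rfl⟩ := Circle.exp_surjective z
    obtain ⟨s, rfl⟩ := Circle.exp_surjective w
    exact h.inj _ _ hzw

theorem PKnot.isKnot_descend [T2Space M] {f : ℝ → M} (h : PKnot f) : IsKnot (descend f) := by
  refine PKnot.isKnot_of_comp (contMDiff_descend h.smooth h.periodic) ?_
  rwa [show (fun t => descend f (Circle.exp t)) = f from funext (descend_exp h.periodic)]

theorem velocity_descend {f : ℝ → M} (hf : Function.Periodic f (2 * Real.pi))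
    (α : ∀ x : M, TangentSpace (𝓡 3) x →L[ℝ] ℝ) (t : ℝ) :
    α (descend f (Circle.exp t)) (velocity (descend f) t) = lev α f t := by
  change lev α (fun t => descend f (Circle.exp t)) t = _
  rw [show (fun t => descend f (Circle.exp t)) = f from funext (descend_exp hf)]

theorem PKnot.isLegendrianKnot_descend [T2Space M] {f : ℝ → M} (h : PKnot f)
    {α : ∀ x : M, TangentSpace (𝓡 3) x →L[ℝ] ℝ} {ξ : ∀ x : M, Submodule ℝ (TangentSpace (𝓡 3) x)}
    (hξ : ∀ (x : M) (v : TangentSpace (𝓡 3) x), v ∈ ξ x ↔ α x v = 0)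
    (hl : ∀ t, lev α f t = 0) : IsLegendrianKnot ξ (descend f) := by
  refine ⟨h.isKnot_descend, fun z v => ?_⟩
  obtain ⟨t, rfl⟩ := Circle.exp_surjective z
  obtain ⟨r, rfl⟩ := tangent_circle_eq_smul t v
  have h1 := velocity_descend h.periodic α t
  rw [hl] at h1
  have h2 := vel_comp_exp (contMDiff_descend h.smooth h.periodic) t
  have h3 : mfderiv (𝓡 1) (𝓡 3) (descend f) (Circle.exp t)
      (mfderiv 𝓘(ℝ, ℝ) (𝓡 1) (fun t => Circle.exp t) t (1 : ℝ)) ∈ ξ (descend f (Circle.exp t)) := by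
    rw [← h2, hξ]
    exact h1
  have h4 := (ξ (descend f (Circle.exp t))).smul_mem r h3
  have h5 := (mfderiv (𝓡 1) (𝓡 3) (descend f) (Circle.exp t)).map_smul r
    (mfderiv 𝓘(ℝ, ℝ) (𝓡 1) (fun t => Circle.exp t) t (1 : ℝ))
  rw [h5]
  exact h4

/-! ### Isotopies of periodic knots -/

/-- Isotopy of periodic knots, constant in time for `τ ≤ 0` and for `τ ≥ 1`. -/
def PIso (f g : ℝ → M) : Prop :=
  ∃ F : ℝ × ℝ → M, ContMDiff 𝓘(ℝ, ℝ × ℝ) (𝓡 3) ∞ F ∧ (∀ τ, PKnot fun t => F (τ, t)) ∧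
    (∀ τ ≤ 0, ∀ t, F (τ, t) = f t) ∧ ∀ τ, 1 ≤ τ → ∀ t, F (τ, t) = g t

theorem PIso.right {f g : ℝ → M} (h : PIso f g) : PKnot g := by
  obtain ⟨F, -, hF, -, h1⟩ := h
  rw [show g = fun t => F (1, t) from funext fun t => (h1 1 le_rfl t).symm]
  exact hF 1

theorem PIso.refl {f : ℝ → M} (h : PKnot f) : PIso f f :=
  ⟨fun x => f x.2, h.smooth.comp contDiff_snd.contMDiff, fun _ => h, fun _ _ _ => rfl,
    fun _ _ _ => rfl⟩

theorem PIso.trans {f g k : ℝ → M} (h₁ : PIso f g) (h₂ : PIso g k) : PIso f k := by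
  obtain ⟨F, hFs, hF, hF0, hF1⟩ := h₁
  obtain ⟨G, hGs, hG, hG0, hG1⟩ := h₂
  -- Both reparametrised isotopies rest at `g` for times in `(1/3, 2/3)`, so the formulas agree on
  -- an open overlap and the concatenation is smooth.
  let H : ℝ × ℝ → M := fun x => if x.1 < 1 / 2 then F (3 * x.1, x.2) else G (3 * x.1 - 2, x.2)
  have hH1 : ∀ x : ℝ × ℝ, x.1 < 2 / 3 → H x = F (3 * x.1, x.2) := by
    intro x hx
    by_cases h : x.1 < 1 / 2
    · simp only [H, if_pos h]
    · simp only [H, if_neg h]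
      rw [hG0 _ (by linarith), hF1 _ (by linarith)]
  have hH2 : ∀ x : ℝ × ℝ, 1 / 3 < x.1 → H x = G (3 * x.1 - 2, x.2) := by
    intro x hx
    by_cases h : x.1 < 1 / 2
    · simp only [H, if_pos h]
      rw [hG0 _ (by linarith), hF1 _ (by linarith)]
    · simp only [H, if_neg h]
  refine ⟨H, fun x => ?_, fun τ => ?_, fun τ hτ t => ?_, fun τ hτ t => ?_⟩
  · rcases lt_or_ge x.1 (2 / 3) with hx | hx
    · have h1 : H =ᶠ[𝓝 x] F ∘ fun x => (3 * x.1, x.2) := by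
        filter_upwards [(isOpen_lt continuous_fst continuous_const).mem_nhds hx] with y hy
          using hH1 y hy
      exact (hFs.comp (ContDiff.contMDiff (by fun_prop))).contMDiffAt.congr_of_eventuallyEq h1
    · have h1 : H =ᶠ[𝓝 x] G ∘ fun x => (3 * x.1 - 2, x.2) := by
        filter_upwards [(isOpen_lt continuous_const continuous_fst).mem_nhds
          (show (1 / 3 : ℝ) < x.1 by linarith)] with y hy using hH2 y hy
      exact (hGs.comp (ContDiff.contMDiff (by fun_prop))).contMDiffAt.congr_of_eventuallyEq h1
  · rcases lt_or_ge τ (2 / 3) with hx | hx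
    · rw [show (fun t => H (τ, t)) = fun t => F (3 * τ, t) from funext fun t => hH1 _ hx]
      exact hF _
    · rw [show (fun t => H (τ, t)) = fun t => G (3 * τ - 2, t) from
        funext fun t => hH2 _ (show 1 / 3 < τ by linarith)]
      exact hG _
  · rw [hH1 _ (show τ < 2 / 3 by linarith)]
    exact hF0 _ (show 3 * τ ≤ 0 by linarith) t
  · rw [hH2 _ (show 1 / 3 < τ by linarith)]
    exact hG1 _ (show 1 ≤ 3 * τ - 2 by linarith) t

theorem PIso.isotopicKnots [T2Space M] {f g : ℝ → M} (h : PIso f g) :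
    IsotopicKnots (descend f) (descend g) := by
  obtain ⟨F, hFs, hF, hF0, hF1⟩ := h
  have e : ∀ τ t₀ (z : Circle), F (τ, Complex.arg z) = F (τ, localAngle t₀ z) := fun τ t₀ z =>
    descend_localAngle (hF τ).periodic t₀ z
  refine ⟨fun x => F (x.1, Complex.arg x.2), fun x _ => ?_, fun τ _ => ?_, fun z => ?_, fun z => ?_⟩
  · obtain ⟨τ, z⟩ := x
    obtain ⟨t₀, rfl⟩ := Circle.exp_surjective z
    have h1 : ContMDiffAt (𝓘(ℝ, ℝ).prod (𝓡 1)) 𝓘(ℝ, ℝ × ℝ) ∞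
        (fun x : ℝ × Circle => (x.1, localAngle t₀ x.2)) (τ, Circle.exp t₀) :=
      contMDiffAt_fst.prodMk_space (ContMDiffAt.comp (g := localAngle t₀) (τ, Circle.exp t₀)
        (contMDiffAt_localAngle t₀) contMDiffAt_snd)
    have h2 := hFs.contMDiffAt.comp _ h1
    rw [show (fun x : ℝ × Circle => F (x.1, Complex.arg x.2)) =
      F ∘ fun x : ℝ × Circle => (x.1, localAngle t₀ x.2) from funext fun x => e _ _ _]
    exact h2.contMDiffWithinAt
  · exact (hF τ).isKnot_descend
  · exact hF0 0 le_rfl _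
  · exact hF1 1 le_rfl _

/-! ### Charts, and the contact form along a curve -/

/-- A smooth coordinate chart of `M`. -/
structure IsSmoothChart (Φ : OpenPartialHomeomorph M E3) : Prop where
  smooth : ContMDiffOn (𝓡 3) 𝓘(ℝ, E3) ∞ Φ Φ.source
  smooth_symm : ContMDiffOn 𝓘(ℝ, E3) (𝓡 3) ∞ Φ.symm Φ.target

/-- The differential of a coordinate of a chart. -/
def dcoord (Φ : OpenPartialHomeomorph M E3) (i : Fin 3) (p : M) : TangentSpace (𝓡 3) p →L[ℝ] ℝ :=
  (EuclideanSpace.proj (𝕜 := ℝ) (ι := Fin 3) i).comp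
    (mfderiv (𝓡 3) 𝓘(ℝ, E3) Φ p : E3 →L[ℝ] E3)

/-- A chart `(x, y, z)` in which `α` is a positive multiple of `dz - y dx`. -/
structure IsDarboux (α : ∀ x : M, TangentSpace (𝓡 3) x →L[ℝ] ℝ)
    (Φ : OpenPartialHomeomorph M E3) : Prop extends IsSmoothChart Φ where
  form : ∀ p ∈ Φ.source, ∃ G : ℝ, 0 < G ∧ ∀ v : TangentSpace (𝓡 3) p,
    α p v = G * (dcoord Φ 2 p v - Φ p 1 * dcoord Φ 0 p v)

theorem deriv_coord {c : ℝ → E3} {t : ℝ} (hc : DifferentiableAt ℝ c t) (i : Fin 3) :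
    deriv (fun t => c t i) t = deriv c t i :=
  ((EuclideanSpace.proj (𝕜 := ℝ) (ι := Fin 3) i).hasFDerivAt.comp_hasDerivAt t
    hc.hasDerivAt).deriv

section Chart

variable {Φ : OpenPartialHomeomorph M E3} {f g : ℝ → M} {t : ℝ}

theorem IsSmoothChart.contDiffAt_comp (hΦ : IsSmoothChart Φ)
    (hf : ContMDiffAt 𝓘(ℝ, ℝ) (𝓡 3) ∞ f t) (ht : f t ∈ Φ.source) :
    ContDiffAt ℝ ∞ (fun t => Φ (f t)) t :=
  contMDiffAt_iff_contDiffAt.1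
    ((hΦ.smooth.contMDiffAt (Φ.open_source.mem_nhds ht)).comp t hf)

theorem IsSmoothChart.deriv_comp (hΦ : IsSmoothChart Φ)
    (hf : ContMDiffAt 𝓘(ℝ, ℝ) (𝓡 3) ∞ f t) (ht : f t ∈ Φ.source) :
    deriv (fun t => Φ (f t)) t = mfderiv (𝓡 3) 𝓘(ℝ, E3) Φ (f t) (vel f t) := by
  have h1 : MDifferentiableAt (𝓡 3) 𝓘(ℝ, E3) Φ (f t) :=
    (hΦ.smooth.contMDiffAt (Φ.open_source.mem_nhds ht)).mdifferentiableAt (by simp)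
  have h2 := mfderiv_comp t h1 (hf.mdifferentiableAt (by simp))
  rw [mfderiv_eq_fderiv] at h2
  exact congrArg (fun T : ℝ →L[ℝ] E3 => T 1) h2

theorem IsSmoothChart.deriv_coord_comp (hΦ : IsSmoothChart Φ)
    (hf : ContMDiffAt 𝓘(ℝ, ℝ) (𝓡 3) ∞ f t) (ht : f t ∈ Φ.source) (i : Fin 3) :
    deriv (fun t => Φ (f t) i) t = dcoord Φ i (f t) (vel f t) := by
  have hd := (hΦ.contDiffAt_comp hf ht).differentiableAt (by simp)
  rw [deriv_coord hd, hΦ.deriv_comp hf ht]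
  rfl

theorem IsSmoothChart.vel_ne_zero (hΦ : IsSmoothChart Φ)
    (hf : ContMDiffAt 𝓘(ℝ, ℝ) (𝓡 3) ∞ f t) (ht : f t ∈ Φ.source)
    (h : deriv (fun t => Φ (f t)) t ≠ 0) : vel f t ≠ 0 := by
  intro h0
  rw [hΦ.deriv_comp hf ht, h0] at h
  exact h (map_zero _)

theorem IsDarboux.lev {α : ∀ x : M, TangentSpace (𝓡 3) x →L[ℝ] ℝ} (hΦ : IsDarboux α Φ)
    (hf : ContMDiffAt 𝓘(ℝ, ℝ) (𝓡 3) ∞ f t) (ht : f t ∈ Φ.source) :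
    ∃ G : ℝ, 0 < G ∧ lev α f t =
      G * (deriv (fun t => Φ (f t) 2) t - Φ (f t) 1 * deriv (fun t => Φ (f t) 0) t) := by
  obtain ⟨G, hG, h⟩ := hΦ.form (f t) ht
  refine ⟨G, hG, ?_⟩
  rw [hΦ.deriv_coord_comp hf ht, hΦ.deriv_coord_comp hf ht]
  exact h _

end Chart

theorem vel_ne_zero_of_periodic {f : ℝ → M} (hf : ContMDiff 𝓘(ℝ, ℝ) (𝓡 3) ∞ f)
    {a : ℝ} (hp : ∀ t, f (t + a) = f t) {t : ℝ} (h : vel f (t + a) ≠ 0) : vel f t ≠ 0 := by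
  have h1 : MDifferentiableAt 𝓘(ℝ, ℝ) (𝓡 3) f (t + a) := hf.mdifferentiable (by simp) _
  have h2 : MDifferentiableAt 𝓘(ℝ, ℝ) 𝓘(ℝ, ℝ) (fun t => t + a) t :=
    (differentiableAt_id.add_const a).mdifferentiableAt
  have h3 := mfderiv_comp t h1 h2
  rw [show f ∘ (fun t => t + a) = f from funext hp, mfderiv_eq_fderiv, fderiv_add_const,
    fderiv_fun_id] at h3
  exact fun h4 => h ((congrArg (fun T : ℝ →L[ℝ] E3 => T 1) h3).symm.trans h4)

theorem lev_eq_of_periodic {α : ∀ x : M, TangentSpace (𝓡 3) x →L[ℝ] ℝ} {f : ℝ → M}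
    (hf : ContMDiff 𝓘(ℝ, ℝ) (𝓡 3) ∞ f)
    {a : ℝ} (hp : ∀ t, f (t + a) = f t) (t : ℝ) : lev α f (t + a) = lev α f t := by
  have h1 : MDifferentiableAt 𝓘(ℝ, ℝ) (𝓡 3) f (t + a) := hf.mdifferentiable (by simp) _
  have h2 : MDifferentiableAt 𝓘(ℝ, ℝ) 𝓘(ℝ, ℝ) (fun t => t + a) t :=
    (differentiableAt_id.add_const a).mdifferentiableAt
  have h3 := mfderiv_comp t h1 h2
  rw [show f ∘ (fun t => t + a) = f from funext hp, mfderiv_eq_fderiv, fderiv_add_const,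
    fderiv_fun_id] at h3
  have h4 : (vel f t : E3) = vel f (t + a) := congrArg (fun T : ℝ →L[ℝ] E3 => T 1) h3
  have key : ∀ (x y : M) (e : x = y) (v w : E3) (e' : v = w), α x v = α y w := by
    rintro x _ rfl v _ rfl; rfl
  exact key _ _ (hp t) _ _ h4.symm

/-! ### Local modifications of a knot -/

/-- The periodic curve equal to `u` on `[p, q)` and to `f` on `[q, p + 2π)`. -/
def splice {X : Type*} (p q : ℝ) (u f : ℝ → X) (t : ℝ) : X :=
  if toIcoMod Real.two_pi_pos p t < q then u (toIcoMod Real.two_pi_pos p t) else f t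

section Splice

variable {X : Type*} {p q t : ℝ} {u f : ℝ → X}

theorem toIcoMod_two_pi_eq (h : t ∈ Ico p (p + 2 * Real.pi)) :
    toIcoMod Real.two_pi_pos p t = t :=
  (toIcoMod_eq_self _).2 h

theorem splice_of_mem (hq : q ≤ p + 2 * Real.pi) (ht : t ∈ Ico p q) : splice p q u f t = u t := by
  rw [splice, toIcoMod_two_pi_eq ⟨ht.1, ht.2.trans_le hq⟩, if_pos ht.2]

theorem splice_of_le (hq : p ≤ q) (ht : t ∈ Ico q (p + 2 * Real.pi)) :
    splice p q u f t = f t := by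
  rw [splice, toIcoMod_two_pi_eq ⟨hq.trans ht.1, ht.2⟩, if_neg (not_lt.2 ht.1)]

theorem splice_periodic (hf : Function.Periodic f (2 * Real.pi)) :
    Function.Periodic (splice p q u f) (2 * Real.pi) := by
  intro t
  unfold splice
  rw [toIcoMod_add_right, hf]

theorem exists_int_mem_Ico (p t : ℝ) : ∃ k : ℤ,
    t + k * (2 * Real.pi) ∈ Ico p (p + 2 * Real.pi) := by
  refine ⟨-toIcoDiv Real.two_pi_pos p t, ?_⟩
  have := sub_toIcoDiv_zsmul_mem_Ico Real.two_pi_pos p t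
  push_cast
  rw [zsmul_eq_mul] at this
  rwa [neg_mul, ← sub_eq_add_neg]

theorem exists_int_mem_Ioo_or_Icc {p q : ℝ} (hq : q < p + 2 * Real.pi) (t : ℝ) :
    ∃ k : ℤ, t + k * (2 * Real.pi) ∈ Ioo p q ∨
      t + k * (2 * Real.pi) ∈ Icc q (p + 2 * Real.pi) := by
  obtain ⟨k, hk⟩ := exists_int_mem_Ico p t
  rcases lt_or_ge (t + k * (2 * Real.pi)) q with h2 | h2
  · rcases eq_or_lt_of_le hk.1 with h1 | h1
    · refine ⟨k + 1, ?_⟩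
      push_cast
      exact Or.inr ⟨by linarith, by linarith⟩
    · exact ⟨k, Or.inl ⟨h1, h2⟩⟩
  · exact ⟨k, Or.inr ⟨h2, hk.2.le⟩⟩

/-- Since `u` agrees with `f` near both ends of `[p, q)`, the splice agrees with `f` on an open
interval around `[q, p + 2π]`; in particular there is no seam at the period. -/
theorem splice_eq_of_mem_Ioo {ε : ℝ} (hpq : p ≤ q) (hε : ε ≤ q - p) (hf : Function.Periodic f (2 * Real.pi))
    (hq : q < p + 2 * Real.pi) (hu : ∀ t ∈ Ico p q, t < p + ε ∨ q - ε < t → u t = f t)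
    (ht : t ∈ Ioo (q - ε) (p + ε + 2 * Real.pi)) : splice p q u f t = f t := by
  rcases lt_or_ge t (p + 2 * Real.pi) with h | h
  · rcases lt_or_ge t q with h' | h'
    · have hm : t ∈ Ico p q := ⟨by linarith [ht.1], h'⟩
      rw [splice_of_mem hq.le hm, hu t hm (Or.inr ht.1)]
    · exact splice_of_le hpq ⟨h', h⟩
  · obtain ⟨s, rfl⟩ : ∃ s, t = s + 2 * Real.pi := ⟨t - 2 * Real.pi, by ring⟩
    rw [splice_periodic hf, hf]
    have hm : s ∈ Ico p q := ⟨by linarith, by linarith [ht.2]⟩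
    rw [splice_of_mem hq.le hm, hu s hm (Or.inl (by linarith [ht.2]))]

end Splice

/-- Modulo `2π` the line is covered by two open intervals, on one of which the splice is `u` and on
the other `f`. -/
theorem contMDiff_splice {f : ℝ → M} (hf : ContMDiff 𝓘(ℝ, ℝ) (𝓡 3) ∞ f)
    (hp : Function.Periodic f (2 * Real.pi)) {p q ε : ℝ} (hε : 0 < ε) (hεpq : ε ≤ q - p)
    (hq : q < p + 2 * Real.pi) {u : ℝ × ℝ → M}
    (hu : ∀ τ, ∀ t ∈ Ioo p q, ContMDiffAt 𝓘(ℝ, ℝ × ℝ) (𝓡 3) ∞ u (τ, t))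
    (huf : ∀ τ, ∀ t ∈ Ico p q, t < p + ε ∨ q - ε < t → u (τ, t) = f t) :
    ContMDiff 𝓘(ℝ, ℝ × ℝ) (𝓡 3) ∞ fun x : ℝ × ℝ => splice p q (fun t => u (x.1, t)) f x.2 := by
  set F := fun x : ℝ × ℝ => splice p q (fun t => u (x.1, t)) f x.2 with hF
  rintro ⟨τ, t⟩
  obtain ⟨k, hk⟩ := exists_int_mem_Ico p t
  have hshift : F = F ∘ fun x : ℝ × ℝ => (x.1, x.2 + k * (2 * Real.pi)) := by
    funext x
    exact ((splice_periodic hp).int_mul k _).symm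
  rw [hshift]
  refine ContMDiffAt.comp (τ, t) (I' := 𝓘(ℝ, ℝ × ℝ)) ?_
    (ContDiff.contMDiff (by fun_prop)).contMDiffAt
  change ContMDiffAt 𝓘(ℝ, ℝ × ℝ) (𝓡 3) ∞ F (τ, t + k * (2 * Real.pi))
  generalize t + k * (2 * Real.pi) = r at hk
  have hpq : p < q := by linarith
  have hff : ContMDiff 𝓘(ℝ, ℝ × ℝ) (𝓡 3) ∞ fun x : ℝ × ℝ => f x.2 :=
    hf.comp contDiff_snd.contMDiff
  by_cases h1 : r ∈ Ioo p q
  · refine (hu τ r h1).congr_of_eventuallyEq ?_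
    have : ∀ᶠ x : ℝ × ℝ in 𝓝 (τ, r), x.2 ∈ Ioo p q :=
      continuous_snd.continuousAt.eventually (isOpen_Ioo.mem_nhds h1)
    filter_upwards [this] with x hx
    exact splice_of_mem hq.le ⟨hx.1.le, hx.2⟩
  · have h2 : ∃ k : ℤ, r + k * (2 * Real.pi) ∈ Ioo (q - ε) (p + ε + 2 * Real.pi) := by
      by_cases h3 : q ≤ r
      · exact ⟨0, by simp; constructor <;> linarith [hk.2]⟩
      · have : r = p := by
          by_contra hne
          exact h1 ⟨lt_of_le_of_ne hk.1 (Ne.symm hne), not_le.1 h3⟩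
        exact ⟨1, by subst this; simp; constructor <;> linarith⟩
    obtain ⟨k, hk'⟩ := h2
    refine hff.contMDiffAt.congr_of_eventuallyEq ?_
    have : ∀ᶠ x : ℝ × ℝ in 𝓝 (τ, r), x.2 + k * (2 * Real.pi) ∈
        Ioo (q - ε) (p + ε + 2 * Real.pi) :=
      (by fun_prop : Continuous fun x : ℝ × ℝ => x.2 + k * (2 * Real.pi)).continuousAt.eventually
        (isOpen_Ioo.mem_nhds hk')
    filter_upwards [this] with x hx
    have e1 : F x = F (x.1, x.2 + k * (2 * Real.pi)) := ((splice_periodic hp).int_mul k _).symm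
    have e2 : f (x.2 + k * (2 * Real.pi)) = f x.2 := hp.int_mul k _
    rw [e1, ← e2]
    exact splice_eq_of_mem_Ioo hpq.le hεpq hp hq (huf x.1) hx

/-- A family of local modifications of a periodic knot inside a chart, supported in a parameter
interval, is an isotopy if a suitable function increases along the modified pieces. -/
theorem PKnot.exists_move {f : ℝ → M} (hf : PKnot f) {Φ : OpenPartialHomeomorph M E3}
    (hΦ : IsSmoothChart Φ) {p q ε : ℝ} (hε : 0 < ε) (hεpq : ε ≤ q - p)
    (hq : q < p + 2 * Real.pi) {G : ℝ × ℝ → E3} {W : Set E3} {h : E3 → ℝ}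
    (hG : ∀ θ ∈ Icc (0 : ℝ) 1, ∀ t ∈ Ioo p q, ContDiffAt ℝ ∞ G (θ, t))
    (hGW : ∀ θ ∈ Icc (0 : ℝ) 1, ∀ t ∈ Ioo p q, G (θ, t) ∈ W) (hW : W ⊆ Φ.target)
    (hGf : ∀ θ ∈ Icc (0 : ℝ) 1, ∀ t ∈ Ico p q, t < p + ε ∨ q - ε < t → Φ.symm (G (θ, t)) = f t)
    (hG0 : ∀ t ∈ Ioo p q, Φ.symm (G (0, t)) = f t)
    (hfW : ∀ t ∈ Icc q (p + 2 * Real.pi), ∀ v ∈ W, Φ.symm v ≠ f t) (hh : Differentiable ℝ h)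
    (hhG : ∀ θ ∈ Icc (0 : ℝ) 1, ∀ t ∈ Ioo p q, 0 < deriv (fun t => h (G (θ, t))) t) :
    ∃ F : ℝ × ℝ → M, ContMDiff 𝓘(ℝ, ℝ × ℝ) (𝓡 3) ∞ F ∧ (∀ τ, PKnot fun t => F (τ, t)) ∧
      (∀ τ ≤ 0, ∀ t, F (τ, t) = f t) ∧ (∀ τ, 1 ≤ τ → ∀ t, F (τ, t) = F (1, t)) ∧
      (∀ τ, ∀ t ∈ Ioo p q, F (τ, t) = Φ.symm (G (Real.smoothTransition τ, t))) ∧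
      ∀ τ, ∀ t ∈ Ioo (q - ε) (p + ε + 2 * Real.pi), F (τ, t) = f t := by
  have hpq : p < q := by linarith
  -- Passing through `S` extends the homotopy, given only for `θ ∈ [0, 1]`, to all times, constant
  -- before `0` and after `1`.
  let S := Real.smoothTransition
  have hS : ∀ τ, S τ ∈ Icc (0 : ℝ) 1 := fun τ =>
    ⟨Real.smoothTransition.nonneg τ, Real.smoothTransition.le_one τ⟩
  let u : ℝ × ℝ → M := fun x => Φ.symm (G (S x.1, x.2))
  let F : ℝ × ℝ → M := fun x => splice p q (fun t => u (x.1, t)) f x.2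
  have hFs : ContMDiff 𝓘(ℝ, ℝ × ℝ) (𝓡 3) ∞ F := by
    refine contMDiff_splice hf.smooth hf.periodic hε hεpq hq (fun τ t ht => ?_)
      fun τ => hGf _ (hS τ)
    have h1 : ContDiffAt ℝ ∞ (fun x : ℝ × ℝ => G (S x.1, x.2)) (τ, t) :=
      ContDiffAt.comp (g := G) (f := fun x : ℝ × ℝ => (S x.1, x.2)) (τ, t) (hG _ (hS τ) t ht)
        ((Real.smoothTransition.contDiff.comp contDiff_fst).prodMk contDiff_snd).contDiffAt
    exact (hΦ.smooth_symm.contMDiffAt (Φ.open_target.mem_nhds (hW (hGW _ (hS τ) t ht)))).comp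
      (τ, t) h1.contMDiffAt
  have hFp : ∀ τ, Function.Periodic (fun t => F (τ, t)) (2 * Real.pi) := fun τ =>
    splice_periodic (u := fun t => u (τ, t)) hf.periodic
  have hFu : ∀ τ, ∀ t ∈ Ioo p q, F (τ, t) = u (τ, t) := fun τ t ht =>
    splice_of_mem hq.le ⟨ht.1.le, ht.2⟩
  have hFf : ∀ τ, ∀ t ∈ Ioo (q - ε) (p + ε + 2 * Real.pi), F (τ, t) = f t := fun τ t ht =>
    splice_eq_of_mem_Ioo hpq.le hεpq hf.periodic hq (hGf _ (hS τ)) ht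
  have hcase := exists_int_mem_Ioo_or_Icc hq
  have hFfI : ∀ τ, ∀ t ∈ Icc q (p + 2 * Real.pi), F (τ, t) = f t := fun τ t ht =>
    hFf τ t ⟨by linarith [ht.1], by linarith [ht.2]⟩
  have hsm : ∀ τ, ContMDiff 𝓘(ℝ, ℝ) (𝓡 3) ∞ fun t => F (τ, t) := fun τ =>
    hFs.comp (contDiff_prodMk_right τ).contMDiff
  have hend : ∀ τ τ', S τ = S τ' → ∀ t, F (τ, t) = F (τ', t) := by
    intro τ τ' h t
    simp only [F, u, h]
  refine ⟨F, hFs, fun τ => ⟨hsm τ, hFp τ, fun s t hst => ?_, fun t => ?_⟩, fun τ hτ t => ?_,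
    fun τ hτ => hend _ _ ?_, hFu, hFf⟩
  -- Injectivity: two moved points are separated by `h`, a moved and an unmoved point by `hfW`, and
  -- two unmoved points by the injectivity of `f`.
  · have hmono : StrictMonoOn (fun t => h (G (S τ, t))) (Ioo p q) := by
      refine strictMonoOn_of_deriv_pos (convex_Ioo p q) (fun t ht => ?_) fun t ht => ?_
      · exact (differentiableAt_of_deriv_ne_zero
          (hhG _ (hS τ) t ht).ne').continuousAt.continuousWithinAt
      · rw [interior_Ioo] at ht
        exact hhG _ (hS τ) t ht
    obtain ⟨k, hk⟩ := hcase s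
    obtain ⟨l, hl⟩ := hcase t
    have e1 : F (τ, s + k * (2 * Real.pi)) = F (τ, s) := (hFp τ).int_mul k s
    have e2 : F (τ, t + l * (2 * Real.pi)) = F (τ, t) := (hFp τ).int_mul l t
    have e3 := Circle.periodic_exp.int_mul k s
    have e4 := Circle.periodic_exp.int_mul l t
    change F (τ, s) = F (τ, t) at hst
    rw [← e1, ← e2] at hst
    rw [← e3, ← e4]
    generalize s + k * (2 * Real.pi) = s at *
    generalize t + l * (2 * Real.pi) = t at *
    rcases hk with hk | hk <;> rcases hl with hl | hl
    · rw [hFu τ s hk, hFu τ t hl] at hst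
      have := Φ.symm.injOn (hW (hGW _ (hS τ) s hk)) (hW (hGW _ (hS τ) t hl)) hst
      rw [hmono.injOn hk hl (congrArg h this)]
    · rw [hFu τ s hk, hFfI τ t hl] at hst
      exact absurd hst (hfW t hl _ (hGW _ (hS τ) s hk))
    · rw [hFu τ t hl, hFfI τ s hk] at hst
      exact absurd hst.symm (hfW s hk _ (hGW _ (hS τ) t hl))
    · rw [hFfI τ s hk, hFfI τ t hl] at hst
      exact hf.inj _ _ hst
  · obtain ⟨k, hk⟩ := hcase t
    refine vel_ne_zero_of_periodic (hsm τ) (fun t => (hFp τ).int_mul k t) ?_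
    generalize t + k * (2 * Real.pi) = t at *
    rcases hk with hk | hk
    · have hsrc : F (τ, t) ∈ Φ.source := by
        rw [hFu τ t hk]
        exact Φ.map_target (hW (hGW _ (hS τ) t hk))
      refine hΦ.vel_ne_zero (hsm τ).contMDiffAt hsrc ?_
      have e : (fun t => Φ (F (τ, t))) =ᶠ[𝓝 t] fun t => G (S τ, t) := by
        filter_upwards [isOpen_Ioo.mem_nhds hk] with t' ht'
        rw [hFu τ t' ht']
        exact Φ.right_inv (hW (hGW _ (hS τ) t' ht'))
      rw [e.deriv_eq]
      -- A zero velocity would give `h ∘ G` a zero derivative.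
      intro h0
      have hd : DifferentiableAt ℝ (fun t => G (S τ, t)) t :=
        ((hG _ (hS τ) t hk).differentiableAt (by simp)).comp t
          ((contDiff_prodMk_right (n := ∞) (S τ)).differentiable (by simp) t)
      have h1 := (hh (G (S τ, t))).hasFDerivAt.comp_hasDerivAt t hd.hasDerivAt
      rw [h0, map_zero] at h1
      exact (hhG _ (hS τ) t hk).ne' h1.deriv
    · have e : (fun t => F (τ, t)) =ᶠ[𝓝 t] f := by
        filter_upwards [isOpen_Ioo.mem_nhds (show t ∈ Ioo (q - ε) (p + ε + 2 * Real.pi) from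
          ⟨by linarith [hk.1], by linarith [hk.2]⟩)] with t' ht' using hFf τ t' ht'
      unfold vel
      rw [e.mfderiv_eq]
      exact hf.imm t
  · obtain ⟨k, hk⟩ := hcase t
    rw [← show F (τ, t + k * (2 * Real.pi)) = F (τ, t) from (hFp τ).int_mul k t,
      ← hf.periodic.int_mul k t]
    generalize t + k * (2 * Real.pi) = t at *
    rcases hk with hk | hk
    · simp only [hFu τ t hk, u, S, Real.smoothTransition.zero_of_nonpos hτ, hG0 t hk]
    · exact hFfI τ t hk
  · simp only [S]
    rw [Real.smoothTransition.one_of_one_le hτ, Real.smoothTransition.one_of_one_le le_rfl]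

/-! ### Tubes around a piece of a knot in a chart -/

theorem exists_Icc_subset_of_isOpen {U : Set ℝ} (hU : IsOpen U) {a b : ℝ} (hab : a ≤ b)
    (h : Icc a b ⊆ U) : ∃ ε > 0, Icc (a - ε) (b + ε) ⊆ U := by
  obtain ⟨ε, hε, hεU⟩ := isCompact_Icc.exists_cthickening_subset_open hU h
  refine ⟨ε, hε, fun t ht => hεU ?_⟩
  rcases lt_or_ge t a with h1 | h1
  · refine Metric.mem_cthickening_of_dist_le t a ε _ ⟨le_rfl, hab⟩ ?_
    rw [Real.dist_eq, abs_le]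
    constructor <;> linarith [ht.1]
  · rcases lt_or_ge b t with h2 | h2
    · refine Metric.mem_cthickening_of_dist_le t b ε _ ⟨hab, le_rfl⟩ ?_
      rw [Real.dist_eq, abs_le]
      constructor <;> linarith [ht.2]
    · refine Metric.mem_cthickening_of_dist_le t t ε _ ⟨h1, h2⟩ ?_
      rw [dist_self]
      exact hε.le

/-- The coordinate expression of a curve piece, extended to a smooth curve on the line. -/
theorem exists_chart_curve {f : ℝ → M} (hf : ContMDiff 𝓘(ℝ, ℝ) (𝓡 3) ∞ f)
    {Φ : OpenPartialHomeomorph M E3} (hΦ : IsSmoothChart Φ) {a b : ℝ} (hab : a ≤ b)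
    (h : ∀ t ∈ Icc a b, f t ∈ Φ.source) :
    ∃ c : ℝ → E3, ContDiff ℝ ∞ c ∧ ∃ ε > 0, ∀ t ∈ Icc (a - ε) (b + ε),
      f t ∈ Φ.source ∧ Φ (f t) = c t := by
  obtain ⟨ε, hε, hεs⟩ := exists_Icc_subset_of_isOpen
    (Φ.open_source.preimage hf.continuous) hab h
  let S := Real.smoothTransition
  -- A cut-off equal to one on `[a - ε/4, b + ε/4]` and zero outside `[a - ε/2, b + ε/2]`.
  let ψ : ℝ → ℝ := fun t => S ((t - (a - ε / 2)) / (ε / 4)) * S ((b + ε / 2 - t) / (ε / 4))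
  have hψ : ContDiff ℝ ∞ ψ := by
    refine ContDiff.mul ?_ ?_ <;> refine Real.smoothTransition.contDiff.comp ?_ <;> fun_prop
  refine ⟨fun t => ψ t • Φ (f t), ?_, ε / 4, by positivity, fun t ht => ?_⟩
  · rw [contDiff_iff_contDiffAt]
    intro t
    by_cases ht : t ∈ Ioo (a - ε) (b + ε)
    · exact hψ.contDiffAt.smul (hΦ.contDiffAt_comp hf.contMDiffAt (hεs ⟨ht.1.le, ht.2.le⟩))
    · have h0 : (fun t => ψ t • Φ (f t)) =ᶠ[𝓝 t] fun _ => 0 := by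
        have : t < a - ε / 2 ∨ b + ε / 2 < t := by
          by_contra! hc
          exact ht ⟨by linarith, by linarith⟩
        rcases this with h1 | h1
        · filter_upwards [Iio_mem_nhds h1] with s hs
          have : S ((s - (a - ε / 2)) / (ε / 4)) = 0 :=
            Real.smoothTransition.zero_of_nonpos
              (div_nonpos_of_nonpos_of_nonneg (by linarith [mem_Iio.1 hs]) (by positivity))
          simp [ψ, this]
        · filter_upwards [Ioi_mem_nhds h1] with s hs
          have : S ((b + ε / 2 - s) / (ε / 4)) = 0 :=
            Real.smoothTransition.zero_of_nonpos
              (div_nonpos_of_nonpos_of_nonneg (by linarith [mem_Ioi.1 hs]) (by positivity))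
          simp [ψ, this]
      exact contDiffAt_const.congr_of_eventuallyEq h0
  · refine ⟨hεs ⟨by linarith [ht.1], by linarith [ht.2]⟩, ?_⟩
    have h1 : S ((t - (a - ε / 2)) / (ε / 4)) = 1 := Real.smoothTransition.one_of_one_le
      ((one_le_div (by positivity)).2 (by linarith [ht.1]))
    have h2 : S ((b + ε / 2 - t) / (ε / 4)) = 1 := Real.smoothTransition.one_of_one_le
      ((one_le_div (by positivity)).2 (by linarith [ht.2]))
    simp [ψ, h1, h2]

/-- The graph of a periodic curve over the circle lies in `O`. -/
def GraphIn (O : Set (Circle × M)) (f : ℝ → M) : Prop := ∀ t, (Circle.exp t, f t) ∈ O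

/-- The `η`-neighbourhood of the piece over `[p, q]` of the curve `c` in a chart stays in the
chart, remains `O`-close to the knot, and, over the open range of the first coordinate, is
disjoint from the rest of the knot `f`. -/
def IsTube (O : Set (Circle × M)) (f : ℝ → M) (Φ : OpenPartialHomeomorph M E3) (c : ℝ → E3)
    (p q η : ℝ) : Prop :=
  ∀ t ∈ Icc p q, ∀ v, dist v (c t) < η → v ∈ Φ.target ∧ (Circle.exp t, Φ.symm v) ∈ O ∧
    (c p 0 < v 0 → v 0 < c q 0 → ∀ t' ∈ Icc q (p + 2 * Real.pi), Φ.symm v ≠ f t')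

theorem contDiff_coord_comp {c : ℝ → E3} (hc : ContDiff ℝ ∞ c) (i : Fin 3) :
    ContDiff ℝ ∞ fun t => c t i := (contDiff_coord i).comp hc

/-- The rest of the knot always touches the piece at its two ends, so no full neighbourhood can
avoid it. Restricting to the open range of the first coordinate removes this problem: just beyond
the ends that coordinate leaves the range, and the part farther away is compact and disjoint from
the piece. -/
theorem PKnot.exists_tube [T2Space M] {f : ℝ → M} (hf : PKnot f)
    {Φ : OpenPartialHomeomorph M E3} {p q : ℝ} (hpq : p < q)
    (hq : q < p + 2 * Real.pi) {c : ℝ → E3} (hc : ContDiff ℝ ∞ c) {δ : ℝ} (hδ : 0 < δ)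
    (hcf : ∀ t ∈ Icc (p - δ) (q + δ), f t ∈ Φ.source ∧ Φ (f t) = c t)
    (hx : ∀ t ∈ Icc p q, 0 < deriv (fun t => c t 0) t) {O : Set (Circle × M)} (hO : IsOpen O)
    (hfO : GraphIn O f) : ∃ η > 0, IsTube O f Φ c p q η := by
  have hc0 := contDiff_coord_comp hc 0
  obtain ⟨ε₀, hε₀, hε₀x⟩ := exists_Icc_subset_of_isOpen
    (isOpen_lt continuous_const (hc0.continuous_deriv (by simp))) hpq.le hx
  obtain ⟨ε, hε, hε1, hε2, hε3⟩ : ∃ ε > 0, ε ≤ ε₀ ∧ ε ≤ δ ∧ 2 * ε < p + 2 * Real.pi - q := by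
    refine ⟨min (min ε₀ δ) ((p + 2 * Real.pi - q) / 3), ?_, ?_, ?_, ?_⟩
    · exact lt_min (lt_min hε₀ hδ) (by linarith)
    · exact (min_le_left _ _).trans (min_le_left _ _)
    · exact (min_le_left _ _).trans (min_le_right _ _)
    · linarith [min_le_right (min ε₀ δ) ((p + 2 * Real.pi - q) / 3)]
  have hmono : StrictMonoOn (fun t => c t 0) (Icc (p - ε) (q + ε)) := by
    refine strictMonoOn_of_deriv_pos (convex_Icc _ _) hc0.continuous.continuousOn fun t ht => ?_
    rw [interior_Icc] at ht
    exact hε₀x ⟨by linarith [ht.1], by linarith [ht.2]⟩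
  -- The part of the knot far from the piece, avoided by compactness.
  let K : Set M := f '' Icc (q + ε) (p + 2 * Real.pi - ε)
  have hK : IsClosed K := (isCompact_Icc.image hf.smooth.continuous).isClosed
  let V : Set (ℝ × E3) := (univ ×ˢ Φ.target) ∩
    (fun x : ℝ × E3 => (Circle.exp x.1, Φ.symm x.2)) ⁻¹' (O ∩ (univ ×ˢ Kᶜ))
  have hV : IsOpen V := by
    refine ContinuousOn.isOpen_inter_preimage ?_ (isOpen_univ.prod Φ.open_target)
      (hO.inter (isOpen_univ.prod hK.isOpen_compl))
    refine ContinuousOn.prodMk (Circle.exp.continuous.comp continuous_fst).continuousOn ?_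
    exact Φ.continuousOn_symm.comp continuous_snd.continuousOn fun x hx => hx.2
  have hcV : (fun t => (t, c t)) '' Icc p q ⊆ V := by
    rintro _ ⟨t, ht, rfl⟩
    obtain ⟨h1, h2⟩ := hcf t ⟨by linarith [ht.1], by linarith [ht.2]⟩
    have h3 : Φ.symm (c t) = f t := by rw [← h2]; exact Φ.left_inv h1
    refine ⟨⟨mem_univ _, show c t ∈ Φ.target by rw [← h2]; exact Φ.map_source h1⟩, ?_⟩
    simp only [mem_preimage, h3]
    refine ⟨hfO t, mem_univ _, ?_⟩
    rintro ⟨s, hs, hst⟩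
    have h4 := hf.inj _ _ hst
    have h5 := Circle.exp_injOn_Ico (a := p) (b := p + 2 * Real.pi) (by linarith)
      ⟨by linarith [hs.1], by linarith [hs.2]⟩ ⟨ht.1, by linarith [ht.2]⟩ h4
    linarith [hs.1, ht.2]
  obtain ⟨η, hη, hηV⟩ := (isCompact_Icc.image
    (continuous_id.prodMk hc.continuous)).exists_thickening_subset_open hV hcV
  refine ⟨η, hη, fun t ht v hv => ?_⟩
  have hmem : (t, v) ∈ V := hηV (Metric.mem_thickening_iff.2
    ⟨(t, c t), ⟨t, ht, rfl⟩, by rw [Prod.dist_eq, dist_self]; exact max_lt hη hv⟩)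
  obtain ⟨⟨-, h1⟩, h2, -, h3⟩ := hmem
  refine ⟨h1, h2, fun hv1 hv2 t' ht' heq => ?_⟩
  -- Near the ends the knot is still in the chart and monotone, so meeting it there forces the first
  -- coordinate of `v` out of the open range.
  have key : ∀ s ∈ Icc (p - ε) (q + ε), Φ.symm v = f s → v 0 = c s 0 := by
    intro s hs h
    obtain ⟨h4, h5⟩ := hcf s ⟨by linarith [hs.1], by linarith [hs.2]⟩
    rw [← h5, ← h, Φ.right_inv h1]
  rcases lt_or_ge t' (q + ε) with h4 | h4
  · have h5 : t' ∈ Icc (p - ε) (q + ε) := ⟨by linarith [ht'.1], h4.le⟩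
    have h6 := key t' h5 heq
    have h7 : c q 0 ≤ c t' 0 := hmono.monotoneOn ⟨by linarith, by linarith⟩ h5 ht'.1
    linarith
  · rcases le_or_gt t' (p + 2 * Real.pi - ε) with h5 | h5
    · exact h3 ⟨t', ⟨h4, h5⟩, heq.symm⟩
    · have h6 : t' - 2 * Real.pi ∈ Icc (p - ε) (q + ε) :=
        ⟨by linarith, by linarith [ht'.2]⟩
      have h7 := key _ h6 (by rw [heq, hf.periodic.sub_eq])
      have h8 : c (t' - 2 * Real.pi) 0 ≤ c p 0 :=
        hmono.monotoneOn h6 ⟨by linarith, by linarith⟩ (by linarith [ht'.2])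
      linarith

/-- Moving a piece of a knot along which the first coordinate increases, keeping that
coordinate. -/
theorem PKnot.exists_graph_move {f : ℝ → M} (hf : PKnot f) {Φ : OpenPartialHomeomorph M E3}
    (hΦ : IsSmoothChart Φ) {p q ε : ℝ} (hε : 0 < ε) (hεpq : ε ≤ q - p)
    (hq : q < p + 2 * Real.pi) {O : Set (Circle × M)} (hfO : GraphIn O f)
    {c c' : ℝ → E3} (hc : ContDiff ℝ ∞ c) (hc' : ContDiff ℝ ∞ c')
    (hcf : ∀ t ∈ Icc p q, f t ∈ Φ.source ∧ Φ (f t) = c t)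
    (hx : ∀ t ∈ Icc p q, 0 < deriv (fun t => c t 0) t) {η : ℝ} (htube : IsTube O f Φ c p q η)
    (hx' : ∀ t, c' t 0 = c t 0) (hcc' : ∀ t ∈ Ico p q, t < p + ε ∨ q - ε < t → c' t = c t)
    (hdist : ∀ t ∈ Icc p q, dist (c' t) (c t) < η) :
    ∃ F : ℝ × ℝ → M, ContMDiff 𝓘(ℝ, ℝ × ℝ) (𝓡 3) ∞ F ∧ (∀ τ, PKnot fun t => F (τ, t)) ∧
      (∀ τ, GraphIn O fun t => F (τ, t)) ∧
      (∀ τ ≤ 0, ∀ t, F (τ, t) = f t) ∧ (∀ τ, 1 ≤ τ → ∀ t, F (τ, t) = F (1, t)) ∧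
      (∀ τ, ∀ t ∈ Ioo p q, F (τ, t) ∈ Φ.source ∧
        Φ (F (τ, t)) = c t + Real.smoothTransition τ • (c' t - c t)) ∧
      ∀ τ, ∀ t ∈ Ioo (q - ε) (p + ε + 2 * Real.pi), F (τ, t) = f t := by
  let G : ℝ × ℝ → E3 := fun x => c x.2 + x.1 • (c' x.2 - c x.2)
  have hc0 := contDiff_coord_comp hc 0
  have hG0 : ∀ x : ℝ × ℝ, G x 0 = c x.2 0 := fun x => by simp [G, hx']
  have hmono : StrictMonoOn (fun t => c t 0) (Icc p q) := by
    refine strictMonoOn_of_deriv_pos (convex_Icc _ _) hc0.continuous.continuousOn fun t ht => ?_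
    rw [interior_Icc] at ht
    exact hx t ⟨ht.1.le, ht.2.le⟩
  have hGd : ∀ θ ∈ Icc (0 : ℝ) 1, ∀ t ∈ Icc p q, dist (G (θ, t)) (c t) < η := by
    intro θ hθ t ht
    have h1 := hdist t ht
    rw [dist_eq_norm] at h1 ⊢
    simp only [G, add_sub_cancel_left, norm_smul, Real.norm_eq_abs, abs_of_nonneg hθ.1]
    nlinarith [hθ.2, norm_nonneg (c' t - c t)]
  have hpq : p < q := by linarith
  -- The tube cut by the open range of the first coordinate, which is where it misses the rest of
  -- the knot. The interpolation stays in it because the first coordinate is unchanged.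
  let W : Set E3 := {v | (∃ t ∈ Icc p q, dist v (c t) < η) ∧ c p 0 < v 0 ∧ v 0 < c q 0}
  have hGW : ∀ θ ∈ Icc (0 : ℝ) 1, ∀ t ∈ Ioo p q, G (θ, t) ∈ W := by
    intro θ hθ t ht
    refine ⟨⟨t, ⟨ht.1.le, ht.2.le⟩, hGd θ hθ t ⟨ht.1.le, ht.2.le⟩⟩, ?_, ?_⟩ <;> rw [hG0]
    · exact hmono ⟨le_rfl, hpq.le⟩ ⟨ht.1.le, ht.2.le⟩ ht.1
    · exact hmono ⟨ht.1.le, ht.2.le⟩ ⟨hpq.le, le_rfl⟩ ht.2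
  have hcf' : ∀ t ∈ Icc p q, Φ.symm (c t) = f t := fun t ht => by
    rw [← (hcf t ht).2]; exact Φ.left_inv (hcf t ht).1
  have hWt : W ⊆ Φ.target := by
    rintro v ⟨⟨s, hs, hsv⟩, -⟩
    exact (htube s hs v hsv).1
  have hGs : ContDiff ℝ ∞ G := (hc.comp contDiff_snd).add (contDiff_fst.smul
    ((hc'.comp contDiff_snd).sub (hc.comp contDiff_snd)))
  have hG1 : ∀ θ ∈ Icc (0 : ℝ) 1, ∀ t ∈ Ico p q, t < p + ε ∨ q - ε < t →
      Φ.symm (G (θ, t)) = f t := by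
    intro θ _ t ht hte
    simp only [G, hcc' t ht hte, sub_self, smul_zero, add_zero]
    exact hcf' t ⟨ht.1, ht.2.le⟩
  have hG2 : ∀ t ∈ Ioo p q, Φ.symm (G (0, t)) = f t := by
    intro t ht
    simp only [G, zero_smul, add_zero]
    exact hcf' t ⟨ht.1.le, ht.2.le⟩
  have hfW : ∀ t ∈ Icc q (p + 2 * Real.pi), ∀ v ∈ W, Φ.symm v ≠ f t := by
    rintro t ht v ⟨⟨s, hs, hsv⟩, hv1, hv2⟩
    exact (htube s hs v hsv).2.2 hv1 hv2 t ht
  have hG3 : ∀ θ ∈ Icc (0 : ℝ) 1, ∀ t ∈ Ioo p q, 0 < deriv (fun t => G (θ, t) 0) t := by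
    intro θ _ t ht
    simp only [hG0]
    exact hx t ⟨ht.1.le, ht.2.le⟩
  obtain ⟨F, hF1, hF2, hF3, hF4, hF5, hF6⟩ := hf.exists_move hΦ hε hεpq hq
    (h := fun v => v 0) (fun θ _ t _ => hGs.contDiffAt) hGW hWt hG1 hG2 hfW
    ((contDiff_coord (n := ∞) 0).differentiable (by simp)) hG3
  have hF7 : ∀ τ, ∀ t ∈ Ioo p q, G (Real.smoothTransition τ, t) ∈ W := fun τ t ht =>
    hGW _ ⟨Real.smoothTransition.nonneg τ, Real.smoothTransition.le_one τ⟩ t ht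
  refine ⟨F, hF1, hF2, fun τ t => ?_, hF3, hF4, fun τ t ht => ?_, hF6⟩
  · obtain ⟨k, hk⟩ := exists_int_mem_Ioo_or_Icc hq t
    have e1 : F (τ, t + k * (2 * Real.pi)) = F (τ, t) := (hF2 τ).periodic.int_mul k t
    change (Circle.exp t, F (τ, t)) ∈ O
    rw [← e1, ← Circle.periodic_exp.int_mul k t]
    rcases hk with hk | hk
    · rw [hF5 τ _ hk]
      exact (htube _ ⟨hk.1.le, hk.2.le⟩ _ (hGd _ ⟨Real.smoothTransition.nonneg τ,
        Real.smoothTransition.le_one τ⟩ _ ⟨hk.1.le, hk.2.le⟩)).2.1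
    · rw [hF6 τ _ ⟨by linarith [hk.1], by linarith [hk.2]⟩]
      exact hfO _
  · obtain ⟨⟨s, hs, hsv⟩, -⟩ := hF7 τ t ht
    rw [hF5 τ t ht]
    exact ⟨Φ.map_target (htube s hs _ hsv).1, Φ.right_inv (htube s hs _ hsv).1⟩

/-! ### The Legendrian coil -/

theorem hasDerivAt_primitive {g : ℝ → ℝ} (hg : Continuous g) (a t : ℝ) :
    HasDerivAt (fun t => ∫ r in a..t, g r) (g t) t :=
  integral_hasDerivAt_right (hg.intervalIntegrable _ _)
    hg.aestronglyMeasurable.stronglyMeasurableAtFilter hg.continuousAt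

theorem contDiff_primitive {g : ℝ → ℝ} (hg : ContDiff ℝ ∞ g) (a : ℝ) :
    ContDiff ℝ ∞ fun t => ∫ r in a..t, g r := by
  rw [contDiff_infty_iff_deriv]
  refine ⟨fun t => (hasDerivAt_primitive hg.continuous a t).differentiableAt, ?_⟩
  rwa [show (deriv fun t => ∫ r in a..t, g r) = g from
    funext fun t => (hasDerivAt_primitive hg.continuous a t).deriv]

theorem E3.norm_le (v : E3) : ‖v‖ ≤ |v 0| + |v 1| + |v 2| := by
  rw [EuclideanSpace.norm_eq, Fin.sum_univ_three]
  refine Real.sqrt_le_iff.2 ⟨by positivity, ?_⟩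
  simp only [Real.norm_eq_abs]
  nlinarith [mul_nonneg (abs_nonneg (v 0)) (abs_nonneg (v 1)),
    mul_nonneg (abs_nonneg (v 0)) (abs_nonneg (v 2)),
    mul_nonneg (abs_nonneg (v 1)) (abs_nonneg (v 2))]

/-- A smooth step from `0` at `-1` to `1` at `1`. -/
def coilS (τ : ℝ) : ℝ := Real.smoothTransition ((τ + 1) / 2)

theorem contDiff_coilS : ContDiff ℝ ∞ coilS :=
  Real.smoothTransition.contDiff.comp (by fun_prop)

theorem coilS_of_le {τ : ℝ} (h : τ ≤ -1) : coilS τ = 0 :=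
  Real.smoothTransition.zero_of_nonpos (by linarith)

theorem coilS_of_ge {τ : ℝ} (h : 1 ≤ τ) : coilS τ = 1 :=
  Real.smoothTransition.one_of_one_le (by linarith)

theorem coilS_monotone : Monotone coilS := fun a b h =>
  Real.smoothTransition.monotone (by linarith)

theorem deriv_coilS_nonneg (τ : ℝ) : 0 ≤ deriv coilS τ := coilS_monotone.deriv_nonneg

/-- The primitive of `(1 + τ²) S'(τ)`. -/
def coilJ (τ : ℝ) : ℝ := ∫ r in (-1 : ℝ)..τ, (1 + r ^ 2) * deriv coilS r

theorem contDiff_deriv_coilS : ContDiff ℝ ∞ (deriv coilS) :=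
  (contDiff_infty_iff_deriv.1 contDiff_coilS).2

theorem contDiff_coilJ : ContDiff ℝ ∞ coilJ :=
  contDiff_primitive ((by fun_prop : ContDiff ℝ ∞ fun r : ℝ => 1 + r ^ 2).mul
    contDiff_deriv_coilS) _

theorem hasDerivAt_coilJ (τ : ℝ) : HasDerivAt coilJ ((1 + τ ^ 2) * deriv coilS τ) τ :=
  hasDerivAt_primitive ((by fun_prop : Continuous fun r : ℝ => 1 + r ^ 2).mul
    contDiff_deriv_coilS.continuous) _ _

theorem hasDerivAt_coilS (τ : ℝ) : HasDerivAt coilS (deriv coilS τ) τ :=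
  (contDiff_coilS.differentiable (by simp) τ).hasDerivAt

theorem coilJ_monotone : Monotone coilJ :=
  monotone_of_deriv_nonneg (fun τ => (hasDerivAt_coilJ τ).differentiableAt) fun τ => by
    rw [(hasDerivAt_coilJ τ).deriv]
    exact mul_nonneg (by positivity) (deriv_coilS_nonneg τ)

theorem coilJ_neg_one : coilJ (-1) = 0 := integral_same

/-- The weight `1 + τ²` is at least one. This bounds `coilJ 1`, hence the area swept by each turn,
away from zero. -/
theorem coilJ_sub_coilS_monotone : Monotone fun τ => coilJ τ - coilS τ := by
  have h : ∀ τ, HasDerivAt (fun τ => coilJ τ - coilS τ)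
      ((1 + τ ^ 2) * deriv coilS τ - deriv coilS τ) τ := fun τ =>
    (hasDerivAt_coilJ τ).sub (hasDerivAt_coilS τ)
  refine monotone_of_deriv_nonneg (fun τ => (h τ).differentiableAt) fun τ => ?_
  rw [(h τ).deriv]
  nlinarith [mul_nonneg (sq_nonneg τ) (deriv_coilS_nonneg τ)]

theorem one_le_coilJ_one : 1 ≤ coilJ 1 := by
  have h := coilJ_sub_coilS_monotone (show (-1 : ℝ) ≤ 1 by norm_num)
  simp only [coilJ_neg_one, coilS_of_le le_rfl, coilS_of_ge le_rfl] at h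
  linarith

theorem deriv_coilS_of_le {τ : ℝ} (h : τ ≤ -1) : deriv coilS τ = 0 := by
  have h1 : IsLocalMin coilS τ := Eventually.of_forall fun s => by
    rw [coilS_of_le h]; exact Real.smoothTransition.nonneg _
  exact h1.deriv_eq_zero

theorem deriv_coilS_of_ge {τ : ℝ} (h : 1 ≤ τ) : deriv coilS τ = 0 := by
  have h1 : IsLocalMax coilS τ := Eventually.of_forall fun s => by
    rw [coilS_of_ge h]; exact Real.smoothTransition.le_one _
  exact h1.deriv_eq_zero

theorem coilJ_of_le {τ : ℝ} (h : τ ≤ -1) : coilJ τ = 0 := by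
  rw [coilJ, ← integral_zero (a := -1) (b := τ) (μ := volume)]
  refine integral_congr fun r hr => ?_
  rw [uIcc_of_ge h] at hr
  simp only [deriv_coilS_of_le hr.2, mul_zero]

theorem coilJ_of_ge {τ : ℝ} (h : 1 ≤ τ) : coilJ τ = coilJ 1 := by
  have hi : ∀ a b : ℝ, IntervalIntegrable (fun r => (1 + r ^ 2) * deriv coilS r) volume a b :=
    fun a b => ((by fun_prop : Continuous fun r : ℝ => 1 + r ^ 2).mul
      contDiff_deriv_coilS.continuous).intervalIntegrable _ _
  have h1 : ∫ r in (1 : ℝ)..τ, (1 + r ^ 2) * deriv coilS r = 0 := by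
    rw [← integral_zero (a := 1) (b := τ) (μ := volume)]
    refine integral_congr fun r hr => ?_
    rw [uIcc_of_le h] at hr
    simp only [deriv_coilS_of_ge hr.1, mul_zero]
  rw [coilJ, ← integral_add_adjacent_intervals (hi (-1) 1) (hi 1 τ), h1, add_zero, coilJ]

theorem sin_nat_mul_two_pi (n : ℕ) : Real.sin (n * (2 * Real.pi)) = 0 := by
  have := Real.sin_add_nat_mul_two_pi 0 n
  simpa using this

/-- The first coordinate `τ cos β + sin β` of the coil. -/
def coilX (n : ℕ) (τ : ℝ) : ℝ :=
  τ * Real.cos (2 * Real.pi * n * coilS τ) + Real.sin (2 * Real.pi * n * coilS τ)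

/-- The second coordinate `cos β - τ sin β` of the coil. -/
def coilV (n : ℕ) (τ : ℝ) : ℝ :=
  Real.cos (2 * Real.pi * n * coilS τ) - τ * Real.sin (2 * Real.pi * n * coilS τ)

theorem contDiff_coilX (n : ℕ) : ContDiff ℝ ∞ (coilX n) := by
  have := contDiff_coilS
  unfold coilX
  fun_prop

theorem contDiff_coilV (n : ℕ) : ContDiff ℝ ∞ (coilV n) := by
  have := contDiff_coilS
  unfold coilV
  fun_prop

theorem hasDerivAt_coilX (n : ℕ) (τ : ℝ) : HasDerivAt (coilX n)
    (Real.cos (2 * Real.pi * n * coilS τ) + 2 * Real.pi * n * deriv coilS τ * coilV n τ) τ := by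
  have hβ := (hasDerivAt_coilS τ).const_mul (2 * Real.pi * n)
  refine (((hasDerivAt_id τ).mul hβ.cos).add hβ.sin).congr_deriv ?_
  simp only [coilV, id]
  ring

theorem hasDerivAt_coilV (n : ℕ) (τ : ℝ) : HasDerivAt (coilV n)
    (-Real.sin (2 * Real.pi * n * coilS τ) - 2 * Real.pi * n * deriv coilS τ * coilX n τ) τ := by
  have hβ := (hasDerivAt_coilS τ).const_mul (2 * Real.pi * n)
  refine (hβ.cos.sub ((hasDerivAt_id τ).mul hβ.sin)).congr_deriv ?_
  simp only [coilX, id]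
  ring

/-- The coil is the line `(τ, 1)` rotated clockwise through the angle `2πn S(τ)`, which is a
multiple of `2π` outside `(-1, 1)`. -/
theorem coilX_of_one_le_abs (n : ℕ) {τ : ℝ} (h : 1 ≤ |τ|) : coilX n τ = τ := by
  rcases le_abs'.1 h with h | h
  · simp [coilX, coilS_of_le h]
  · have : 2 * Real.pi * n = n * (2 * Real.pi) := by ring
    simp [coilX, coilS_of_ge h, this, Real.cos_nat_mul_two_pi, sin_nat_mul_two_pi]

theorem coilV_of_one_le_abs (n : ℕ) {τ : ℝ} (h : 1 ≤ |τ|) : coilV n τ = 1 := by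
  rcases le_abs'.1 h with h | h
  · simp [coilV, coilS_of_le h]
  · have : 2 * Real.pi * n = n * (2 * Real.pi) := by ring
    simp [coilV, coilS_of_ge h, this, Real.cos_nat_mul_two_pi, sin_nat_mul_two_pi]

theorem abs_coilX_le (n : ℕ) {τ : ℝ} (h : |τ| ≤ 1) : |coilX n τ| ≤ 2 := by
  refine (abs_add_le _ _).trans ?_
  rw [abs_mul]
  nlinarith [Real.abs_cos_le_one (2 * Real.pi * n * coilS τ),
    Real.abs_sin_le_one (2 * Real.pi * n * coilS τ), abs_nonneg τ,
    abs_nonneg (Real.cos (2 * Real.pi * n * coilS τ))]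

theorem abs_coilV_le (n : ℕ) {τ : ℝ} (h : |τ| ≤ 1) : |coilV n τ| ≤ 2 := by
  refine (abs_sub _ _).trans ?_
  rw [abs_mul]
  nlinarith [Real.abs_cos_le_one (2 * Real.pi * n * coilS τ),
    Real.abs_sin_le_one (2 * Real.pi * n * coilS τ), abs_nonneg τ,
    abs_nonneg (Real.sin (2 * Real.pi * n * coilS τ))]

/-- The coil satisfies `d(½XV - X + ½τ + πnJ) = (V - 1) dX`. -/
theorem hasDerivAt_coil_lift (n : ℕ) (τ : ℝ) :
    HasDerivAt (fun τ => coilX n τ * coilV n τ / 2 - coilX n τ + τ / 2 + Real.pi * n * coilJ τ)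
      ((coilV n τ - 1) * deriv (coilX n) τ) τ := by
  -- Here `V dX = ½ d(XV) + ½ (V dX - X dV)`. Since `(X, V)` is `(τ, 1)` turned clockwise through `β
  -- = 2πn S`, one has `V dX - X dV = dτ + (1 + τ²) dβ`.
  have h := (((((hasDerivAt_coilX n τ).mul (hasDerivAt_coilV n τ)).div_const 2).sub
    (hasDerivAt_coilX n τ)).add ((hasDerivAt_id τ).div_const 2)).add
    ((hasDerivAt_coilJ τ).const_mul (Real.pi * n))
  refine h.congr_deriv ?_
  rw [(hasDerivAt_coilX n τ).deriv]
  have h1 := Real.sin_sq_add_cos_sq (2 * Real.pi * n * coilS τ)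
  simp only [coilX, coilV]
  generalize Real.sin (2 * Real.pi * n * coilS τ) = a at *
  generalize Real.cos (2 * Real.pi * n * coilS τ) = b at *
  generalize deriv coilS τ = d at *
  linear_combination (-(1 : ℝ) / 2 - Real.pi * n * d * (1 + τ ^ 2)) * h1

/-- The homotopy from a curve `(x, y₀, y₀ x + e)` to a Legendrian coil. -/
def coilMove (x e : ℝ → ℝ) (y₀ xm R s e₀ : ℝ) (n : ℕ) (w : ℝ × ℝ) : E3 :=
  let τ := (x w.2 - xm) / R
  let X := R * τ + w.1 * (R * (coilX n τ - τ))
  let u := w.1 * (s * R * (coilV n τ - 1))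
  let h := (1 - w.1) * (e w.2 + s * R ^ 2 * τ / 2) +
    w.1 * (e₀ + s * R ^ 2 * (τ / 2 + Real.pi * n * coilJ τ))
  vec3 (xm + X) (y₀ + u) (y₀ * (xm + X) + h - s * R * X / 2 + X * u / 2)

theorem contDiff_coilMove {x e : ℝ → ℝ} (hx : ContDiff ℝ ∞ x) (he : ContDiff ℝ ∞ e)
    (y₀ xm R s e₀ : ℝ) (n : ℕ) : ContDiff ℝ ∞ (coilMove x e y₀ xm R s e₀ n) := by
  have hτ : ContDiff ℝ ∞ fun w : ℝ × ℝ => (x w.2 - xm) / R :=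
    ((hx.comp contDiff_snd).sub contDiff_const).div_const R
  have h1 := (contDiff_coilX n).comp hτ
  have h2 := (contDiff_coilV n).comp hτ
  have h3 := contDiff_coilJ.comp hτ
  have h4 : ContDiff ℝ ∞ fun w : ℝ × ℝ => e w.2 := he.comp contDiff_snd
  simp only [Function.comp_def] at h1 h2 h3
  unfold coilMove
  refine contDiff_vec3 ?_ ?_ ?_ <;> fun_prop

theorem coilMove_zero {x e : ℝ → ℝ} {y₀ xm R s e₀ : ℝ} (hR : R ≠ 0) (n : ℕ) (t : ℝ) :
    coilMove x e y₀ xm R s e₀ n (0, t) = vec3 (x t) y₀ (y₀ * x t + e t) := by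
  simp only [coilMove]
  congr 1 <;> field_simp <;> ring

/-- Off the coil the plane curve does not move; the height does not move either, provided `e`
already equals the area swept so far. This is what lets the homotopy be constant near the ends of a
window. -/
theorem coilMove_eq_of_one_le_abs {x e : ℝ → ℝ} {y₀ xm R s e₀ t : ℝ} (hR : R ≠ 0) (n : ℕ) (θ : ℝ)
    (h : 1 ≤ |(x t - xm) / R|)
    (he : e t = e₀ + s * R ^ 2 * (Real.pi * n * coilJ ((x t - xm) / R))) :
    coilMove x e y₀ xm R s e₀ n (θ, t) = vec3 (x t) y₀ (y₀ * x t + e t) := by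
  simp only [coilMove, coilX_of_one_le_abs n h, coilV_of_one_le_abs n h]
  rw [he]
  generalize coilJ ((x t - xm) / R) = j
  congr 1 <;> field_simp <;> ring

/-- The function increasing along all curves of the coiling homotopy. -/
def coilHeight (y₀ xm R s : ℝ) (v : E3) : ℝ :=
  s * (v 2 - y₀ * v 0 + s * R * (v 0 - xm) / 2 - (v 0 - xm) * (v 1 - y₀) / 2)

/-- The last two terms of `coilHeight` replace the height `∫ y dx` by the area swept around the
centre `(xm, y₀ - s R)` of the coil. The oscillating coordinates cancel, and what remains is affine
in `θ`. -/
theorem coilHeight_coilMove {x e : ℝ → ℝ} {y₀ xm R s e₀ : ℝ} (n : ℕ) (θ t : ℝ) :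
    coilHeight y₀ xm R s (coilMove x e y₀ xm R s e₀ n (θ, t)) =
      s * ((1 - θ) * (e t + s * R ^ 2 * ((x t - xm) / R) / 2) +
        θ * (e₀ + s * R ^ 2 * ((x t - xm) / R / 2 + Real.pi * n * coilJ ((x t - xm) / R)))) := by
  simp only [coilHeight, coilMove, vec3_zero, vec3_one, vec3_two]
  ring

theorem differentiable_coilHeight (y₀ xm R s : ℝ) : Differentiable ℝ (coilHeight y₀ xm R s) := by
  have h : ∀ i : Fin 3, Differentiable ℝ fun v : E3 => v i := fun i =>
    (contDiff_coord (n := ∞) i).differentiable (by simp)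
  have h0 := h 0
  have h1 := h 1
  have h2 := h 2
  unfold coilHeight
  fun_prop

/-- Both ends of the homotopy have nondecreasing height: at `θ = 0` because `s e` is, at `θ = 1`
because `coilJ` is. The common term `R² τ / 2` makes the sum strictly increasing. -/
theorem deriv_coilHeight_pos {x e : ℝ → ℝ} {y₀ xm R s e₀ t θ : ℝ} (hR : 0 < R) (n : ℕ)
    (hx : DifferentiableAt ℝ x t) (he : DifferentiableAt ℝ e t) (hxt : 0 < deriv x t)
    (hs : s * s = 1) (het : 0 ≤ s * deriv e t) (hθ : θ ∈ Icc (0 : ℝ) 1) :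
    0 < deriv (fun t => coilHeight y₀ xm R s (coilMove x e y₀ xm R s e₀ n (θ, t))) t := by
  have hτ : HasDerivAt (fun t => (x t - xm) / R) (deriv x t / R) t :=
    (hx.hasDerivAt.sub_const xm).div_const R
  have hJ := (hasDerivAt_coilJ ((x t - xm) / R)).comp t hτ
  have h1 := ((he.hasDerivAt.add ((hτ.const_mul (s * R ^ 2)).div_const 2)).const_mul (1 - θ)).add
    ((((hτ.div_const 2).add (hJ.const_mul (Real.pi * n))).const_mul
      (s * R ^ 2)).const_add e₀ |>.const_mul θ)
  have h2 := h1.const_mul s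
  have h3 := h2.congr_of_eventuallyEq
    (f₁ := fun t => coilHeight y₀ xm R s (coilMove x e y₀ xm R s e₀ n (θ, t)))
    (Eventually.of_forall fun t => coilHeight_coilMove n θ t)
  rw [h3.deriv]
  have hd := deriv_coilS_nonneg ((x t - xm) / R)
  generalize deriv coilS ((x t - xm) / R) = d at *
  generalize (x t - xm) / R = τ at *
  have e1 : s * ((1 - θ) * (deriv e t + s * R ^ 2 * (deriv x t / R) / 2) +
      θ * (s * R ^ 2 * (deriv x t / R / 2 + Real.pi * n * ((1 + τ ^ 2) * d * (deriv x t / R))))) =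
      (1 - θ) * (s * deriv e t) + R * deriv x t / 2 +
        θ * (R * Real.pi * n * (1 + τ ^ 2) * d * deriv x t) := by
    field_simp
    linear_combination ((1 - θ) * R * deriv x t + θ * R * deriv x t +
      θ * R * Real.pi * n * (1 + τ ^ 2) * d * deriv x t * 2) * hs
  rw [e1]
  have p1 : 0 ≤ (1 - θ) * (s * deriv e t) := mul_nonneg (by linarith [hθ.2]) het
  have p2 : 0 ≤ θ * (R * Real.pi * n * (1 + τ ^ 2) * d * deriv x t) := by
    have := hθ.1
    have := Real.pi_pos
    positivity
  have p3 : 0 < R * deriv x t / 2 := by positivity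
  linarith

theorem coilMove_one_legendrian {x e : ℝ → ℝ} {y₀ xm R s e₀ t : ℝ} (n : ℕ)
    (hx : DifferentiableAt ℝ x t) :
    deriv (fun t => coilMove x e y₀ xm R s e₀ n (1, t) 2) t =
      coilMove x e y₀ xm R s e₀ n (1, t) 1 *
        deriv (fun t => coilMove x e y₀ xm R s e₀ n (1, t) 0) t := by
  have hτ : HasDerivAt (fun t => (x t - xm) / R) (deriv x t / R) t :=
    (hx.hasDerivAt.sub_const xm).div_const R
  have hX := ((contDiff_coilX n).differentiable (by simp) ((x t - xm) / R)).hasDerivAt.comp t hτ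
  have hL := (hasDerivAt_coil_lift n ((x t - xm) / R)).comp t hτ
  have h0 : HasDerivAt (fun t => coilMove x e y₀ xm R s e₀ n (1, t) 0)
      (R * (deriv (coilX n) ((x t - xm) / R) * (deriv x t / R))) t := by
    refine ((hX.const_mul R).const_add xm).congr_of_eventuallyEq
      (Eventually.of_forall fun t => ?_)
    simp only [coilMove, vec3_zero, Function.comp]
    ring
  have h2 : HasDerivAt (fun t => coilMove x e y₀ xm R s e₀ n (1, t) 2)
      (y₀ * (R * (deriv (coilX n) ((x t - xm) / R) * (deriv x t / R))) + s * R ^ 2 *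
        ((coilV n ((x t - xm) / R) - 1) * deriv (coilX n) ((x t - xm) / R) * (deriv x t / R))) t := by
    refine (((hX.const_mul R).const_add xm).const_mul y₀ |>.add
      ((hL.const_mul (s * R ^ 2)).const_add e₀)).congr_of_eventuallyEq
      (Eventually.of_forall fun t => ?_)
    simp only [coilMove, vec3_two, Function.comp, Pi.add_apply]
    ring
  rw [h0.deriv, h2.deriv]
  simp only [coilMove, vec3_one]
  ring

/-- On the coil the first two coordinates move by at most `3R` each. The third moves by at most `A +
3|y₀|R + 3R/2 + 6R`, and `3 + 3 + 3/2 + 6 ≤ 14`. Off the coil only the term `A` remains. -/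
theorem dist_coilMove_le {x e : ℝ → ℝ} {y₀ xm R s e₀ t θ A : ℝ} (n : ℕ) (hR : 0 < R)
    (hR1 : R ≤ 1) (hs : |s| = 1) (hθ : θ ∈ Icc (0 : ℝ) 1)
    (hA : |e₀ + s * R ^ 2 * (Real.pi * n * coilJ ((x t - xm) / R)) - e t| ≤ A) :
    dist (coilMove x e y₀ xm R s e₀ n (θ, t)) (vec3 (x t) y₀ (y₀ * x t + e t)) ≤
      A + (14 + 3 * |y₀|) * R := by
  have hA0 : 0 ≤ A := (abs_nonneg _).trans hA
  set B := e₀ + s * R ^ 2 * (Real.pi * n * coilJ ((x t - xm) / R)) - e t with hB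
  set τ := (x t - xm) / R with hτ
  have hxt : x t = xm + R * τ := by rw [hτ]; field_simp; ring
  rw [dist_eq_norm]
  refine (E3.norm_le _).trans ?_
  set dx := θ * (R * (coilX n τ - τ)) with hdx
  set du := θ * (s * R * (coilV n τ - 1)) with hdu
  have e0 : (coilMove x e y₀ xm R s e₀ n (θ, t) - vec3 (x t) y₀ (y₀ * x t + e t)) 0 = dx := by
    simp only [PiLp.sub_apply, coilMove, vec3_zero, ← hτ, hdx]
    linear_combination -hxt
  have e1 : (coilMove x e y₀ xm R s e₀ n (θ, t) - vec3 (x t) y₀ (y₀ * x t + e t)) 1 = du := by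
    simp only [PiLp.sub_apply, coilMove, vec3_one, ← hτ, hdu]; ring
  have e2 : (coilMove x e y₀ xm R s e₀ n (θ, t) - vec3 (x t) y₀ (y₀ * x t + e t)) 2 =
      θ * B + y₀ * dx - s * R * dx / 2 + (R * τ + dx) * du / 2 := by
    simp only [PiLp.sub_apply, coilMove, vec3_two, ← hτ, hdx, hdu, hB]
    linear_combination -y₀ * hxt
  rw [e0, e1, e2]
  have hθB : |θ * B| ≤ A := by
    rw [abs_mul, abs_of_nonneg hθ.1]
    exact (mul_le_of_le_one_left (abs_nonneg _) hθ.2).trans hA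
  rcases le_total |τ| 1 with h | h
  · have hX := abs_coilX_le n h
    have hV := abs_coilV_le n h
    have hdx3 : |dx| ≤ 3 * R := by
      rw [hdx, abs_mul, abs_mul, abs_of_nonneg hθ.1, abs_of_pos hR]
      have : |coilX n τ - τ| ≤ 3 := (abs_sub _ _).trans (by linarith)
      nlinarith [mul_le_of_le_one_left (mul_nonneg hR.le (abs_nonneg (coilX n τ - τ))) hθ.2]
    have hdu3 : |du| ≤ 3 * R := by
      rw [hdu, abs_mul, abs_mul, abs_mul, hs, abs_of_nonneg hθ.1, abs_of_pos hR, one_mul]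
      have : |coilV n τ - 1| ≤ 3 := (abs_sub _ _).trans (by rw [abs_one]; linarith)
      nlinarith [mul_le_of_le_one_left (mul_nonneg hR.le (abs_nonneg (coilV n τ - 1))) hθ.2]
    have hX4 : |R * τ + dx| ≤ 4 * R := by
      refine (abs_add_le _ _).trans ?_
      rw [abs_mul, abs_of_pos hR]
      nlinarith
    have h1 : |y₀ * dx| ≤ |y₀| * (3 * R) := by
      rw [abs_mul]; exact mul_le_mul_of_nonneg_left hdx3 (abs_nonneg _)
    have h2 : |s * R * dx / 2| ≤ 3 * R / 2 := by
      rw [abs_div, abs_mul, abs_mul, hs, abs_of_pos hR, one_mul, abs_two]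
      have : R * |dx| ≤ |dx| := mul_le_of_le_one_left (abs_nonneg _) hR1
      linarith
    have h3 : |(R * τ + dx) * du / 2| ≤ 6 * R := by
      rw [abs_div, abs_mul, abs_two]
      have : |R * τ + dx| * |du| ≤ (4 * R) * (3 * R) :=
        mul_le_mul hX4 hdu3 (abs_nonneg _) (by positivity)
      nlinarith
    have h4 : |θ * B + y₀ * dx - s * R * dx / 2 + (R * τ + dx) * du / 2| ≤
        A + |y₀| * (3 * R) + 3 * R / 2 + 6 * R := by
      refine (abs_add_le _ _).trans (add_le_add ((abs_sub _ _).trans (add_le_add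
        ((abs_add_le _ _).trans (add_le_add hθB h1)) h2)) h3)
    linarith
  · have h1 : dx = 0 := by rw [hdx, coilX_of_one_le_abs n h]; ring
    have h2 : du = 0 := by rw [hdu, coilV_of_one_le_abs n h]; ring
    rw [h1, h2]
    simp only [abs_zero, mul_zero, zero_div, sub_zero, add_zero, zero_add]
    have : 0 ≤ (14 + 3 * |y₀|) * R := by positivity
    linarith

/-- A curve with constant second coordinate `y₀` and monotone `z - y₀ x` can be replaced by a
nearby Legendrian one, through curves along which a fixed function increases. -/
theorem exists_coil {x e : ℝ → ℝ} (hxs : ContDiff ℝ ∞ x) (hes : ContDiff ℝ ∞ e)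
    {p q y₀ η δ s : ℝ} (hpq : p < q) (hx : ∀ t ∈ Icc p q, 0 < deriv x t) (hs : s * s = 1)
    (hes' : ∀ t ∈ Icc p q, 0 ≤ s * deriv e t) (hδ : 0 < δ)
    (hep : ∀ t ∈ Icc p (p + δ), e t = e p) (heq : ∀ t ∈ Icc (q - δ) q, e t = e q)
    (hη : |e q - e p| < η) :
    ∃ (G : ℝ × ℝ → E3) (h : E3 → ℝ) (ε : ℝ), 0 < ε ∧ ε ≤ q - p ∧ ContDiff ℝ ∞ G ∧
      Differentiable ℝ h ∧
      (∀ θ ∈ Icc (0 : ℝ) 1, ∀ t ∈ Icc p q,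
        dist (G (θ, t)) (vec3 (x t) y₀ (y₀ * x t + e t)) < η) ∧
      (∀ θ, ∀ t ∈ Icc p q, t < p + ε ∨ q - ε < t →
        G (θ, t) = vec3 (x t) y₀ (y₀ * x t + e t)) ∧
      (∀ t, G (0, t) = vec3 (x t) y₀ (y₀ * x t + e t)) ∧
      (∀ θ ∈ Icc (0 : ℝ) 1, ∀ t ∈ Ioo p q, x p < G (θ, t) 0 ∧ G (θ, t) 0 < x q) ∧
      (∀ θ ∈ Icc (0 : ℝ) 1, ∀ t ∈ Ioo p q, 0 < deriv (fun t => h (G (θ, t))) t) ∧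
      ∀ t ∈ Ioo p q,
        deriv (fun t => G (1, t) 2) t = G (1, t) 1 * deriv (fun t => G (1, t) 0) t := by
  have hxm : StrictMonoOn x (Icc p q) := by
    refine strictMonoOn_of_deriv_pos (convex_Icc _ _) hxs.continuous.continuousOn fun t ht => ?_
    rw [interior_Icc] at ht
    exact hx t ⟨ht.1.le, ht.2.le⟩
  have hed : Differentiable ℝ e := hes.differentiable (by simp)
  have hxd : Differentiable ℝ x := hxs.differentiable (by simp)
  have hsem : MonotoneOn (fun t => s * e t) (Icc p q) := by
    refine monotoneOn_of_deriv_nonneg (convex_Icc _ _)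
      (continuous_const.mul hes.continuous).continuousOn (hed.const_mul s).differentiableOn
      fun t ht => ?_
    rw [interior_Icc] at ht
    rw [deriv_const_mul _ (hed t)]
    exact hes' t ⟨ht.1.le, ht.2.le⟩
  have hpI : p ∈ Icc p q := ⟨le_rfl, hpq.le⟩
  have hqI : q ∈ Icc p q := ⟨hpq.le, le_rfl⟩
  have hxpq : x p < x q := hxm hpI hqI hpq
  have hsabs : |s| = 1 := by
    rcases mul_self_eq_one_iff.1 hs with h | h <;> simp [h]
  have hse : ∀ a, a = s * (s * a) := fun a => by rw [← mul_assoc, hs, one_mul]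
  set A := s * (e q - e p) with hA
  have hA0 : 0 ≤ A := by
    have := hsem hpI hqI hpq.le
    simp only at this
    rw [hA]; linarith
  have hAabs : |e q - e p| = A := by
    rw [hse (e q - e p), ← hA, abs_mul, hsabs, one_mul, abs_of_nonneg hA0]
  rcases hA0.eq_or_lt with hA1 | hA1
  -- No area is needed: `e` is constant, so the curve is already Legendrian and the constant
  -- homotopy works. The coil itself would have radius zero.
  · have hconst : ∀ t ∈ Icc p q, e t = e p := by
      intro t ht
      have h1 := hsem hpI ht ht.1
      have h2 := hsem ht hqI ht.2
      simp only at h1 h2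
      have h3 : s * e t = s * e p := by linarith
      rw [hse (e t), h3, ← hse]
    refine ⟨fun w => vec3 (x w.2) y₀ (y₀ * x w.2 + e w.2), fun v => v 0, q - p, by linarith,
      le_rfl, ?_, (contDiff_coord (n := ∞) 0).differentiable (by simp), ?_, fun _ _ _ _ => rfl,
      fun _ => rfl, ?_, ?_, ?_⟩
    · have h1 : ContDiff ℝ ∞ fun w : ℝ × ℝ => x w.2 := hxs.comp contDiff_snd
      have h2 : ContDiff ℝ ∞ fun w : ℝ × ℝ => e w.2 := hes.comp contDiff_snd
      exact contDiff_vec3 h1 contDiff_const ((contDiff_const.mul h1).add h2)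
    · intro θ _ t _
      rw [dist_self]
      exact (abs_nonneg _).trans_lt hη
    · intro θ _ t ht
      exact ⟨hxm hpI ⟨ht.1.le, ht.2.le⟩ ht.1, hxm ⟨ht.1.le, ht.2.le⟩ hqI ht.2⟩
    · intro θ _ t ht
      exact hx t ⟨ht.1.le, ht.2.le⟩
    · intro t ht
      simp only [vec3_two, vec3_one, vec3_zero]
      have h1 : (fun t => y₀ * x t + e t) =ᶠ[𝓝 t] fun t => y₀ * x t + e p := by
        filter_upwards [isOpen_Ioo.mem_nhds ht] with r hr
        rw [hconst r ⟨hr.1.le, hr.2.le⟩]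
      rw [h1.deriv_eq, deriv_add_const, deriv_const_mul _ (hxd t)]
  · set K := 14 + 3 * |y₀| with hK
    have hK0 : 0 < K := by positivity
    have hJ1 := one_le_coilJ_one
    -- The coil reaches at most `2R ≤ 2r` to either side of the midpoint, so `8 r ≤ x q - x p` keeps
    -- it well inside the range of `x`.
    obtain ⟨r, hr, hr1, hr2, hr3⟩ : ∃ r > 0, r ≤ 1 ∧ 8 * r ≤ x q - x p ∧ A + K * r < η := by
      refine ⟨min (min 1 ((x q - x p) / 8)) ((η - A) / (2 * K)), ?_, ?_, ?_, ?_⟩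
      · rw [hAabs] at hη
        exact lt_min (lt_min one_pos (by linarith)) (div_pos (by linarith) (by positivity))
      · exact (min_le_left _ _).trans (min_le_left _ _)
      · linarith [(min_le_left (min 1 ((x q - x p) / 8)) ((η - A) / (2 * K))).trans
          (min_le_right _ _)]
      · rw [hAabs] at hη
        have h1 := mul_le_mul_of_nonneg_left
          (min_le_right (min 1 ((x q - x p) / 8)) ((η - A) / (2 * K))) hK0.le
        have h2 : K * ((η - A) / (2 * K)) = (η - A) / 2 := by field_simp
        linarith
    obtain ⟨n, hn⟩ := exists_nat_gt (A / (Real.pi * coilJ 1 * r ^ 2))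
    have hπ := Real.pi_pos
    have hc0 : 0 < Real.pi * coilJ 1 := by positivity
    have hn0 : 0 < (n : ℝ) := lt_of_le_of_lt (by positivity) hn
    -- The radius for which `n` turns sweep exactly the area `A`; the choice of `n` makes it at most
    -- `r`.
    set R := Real.sqrt (A / (Real.pi * n * coilJ 1)) with hR
    have hR0 : 0 < R := Real.sqrt_pos.2 (by positivity)
    have hRsq : R ^ 2 * (Real.pi * n * coilJ 1) = A := by
      rw [hR, Real.sq_sqrt (by positivity)]; field_simp
    have hRr : R ≤ r := by
      rw [hR]
      refine Real.sqrt_le_iff.2 ⟨hr.le, ?_⟩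
      rw [div_lt_iff₀ (by positivity)] at hn
      rw [div_le_iff₀ (by positivity)]
      linarith
    set xm := (x p + x q) / 2 with hxm'
    have heqA : e q = e p + s * A := by rw [hA, ← hse]; ring
    have hBet : ∀ t ∈ Icc p q,
        |e p + s * R ^ 2 * (Real.pi * n * coilJ ((x t - xm) / R)) - e t| ≤ A := by
      intro t ht
      have hJ0 : 0 ≤ coilJ ((x t - xm) / R) := by
        rcases le_total ((x t - xm) / R) (-1) with h | h
        · rw [coilJ_of_le h]
        · rw [← coilJ_neg_one]; exact coilJ_monotone h
      have hJ2 : coilJ ((x t - xm) / R) ≤ coilJ 1 := by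
        rcases le_total 1 ((x t - xm) / R) with h | h
        · rw [coilJ_of_ge h]
        · exact coilJ_monotone h
      have h1 := hsem hpI ht ht.1
      have h2 := hsem ht hqI ht.2
      simp only at h1 h2
      have h3 : R ^ 2 * (Real.pi * n * coilJ ((x t - xm) / R)) ≤ A := by
        rw [← hRsq]; gcongr
      have h4 : 0 ≤ R ^ 2 * (Real.pi * n * coilJ ((x t - xm) / R)) := by positivity
      have h5 : e p + s * R ^ 2 * (Real.pi * n * coilJ ((x t - xm) / R)) - e t =
          s * (R ^ 2 * (Real.pi * n * coilJ ((x t - xm) / R)) - (s * e t - s * e p)) := by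
        linear_combination (e t - e p) * hs
      rw [h5, abs_mul, hsabs, one_mul, abs_le]
      constructor <;> rw [hA] at * <;> linarith
    -- Within `ε` of the ends the curve is off the coil and `e` is constant, as required for the
    -- homotopy to be stationary there.
    obtain ⟨ε, hε, hε1, hε2, hε3, hε4⟩ : ∃ ε > 0, ε ≤ q - p ∧ ε ≤ δ ∧
        (∀ t ∈ Icc p q, t < p + ε → x t ≤ xm - R) ∧
        ∀ t ∈ Icc p q, q - ε < t → xm + R ≤ x t := by
      have h1 : ∀ᶠ t in 𝓝 p, x t < xm - R :=
        hxs.continuous.continuousAt.eventually_lt_const (by linarith)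
      have h2 : ∀ᶠ t in 𝓝 q, xm + R < x t :=
        hxs.continuous.continuousAt.eventually_const_lt (by linarith)
      obtain ⟨a, ha, ha'⟩ := Metric.eventually_nhds_iff.1 h1
      obtain ⟨b, hb, hb'⟩ := Metric.eventually_nhds_iff.1 h2
      refine ⟨min (min (q - p) δ) (min a b), by simp [hpq, hδ, ha, hb],
        (min_le_left _ _).trans (min_le_left _ _), (min_le_left _ _).trans (min_le_right _ _),
        fun t ht htε => (ha' ?_).le, fun t ht htε => (hb' ?_).le⟩
      · rw [Real.dist_eq, abs_of_nonneg (by linarith [ht.1])]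
        linarith [(min_le_right (min (q - p) δ) (min a b)).trans (min_le_left _ _)]
      · rw [Real.dist_eq, abs_of_nonpos (by linarith [ht.2])]
        linarith [(min_le_right (min (q - p) δ) (min a b)).trans (min_le_right _ _)]
    refine ⟨coilMove x e y₀ xm R s (e p) n, coilHeight y₀ xm R s, ε, hε, hε1,
      contDiff_coilMove hxs hes _ _ _ _ _ _, differentiable_coilHeight _ _ _ _, ?_, ?_,
      coilMove_zero hR0.ne' n, ?_, ?_, fun t _ => coilMove_one_legendrian n (hxd t)⟩
    · intro θ hθ t ht
      refine (dist_coilMove_le n hR0 (hRr.trans hr1) hsabs hθ (hBet t ht)).trans_lt ?_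
      nlinarith
    · rintro θ t ht (htε | htε)
      · have h1 : (x t - xm) / R ≤ -1 := by
          rw [div_le_iff₀ hR0]; linarith [hε3 t ht htε]
        refine coilMove_eq_of_one_le_abs hR0.ne' n θ (le_abs'.2 (Or.inl h1)) ?_
        rw [coilJ_of_le h1, hep t ⟨ht.1, by linarith⟩]
        ring
      · have h1 : 1 ≤ (x t - xm) / R := by
          rw [le_div_iff₀ hR0]; linarith [hε4 t ht htε]
        refine coilMove_eq_of_one_le_abs hR0.ne' n θ (le_abs'.2 (Or.inr h1)) ?_
        rw [coilJ_of_ge h1, heq t ⟨by linarith, ht.2⟩, heqA, ← hRsq]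
        ring
    · intro θ hθ t ht
      have htI : t ∈ Icc p q := ⟨ht.1.le, ht.2.le⟩
      have e0 : coilMove x e y₀ xm R s (e p) n (θ, t) 0 = xm + (R * ((x t - xm) / R) +
        θ * (R * (coilX n ((x t - xm) / R) - (x t - xm) / R))) := rfl
      rw [e0]
      rcases le_total |(x t - xm) / R| 1 with h | h
      · have hX := abs_le.1 (abs_coilX_le n h)
        have h' := abs_le.1 h
        generalize (x t - xm) / R = τ at *
        have h1 : |(1 - θ) * τ + θ * coilX n τ| ≤ 2 := by
          have m1 := mul_le_mul_of_nonneg_left h'.1 (sub_nonneg.2 hθ.2)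
          have m2 := mul_le_mul_of_nonneg_left h'.2 (sub_nonneg.2 hθ.2)
          have m3 := mul_le_mul_of_nonneg_left hX.1 hθ.1
          have m4 := mul_le_mul_of_nonneg_left hX.2 hθ.1
          rw [abs_le]
          constructor <;> linarith [hθ.1, hθ.2]
        have h2 : R * τ + θ * (R * (coilX n τ - τ)) = R * ((1 - θ) * τ + θ * coilX n τ) := by ring
        rw [h2]
        have h3 := mul_le_mul_of_nonneg_left (abs_le.1 h1).1 hR0.le
        have h4 := mul_le_mul_of_nonneg_left (abs_le.1 h1).2 hR0.le
        constructor <;> linarith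
      · rw [coilX_of_one_le_abs n h]
        have h1 : xm + (R * ((x t - xm) / R) +
            θ * (R * ((x t - xm) / R - (x t - xm) / R))) = x t := by field_simp; ring
        rw [h1]
        exact ⟨hxm hpI htI ht.1, hxm htI hqI ht.2⟩
    · intro θ hθ t ht
      have htI : t ∈ Icc p q := ⟨ht.1.le, ht.2.le⟩
      exact deriv_coilHeight_pos hR0 n (hxd t) (hed t) (hx t htI) hs (hes' t htI) hθ

/-! ### Coiling pieces of a knot -/

/-- The periodic curves `f` and `g` agree outside a compact part of `(p, q)` modulo `2π`. -/
def AgreeOff {X : Type*} (f g : ℝ → X) (p q : ℝ) : Prop :=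
  ∃ ε > 0, ∀ t ∈ Ioo (q - ε) (p + ε + 2 * Real.pi), g t = f t

theorem AgreeOff.eventuallyEq {X : Type*} {f g : ℝ → X} {p q : ℝ} (h : AgreeOff f g p q)
    (hf : Function.Periodic f (2 * Real.pi)) (hg : Function.Periodic g (2 * Real.pi)) {t : ℝ}
    (k : ℤ) (ht : t + k * (2 * Real.pi) ∈ Icc q (p + 2 * Real.pi)) : g =ᶠ[𝓝 t] f := by
  obtain ⟨ε, hε, h⟩ := h
  have h1 : ∀ᶠ s in 𝓝 t, s + k * (2 * Real.pi) ∈ Ioo (q - ε) (p + ε + 2 * Real.pi) :=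
    (by fun_prop : Continuous fun s : ℝ => s + k * (2 * Real.pi)).continuousAt.eventually
      (isOpen_Ioo.mem_nhds ⟨by linarith [ht.1], by linarith [ht.2]⟩)
  filter_upwards [h1] with s hs
  rw [← hf.int_mul k s, ← hg.int_mul k s]
  exact h _ hs

theorem AgreeOff.eventuallyEq_of_notMem {X : Type*} {f g : ℝ → X} {p q a b : ℝ}
    (h : AgreeOff f g p q) (hf : Function.Periodic f (2 * Real.pi))
    (hg : Function.Periodic g (2 * Real.pi)) (hap : a ≤ p) (hqb : q ≤ b)
    (hab : b < a + 2 * Real.pi) {t : ℝ} (ht : t ∈ Icc a b) (ht' : t ∉ Ioo p q) :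
    g =ᶠ[𝓝 t] f := by
  rcases le_or_gt t p with h1 | h1
  · exact h.eventuallyEq hf hg 1 (by push_cast; constructor <;> linarith [ht.1, ht.2])
  · have h2 : q ≤ t := by
      by_contra h2
      exact ht' ⟨h1, not_le.1 h2⟩
    exact h.eventuallyEq hf hg 0 (by push_cast; constructor <;> linarith [ht.1, ht.2])

theorem AgreeOff.refl {X : Type*} (f : ℝ → X) (p q : ℝ) : AgreeOff f f p q :=
  ⟨1, one_pos, fun _ _ => rfl⟩

theorem AgreeOff.trans_mono {X : Type*} {f g k : ℝ → X} {a b p q : ℝ} (h₁ : AgreeOff f g a b)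
    (h₂ : AgreeOff g k p q) (hap : a ≤ p) (hqb : q ≤ b) : AgreeOff f k a b := by
  obtain ⟨ε₁, hε₁, h₁⟩ := h₁
  obtain ⟨ε₂, hε₂, h₂⟩ := h₂
  refine ⟨min ε₁ ε₂, lt_min hε₁ hε₂, fun t ht => ?_⟩
  have m1 := min_le_left ε₁ ε₂
  have m2 := min_le_right ε₁ ε₂
  rw [h₂ t ⟨by linarith [ht.1], by linarith [ht.2]⟩, h₁ t ⟨by linarith [ht.1], by linarith [ht.2]⟩]

/-- Replacing a piece of a knot with constant second coordinate by a Legendrian coil. -/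
theorem PKnot.exists_coil_move {α : ∀ x : M, TangentSpace (𝓡 3) x →L[ℝ] ℝ} {f : ℝ → M}
    (hf : PKnot f) {Φ : OpenPartialHomeomorph M E3} (hΦ : IsDarboux α Φ) {O : Set (Circle × M)}
    (hfO : GraphIn O f) {c : ℝ → E3} (hc : ContDiff ℝ ∞ c) {p q η y₀ s δ : ℝ} (hpq : p < q)
    (hq : q < p + 2 * Real.pi) (hcf : ∀ t ∈ Icc p q, f t ∈ Φ.source ∧ Φ (f t) = c t)
    (hx : ∀ t ∈ Icc p q, 0 < deriv (fun t => c t 0) t) (htube : IsTube O f Φ c p q η)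
    (hy : ∀ t ∈ Icc p q, c t 1 = y₀) (hs : s * s = 1)
    (he' : ∀ t ∈ Icc p q, 0 ≤ s * deriv (fun t => c t 2 - y₀ * c t 0) t) (hδ : 0 < δ)
    (hep : ∀ t ∈ Icc p (p + δ), c t 2 - y₀ * c t 0 = c p 2 - y₀ * c p 0)
    (heq : ∀ t ∈ Icc (q - δ) q, c t 2 - y₀ * c t 0 = c q 2 - y₀ * c q 0)
    (hη : |c q 2 - y₀ * c q 0 - (c p 2 - y₀ * c p 0)| < η) :
    ∃ g : ℝ → M, PIso f g ∧ GraphIn O g ∧ AgreeOff f g p q ∧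
      ∀ t ∈ Ioo p q, g t ∈ Φ.source ∧ c p 0 < Φ (g t) 0 ∧ Φ (g t) 0 < c q 0 ∧ lev α g t = 0 := by
  have h0 := contDiff_coord_comp hc 0
  have h2 := contDiff_coord_comp hc 2
  obtain ⟨G, h, ε, hε, hεpq, hG, hh, hGd, hGe, hG0, hGx, hGh, hGl⟩ := exists_coil (y₀ := y₀)
    h0 (h2.sub (contDiff_const.mul h0)) hpq hx hs he' hδ hep heq hη
  have hcv : ∀ t ∈ Icc p q, vec3 (c t 0) y₀ (y₀ * c t 0 + (c t 2 - y₀ * c t 0)) = c t := by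
    intro t ht
    conv_rhs => rw [← vec3_eta (c t)]
    rw [hy t ht]
    congr 1; ring
  have hcf' : ∀ t ∈ Icc p q, Φ.symm (c t) = f t := fun t ht => by
    rw [← (hcf t ht).2]; exact Φ.left_inv (hcf t ht).1
  let W : Set E3 := {v | (∃ t ∈ Icc p q, dist v (c t) < η) ∧ c p 0 < v 0 ∧ v 0 < c q 0}
  have hGW : ∀ θ ∈ Icc (0 : ℝ) 1, ∀ t ∈ Ioo p q, G (θ, t) ∈ W := by
    intro θ hθ t ht
    have htI : t ∈ Icc p q := ⟨ht.1.le, ht.2.le⟩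
    refine ⟨⟨t, htI, ?_⟩, hGx θ hθ t ht⟩
    have := hGd θ hθ t htI
    rwa [hcv t htI] at this
  have hWt : W ⊆ Φ.target := by
    rintro v ⟨⟨s, hs, hsv⟩, -⟩
    exact (htube s hs v hsv).1
  obtain ⟨F, hF1, hF2, hF3, hF4, hF5, hF6⟩ := hf.exists_move hΦ.toIsSmoothChart hε hεpq hq (G := G)
    (W := W) (h := h) (fun θ _ t _ => hG.contDiffAt) hGW hWt
    (fun θ _ t ht hte => by
      have htI : t ∈ Icc p q := ⟨ht.1, ht.2.le⟩
      rw [hGe θ t htI hte, hcv t htI, hcf' t htI])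
    (fun t ht => by
      have htI : t ∈ Icc p q := ⟨ht.1.le, ht.2.le⟩
      rw [hG0, hcv t htI, hcf' t htI])
    (by
      rintro t ht v ⟨⟨s, hs, hsv⟩, hv1, hv2⟩
      exact (htube s hs v hsv).2.2 hv1 hv2 t ht) hh hGh
  have h1 : (1 : ℝ) ∈ Icc (0 : ℝ) 1 := ⟨zero_le_one, le_rfl⟩
  have hF7 : ∀ t ∈ Ioo p q, F (1, t) = Φ.symm (G (1, t)) := fun t ht => by
    rw [hF5 1 t ht, Real.smoothTransition.one]
  have hF8 : ∀ t ∈ Ioo p q, F (1, t) ∈ Φ.source ∧ Φ (F (1, t)) = G (1, t) := fun t ht => by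
    rw [hF7 t ht]
    exact ⟨Φ.map_target (hWt (hGW 1 h1 t ht)), Φ.right_inv (hWt (hGW 1 h1 t ht))⟩
  refine ⟨fun t => F (1, t), ⟨F, hF1, hF2, hF3, hF4⟩, fun t => ?_, ⟨ε, hε, hF6 1⟩,
    fun t ht => ?_⟩
  · obtain ⟨k, hk⟩ := exists_int_mem_Ioo_or_Icc hq t
    have e1 : F (1, t + k * (2 * Real.pi)) = F (1, t) := (hF2 1).periodic.int_mul k t
    change (Circle.exp t, F (1, t)) ∈ O
    rw [← e1, ← Circle.periodic_exp.int_mul k t]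
    rcases hk with hk | hk
    · rw [hF7 _ hk]
      have hkI : t + k * (2 * Real.pi) ∈ Icc p q := ⟨hk.1.le, hk.2.le⟩
      have := hGd 1 h1 _ hkI
      rw [hcv _ hkI] at this
      exact (htube _ hkI _ this).2.1
    · rw [hF6 1 _ ⟨by linarith [hk.1], by linarith [hk.2]⟩]
      exact hfO _
  · obtain ⟨h3, h4⟩ := hF8 t ht
    have h5 := hGx 1 h1 t ht
    refine ⟨h3, ?_, ?_, ?_⟩
    · change c p 0 < Φ (F (1, t)) 0
      rw [h4]; exact h5.1
    · change Φ (F (1, t)) 0 < c q 0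
      rw [h4]; exact h5.2
    · obtain ⟨K, -, hK⟩ := hΦ.lev (hF2 1).smooth.contMDiffAt h3
      have e : ∀ i : Fin 3, deriv (fun t => Φ (F (1, t)) i) t = deriv (fun t => G (1, t) i) t := by
        intro i
        refine Filter.EventuallyEq.deriv_eq ?_
        filter_upwards [isOpen_Ioo.mem_nhds ht] with r hr
        rw [(hF8 r hr).2]
      rw [hK, e, e, h4, hGl t ht, sub_self, mul_zero]

/-- Replacing finitely many pieces of a knot by Legendrian coils. -/
theorem PKnot.exists_coil_moves {α : ∀ x : M, TangentSpace (𝓡 3) x →L[ℝ] ℝ} {f : ℝ → M}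
    (hf : PKnot f) {Φ : OpenPartialHomeomorph M E3} (hΦ : IsDarboux α Φ) {O : Set (Circle × M)}
    (hfO : GraphIn O f) {c : ℝ → E3} (hc : ContDiff ℝ ∞ c) {a b η : ℝ} (hab : b < a + 2 * Real.pi)
    (hx : ∀ t ∈ Icc a b, 0 < deriv (fun t => c t 0) t)
    {N : ℕ} {p q y₀ s δ : ℕ → ℝ} (hpq : ∀ j < N, a ≤ p j ∧ p j < q j ∧ q j ≤ b)
    (hqp : ∀ i j, i < j → j < N → q i ≤ p j)
    (hcf : ∀ j < N, ∀ t ∈ Icc (p j) (q j), f t ∈ Φ.source ∧ Φ (f t) = c t)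
    (htube : ∀ j < N, IsTube O f Φ c (p j) (q j) η)
    (hy : ∀ j < N, ∀ t ∈ Icc (p j) (q j), c t 1 = y₀ j) (hs : ∀ j < N, s j * s j = 1)
    (he' : ∀ j < N, ∀ t ∈ Icc (p j) (q j), 0 ≤ s j * deriv (fun t => c t 2 - y₀ j * c t 0) t)
    (hδ : ∀ j < N, 0 < δ j)
    (hep : ∀ j < N, ∀ t ∈ Icc (p j) (p j + δ j),
      c t 2 - y₀ j * c t 0 = c (p j) 2 - y₀ j * c (p j) 0)
    (heq : ∀ j < N, ∀ t ∈ Icc (q j - δ j) (q j),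
      c t 2 - y₀ j * c t 0 = c (q j) 2 - y₀ j * c (q j) 0)
    (hη : ∀ j < N, |c (q j) 2 - y₀ j * c (q j) 0 - (c (p j) 2 - y₀ j * c (p j) 0)| < η)
    (hl : ∀ t ∈ Icc a b, (∀ j < N, t ∉ Ioo (p j) (q j)) → lev α f t = 0) :
    ∃ g : ℝ → M, PIso f g ∧ GraphIn O g ∧ AgreeOff f g a b ∧ ∀ t ∈ Icc a b, lev α g t = 0 := by
  have hmono : StrictMonoOn (fun t => c t 0) (Icc a b) := by
    refine strictMonoOn_of_deriv_pos (convex_Icc _ _)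
      (contDiff_coord_comp hc 0).continuous.continuousOn fun t ht => ?_
    rw [interior_Icc] at ht
    exact hx t ⟨ht.1.le, ht.2.le⟩
  -- The windows are treated one by one. The tubes of the untreated windows survive because coil `j`
  -- stays within the first-coordinate range of window `j`, which lies below the ranges of the later
  -- windows.
  have key : ∀ j ≤ N, ∃ g : ℝ → M, PIso f g ∧ GraphIn O g ∧ AgreeOff f g a b ∧
      (∀ i, j ≤ i → i < N → IsTube O g Φ c (p i) (q i) η ∧ ∀ t ∈ Icc (p i) (q i), g t = f t) ∧
      ∀ t ∈ Icc a b, (∀ i, j ≤ i → i < N → t ∉ Ioo (p i) (q i)) → lev α g t = 0 := by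
    intro j
    induction j with
    | zero =>
      intro _
      exact ⟨f, PIso.refl hf, hfO, AgreeOff.refl _ _ _,
        fun i _ hi => ⟨htube i hi, fun _ _ => rfl⟩,
        fun t ht h => hl t ht fun i hi => h i (Nat.zero_le _) hi⟩
    | succ j ih =>
      intro hj
      obtain ⟨g, hg1, hg2, hg3, hg4, hg5⟩ := ih (by omega)
      have hjN : j < N := by omega
      obtain ⟨hap, hpqj, hqb⟩ := hpq j hjN
      obtain ⟨htj, hgf⟩ := hg4 j le_rfl hjN
      have hgk : PKnot g := hg1.right
      obtain ⟨k, hk1, hk2, hk3, hk4⟩ := hgk.exists_coil_move hΦ hg2 hc hpqj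
        (by linarith) (fun t ht => by rw [hgf t ht]; exact hcf j hjN t ht)
        (fun t ht => hx t ⟨by linarith [ht.1], by linarith [ht.2]⟩) htj (hy j hjN) (hs j hjN)
        (he' j hjN) (hδ j hjN) (hep j hjN) (heq j hjN) (hη j hjN)
      have hkk : PKnot k := hk1.right
      have hev : ∀ t ∈ Icc a b, t ∉ Ioo (p j) (q j) → k =ᶠ[𝓝 t] g := fun t ht ht' =>
        hk3.eventuallyEq_of_notMem hgk.periodic hkk.periodic hap hqb hab ht ht'
      refine ⟨k, hg1.trans hk1, hk2, hg3.trans_mono hk3 hap hqb, fun i hi hiN => ⟨?_, ?_⟩,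
        fun t ht h => ?_⟩
      · intro t ht v hv
        obtain ⟨h1, h2, h3⟩ := (hg4 i (by omega) hiN).1 t ht v hv
        refine ⟨h1, h2, fun hv1 hv2 t' ht' heq' => ?_⟩
        obtain ⟨m, hm⟩ := exists_int_mem_Ioo_or_Icc (show q j < p j + 2 * Real.pi by linarith) t'
        rcases hm with hm | hm
        · obtain ⟨h4, h5, h6, -⟩ := hk4 _ hm
          rw [hkk.periodic.int_mul m t', ← heq', Φ.right_inv h1] at h6
          have h7 := hqp j i (by omega) hiN
          obtain ⟨r1, r2, r3⟩ := hpq i hiN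
          have h8 := hmono.monotoneOn (show q j ∈ Icc a b from ⟨by linarith, hqb⟩)
            (show p i ∈ Icc a b from ⟨by linarith, by linarith⟩) h7
          simp only at h8
          linarith
        · have h4 := (hk3.eventuallyEq hgk.periodic hkk.periodic m hm).self_of_nhds
          rw [h4] at heq'
          exact h3 hv1 hv2 t' ht' heq'
      · intro t ht
        obtain ⟨r1, r2, r3⟩ := hpq i hiN
        have h7 := hqp j i (by omega) hiN
        rw [(hev t ⟨by linarith [ht.1], by linarith [ht.2]⟩
          fun h => by linarith [h.2, ht.1]).self_of_nhds]
        exact (hg4 i (by omega) hiN).2 t ht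
      · by_cases htj' : t ∈ Ioo (p j) (q j)
        · exact (hk4 t htj').2.2.2
        · rw [lev_congr (hev t ht htj')]
          refine hg5 t ht fun i hi hiN => ?_
          rcases hi.eq_or_lt with rfl | hi
          · exact htj'
          · exact h i hi hiN
  obtain ⟨g, hg1, hg2, hg3, -, hg5⟩ := key N le_rfl
  exact ⟨g, hg1, hg2, hg3, fun t ht => hg5 t ht fun i hi hiN => absurd hiN (by omega)⟩

/-! ### Cellular approximation of a curve -/

/-- A bump on the cell `[s, s + d]`, equal to one on its middle half. -/
def cellBump (s d t : ℝ) : ℝ :=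
  Real.smoothTransition ((t - s - d / 8) / (d / 8)) *
    Real.smoothTransition ((s + 7 * d / 8 - t) / (d / 8))

/-- A step in the middle quarter of the cell `[s, s + d]`. -/
def cellStep (s d t : ℝ) : ℝ := Real.smoothTransition ((t - s - 3 * d / 8) / (d / 4))

section Cell

variable {s d t : ℝ}

theorem contDiff_cellBump (s d : ℝ) : ContDiff ℝ ∞ (cellBump s d) := by
  refine ContDiff.mul ?_ ?_ <;> refine Real.smoothTransition.contDiff.comp ?_ <;> fun_prop

theorem contDiff_cellStep (s d : ℝ) : ContDiff ℝ ∞ (cellStep s d) :=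
  Real.smoothTransition.contDiff.comp (by fun_prop)

theorem cellBump_of_le (hd : 0 < d) (h : t ≤ s + d / 8) : cellBump s d t = 0 := by
  rw [cellBump, Real.smoothTransition.zero_of_nonpos
    (div_nonpos_of_nonpos_of_nonneg (by linarith) (by positivity)), zero_mul]

theorem cellBump_of_ge (hd : 0 < d) (h : s + 7 * d / 8 ≤ t) : cellBump s d t = 0 := by
  rw [cellBump, Real.smoothTransition.zero_of_nonpos (x := (s + 7 * d / 8 - t) / (d / 8))
    (div_nonpos_of_nonpos_of_nonneg (by linarith) (by positivity)), mul_zero]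

theorem cellBump_of_mem (hd : 0 < d) (h : t ∈ Icc (s + d / 4) (s + 3 * d / 4)) :
    cellBump s d t = 1 := by
  rw [cellBump, Real.smoothTransition.one_of_one_le
    ((one_le_div (by positivity)).2 (by linarith [h.1])), Real.smoothTransition.one_of_one_le
    ((one_le_div (by positivity)).2 (by linarith [h.2])), one_mul]

theorem abs_cellBump_le (s d t : ℝ) : |cellBump s d t| ≤ 1 := by
  rw [cellBump, abs_mul, abs_of_nonneg (Real.smoothTransition.nonneg _),
    abs_of_nonneg (Real.smoothTransition.nonneg _)]
  exact mul_le_one₀ (Real.smoothTransition.le_one _) (Real.smoothTransition.nonneg _)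
    (Real.smoothTransition.le_one _)

theorem cellStep_nonneg (s d t : ℝ) : 0 ≤ cellStep s d t := Real.smoothTransition.nonneg _

theorem cellStep_le_one (s d t : ℝ) : cellStep s d t ≤ 1 := Real.smoothTransition.le_one _

theorem cellStep_of_le (hd : 0 < d) (h : t ≤ s + 3 * d / 8) : cellStep s d t = 0 :=
  Real.smoothTransition.zero_of_nonpos
    (div_nonpos_of_nonpos_of_nonneg (by linarith) (by positivity))

theorem cellStep_of_ge (hd : 0 < d) (h : s + 5 * d / 8 ≤ t) : cellStep s d t = 1 :=
  Real.smoothTransition.one_of_one_le ((one_le_div (by positivity)).2 (by linarith))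

theorem deriv_cellStep_of_le (hd : 0 < d) (h : t ≤ s + 3 * d / 8) :
    deriv (cellStep s d) t = 0 := by
  have h1 : IsLocalMin (cellStep s d) t := Eventually.of_forall fun r => by
    rw [cellStep_of_le hd h]; exact cellStep_nonneg _ _ _
  exact h1.deriv_eq_zero

theorem deriv_cellStep_of_ge (hd : 0 < d) (h : s + 5 * d / 8 ≤ t) :
    deriv (cellStep s d) t = 0 := by
  have h1 : IsLocalMax (cellStep s d) t := Eventually.of_forall fun r => by
    rw [cellStep_of_ge hd h]; exact cellStep_le_one _ _ _
  exact h1.deriv_eq_zero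

theorem deriv_cellStep_nonneg (hd : 0 < d) (s t : ℝ) : 0 ≤ deriv (cellStep s d) t := by
  refine Monotone.deriv_nonneg fun a b h => Real.smoothTransition.monotone ?_
  gcongr

end Cell

theorem exists_cell {a d t : ℝ} {N : ℕ} (hd : 0 < d) (hN : 0 < N)
    (ht : t ∈ Icc a (a + N * d)) : ∃ j : ℕ, j < N ∧ t ∈ Icc (a + j * d) (a + (j + 1) * d) := by
  rcases ht.2.eq_or_lt with h | h
  · refine ⟨N - 1, by omega, ?_⟩
    have : ((N - 1 : ℕ) : ℝ) = N - 1 := by push_cast [Nat.cast_sub (show 1 ≤ N by omega)]; ring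
    rw [h, this]
    constructor <;> nlinarith
  · have h0 : 0 ≤ (t - a) / d := div_nonneg (by linarith [ht.1]) hd.le
    refine ⟨⌊(t - a) / d⌋₊, ?_, ?_, ?_⟩
    · rw [Nat.floor_lt h0, div_lt_iff₀ hd]; linarith
    · have := Nat.floor_le h0
      rw [le_div_iff₀ hd] at this; linarith
    · have := Nat.lt_floor_add_one ((t - a) / d)
      rw [div_lt_iff₀ hd] at this; linarith

theorem cell_le {a d : ℝ} (hd : 0 < d) {i j : ℕ} (h : i < j) :
    a + (i + 1) * d ≤ a + j * d := by
  have : ((i : ℝ) + 1) ≤ j := by exact_mod_cast h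
  have := mul_le_mul_of_nonneg_right this hd.le
  linarith

/-- A function made constant on the middle halves of cells. -/
def flatten (y : ℝ → ℝ) (a d : ℝ) (N : ℕ) (t : ℝ) : ℝ :=
  y t + ∑ j ∈ Finset.range N, cellBump (a + j * d) d t * (y (a + j * d + d / 2) - y t)

section Flatten

variable {y : ℝ → ℝ} {a d t : ℝ} {N : ℕ}

theorem contDiff_flatten (hy : ContDiff ℝ ∞ y) : ContDiff ℝ ∞ (flatten y a d N) :=
  hy.add (ContDiff.sum fun _ _ => (contDiff_cellBump _ _).mul (contDiff_const.sub hy))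

theorem flatten_of_cell (hd : 0 < d) {j : ℕ} (hj : j < N)
    (ht : t ∈ Icc (a + j * d) (a + (j + 1) * d)) :
    flatten y a d N t = y t + cellBump (a + j * d) d t * (y (a + j * d + d / 2) - y t) := by
  rw [flatten, Finset.sum_eq_single j]
  · intro i _ hij
    rcases lt_or_gt_of_ne hij with h | h
    · have := cell_le (a := a) hd h
      rw [cellBump_of_ge hd (by linarith [ht.1]), zero_mul]
    · have := cell_le (a := a) hd h
      rw [cellBump_of_le hd (by linarith [ht.2]), zero_mul]
  · intro h
    exact absurd (Finset.mem_range.2 hj) h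

theorem flatten_left (hd : 0 < d) (ht : t ≤ a + d / 8) : flatten y a d N t = y t := by
  rw [flatten, Finset.sum_eq_zero, add_zero]
  intro j _
  have : 0 ≤ (j : ℝ) * d := by positivity
  rw [cellBump_of_le hd (by linarith), zero_mul]

theorem flatten_right (hd : 0 < d) (ht : a + N * d - d / 8 ≤ t) : flatten y a d N t = y t := by
  rw [flatten, Finset.sum_eq_zero, add_zero]
  intro j hj
  have := cell_le (a := a) hd (Finset.mem_range.1 hj)
  rw [cellBump_of_ge hd (by linarith), zero_mul]

theorem abs_flatten_sub_le (hd : 0 < d) {j : ℕ} (hj : j < N)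
    (ht : t ∈ Icc (a + j * d) (a + (j + 1) * d)) :
    |flatten y a d N t - y t| ≤ |y (a + j * d + d / 2) - y t| := by
  rw [flatten_of_cell hd hj ht, add_sub_cancel_left, abs_mul]
  exact mul_le_of_le_one_left (abs_nonneg _) (abs_cellBump_le _ _ _)

theorem flatten_of_mem (hd : 0 < d) {j : ℕ} (hj : j < N)
    (ht : t ∈ Icc (a + j * d + d / 4) (a + j * d + 3 * d / 4)) :
    flatten y a d N t = y (a + j * d + d / 2) := by
  rw [flatten_of_cell hd hj ⟨by linarith [ht.1], by linarith [ht.2]⟩, cellBump_of_mem hd ht]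
  ring

end Flatten

/-- A function replaced by a sum of steps located in the middle quarters of cells. -/
def staircase (E : ℝ → ℝ) (a d : ℝ) (N : ℕ) (t : ℝ) : ℝ :=
  E a + ∑ j ∈ Finset.range N, (E (a + (j + 1) * d) - E (a + j * d)) * cellStep (a + j * d) d t

section Staircase

variable {E : ℝ → ℝ} {a d t : ℝ} {N : ℕ}

theorem contDiff_staircase (E : ℝ → ℝ) (a d : ℝ) (N : ℕ) : ContDiff ℝ ∞ (staircase E a d N) :=
  contDiff_const.add (ContDiff.sum fun _ _ => contDiff_const.mul (contDiff_cellStep _ _))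

theorem sum_range_cells (E : ℝ → ℝ) (a d : ℝ) (j : ℕ) :
    E a + ∑ i ∈ Finset.range j, (E (a + (i + 1) * d) - E (a + i * d)) = E (a + j * d) := by
  have := Finset.sum_range_sub (fun i : ℕ => E (a + i * d)) j
  simp only [Nat.cast_add, Nat.cast_one, Nat.cast_zero, zero_mul, add_zero] at this
  rw [this]; ring

/-- In cell `j` the earlier steps are complete and telescope, and the later ones have not begun. -/
theorem staircase_of_cell (hd : 0 < d) {j : ℕ} (hj : j < N)
    (ht : t ∈ Icc (a + j * d) (a + (j + 1) * d)) :
    staircase E a d N t =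
      E (a + j * d) + (E (a + (j + 1) * d) - E (a + j * d)) * cellStep (a + j * d) d t := by
  have h1 : ∑ i ∈ Finset.range N,
      (E (a + (i + 1) * d) - E (a + i * d)) * cellStep (a + i * d) d t =
      ∑ i ∈ Finset.range (j + 1),
        (E (a + (i + 1) * d) - E (a + i * d)) * cellStep (a + i * d) d t := by
    symm
    refine Finset.sum_subset (Finset.range_subset_range.2 hj) fun i _ hi => ?_
    have hji : j < i := by simpa using hi
    have := cell_le (a := a) hd hji
    rw [cellStep_of_le hd (by linarith [ht.2]), mul_zero]
  have h2 : ∑ i ∈ Finset.range j,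
      (E (a + (i + 1) * d) - E (a + i * d)) * cellStep (a + i * d) d t =
      ∑ i ∈ Finset.range j, (E (a + (i + 1) * d) - E (a + i * d)) := by
    refine Finset.sum_congr rfl fun i hi => ?_
    have := cell_le (a := a) hd (Finset.mem_range.1 hi)
    rw [cellStep_of_ge hd (by linarith [ht.1]), mul_one]
  rw [staircase, h1, Finset.sum_range_succ, h2, ← add_assoc, sum_range_cells]

theorem staircase_left (hd : 0 < d) (ht : t ≤ a + d / 8) : staircase E a d N t = E a := by
  rw [staircase, Finset.sum_eq_zero, add_zero]
  intro j _
  have : 0 ≤ (j : ℝ) * d := by positivity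
  rw [cellStep_of_le hd (by linarith), mul_zero]

theorem staircase_right (hd : 0 < d) (ht : a + N * d - d / 8 ≤ t) :
    staircase E a d N t = E (a + N * d) := by
  rw [staircase, ← sum_range_cells E a d N]
  congr 1
  refine Finset.sum_congr rfl fun j hj => ?_
  have := cell_le (a := a) hd (Finset.mem_range.1 hj)
  rw [cellStep_of_ge hd (by linarith), mul_one]

theorem deriv_staircase_of_cell (hd : 0 < d) {j : ℕ} (hj : j < N)
    (ht : t ∈ Icc (a + j * d) (a + (j + 1) * d)) :
    deriv (staircase E a d N) t =
      (E (a + (j + 1) * d) - E (a + j * d)) * deriv (cellStep (a + j * d) d) t := by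
  have h1 : HasDerivAt (staircase E a d N) (∑ i ∈ Finset.range N,
      (E (a + (i + 1) * d) - E (a + i * d)) * deriv (cellStep (a + i * d) d) t) t :=
    (HasDerivAt.fun_sum fun (i : ℕ) _ => ((contDiff_cellStep (a + i * d) d).differentiable
      (by simp) t).hasDerivAt.const_mul (E (a + (i + 1) * d) - E (a + i * d))).const_add _
  rw [h1.deriv, Finset.sum_eq_single j]
  · intro i _ hij
    rcases lt_or_gt_of_ne hij with h | h
    · have := cell_le (a := a) hd h
      rw [deriv_cellStep_of_ge hd (by linarith [ht.1]), mul_zero]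
    · have := cell_le (a := a) hd h
      rw [deriv_cellStep_of_le hd (by linarith [ht.2]), mul_zero]
  · intro h
    exact absurd (Finset.mem_range.2 hj) h

theorem abs_staircase_sub_le (hd : 0 < d) {j : ℕ} (hj : j < N)
    (ht : t ∈ Icc (a + j * d) (a + (j + 1) * d)) {κ : ℝ} (h1 : |E (a + j * d) - E t| ≤ κ)
    (h2 : |E (a + (j + 1) * d) - E t| ≤ κ) : |staircase E a d N t - E t| ≤ κ := by
  rw [staircase_of_cell hd hj ht]
  have h3 := cellStep_nonneg (a + j * d) d t
  have h4 := cellStep_le_one (a + j * d) d t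
  generalize cellStep (a + j * d) d t = σ at *
  have m1 := mul_le_mul_of_nonneg_left (abs_le.1 h2).1 h3
  have m2 := mul_le_mul_of_nonneg_left (abs_le.1 h2).2 h3
  have m3 := mul_le_mul_of_nonneg_left (abs_le.1 h1).1 (sub_nonneg.2 h4)
  have m4 := mul_le_mul_of_nonneg_left (abs_le.1 h1).2 (sub_nonneg.2 h4)
  rw [abs_le]
  constructor <;> nlinarith

end Staircase

theorem exists_lipschitz_on_Icc {g : ℝ → ℝ} (hg : ContDiff ℝ ∞ g) (a b : ℝ) :
    ∃ C ≥ 0, ∀ t ∈ Icc a b, |g t| ≤ C ∧ |deriv g t| ≤ C := by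
  obtain ⟨C, hC⟩ := isCompact_Icc.exists_bound_of_continuousOn (s := Icc a b)
    hg.continuous.continuousOn
  obtain ⟨D, hD⟩ := isCompact_Icc.exists_bound_of_continuousOn (s := Icc a b)
    (hg.continuous_deriv (by simp)).continuousOn
  exact ⟨max (max C D) 0, le_max_right _ _, fun t ht =>
    ⟨(hC t ht).trans ((le_max_left _ _).trans (le_max_left _ _)),
      (hD t ht).trans ((le_max_right _ _).trans (le_max_left _ _))⟩⟩

theorem abs_sub_le_of_deriv_le {g : ℝ → ℝ} (hg : Differentiable ℝ g) {a b C : ℝ}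
    (hC : ∀ t ∈ Icc a b, |deriv g t| ≤ C) {s t : ℝ} (hs : s ∈ Icc a b) (ht : t ∈ Icc a b) :
    |g s - g t| ≤ C * |s - t| :=
  Convex.norm_image_sub_le_of_norm_deriv_le (fun r _ => hg r) hC (convex_Icc a b) ht hs

theorem eq_of_deriv_eq_zero_on {g : ℝ → ℝ} (hg : Differentiable ℝ g) {a b : ℝ}
    (h : ∀ t ∈ Icc a b, deriv g t = 0) {s t : ℝ} (hs : s ∈ Icc a b) (ht : t ∈ Icc a b) :
    g s = g t := by
  have := abs_sub_le_of_deriv_le hg (C := 0) (fun r hr => by rw [h r hr, abs_zero]) hs ht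
  rw [zero_mul] at this
  exact sub_eq_zero.1 (abs_eq_zero.1 (le_antisymm this (abs_nonneg _)))

/-- A curve that is Legendrian near its ends, approximated by a curve with the same first
coordinate which is Legendrian outside finitely many windows and has constant second coordinate
and monotone `z - yx` in each window. -/
structure IsCellular (c' : ℝ → E3) (a d : ℝ) (N : ℕ) (y₀ Δ : ℕ → ℝ) : Prop where
  snd_eq : ∀ j < N, ∀ t ∈ Icc (a + j * d + d / 4) (a + j * d + 3 * d / 4), c' t 1 = y₀ j
  deriv_eq : ∀ j < N, ∀ t ∈ Icc (a + j * d) (a + (j + 1) * d),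
    deriv (fun t => c' t 2) t - c' t 1 * deriv (fun t => c' t 0) t =
      Δ j * deriv (cellStep (a + j * d) d) t
  sub_eq : ∀ j < N, ∀ t ∈ Icc (a + j * d + d / 4) (a + j * d + 3 * d / 4),
    c' t 2 - y₀ j * c' t 0 = c' (a + j * d + d / 4) 2 - y₀ j * c' (a + j * d + d / 4) 0 +
      Δ j * cellStep (a + j * d) d t

/-- Flatten `y` to `y'`, take the Legendrian height `P = ∫ y' dx`, and concentrate the error `E = z
- P` into steps inside the regions where `y'` is constant. Short cells make this a small change.
Near the ends `y' = y` and the curve is Legendrian, so `E` is constant there and nothing changes. -/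
theorem exists_cellular {c : ℝ → E3} (hc : ContDiff ℝ ∞ c) {a b κ : ℝ} (hab : a < b)
    (hκ : 0 < κ)
    (hla : ∀ᶠ t in 𝓝 a, deriv (fun t => c t 2) t - c t 1 * deriv (fun t => c t 0) t = 0)
    (hlb : ∀ᶠ t in 𝓝 b, deriv (fun t => c t 2) t - c t 1 * deriv (fun t => c t 0) t = 0) :
    ∃ (c' : ℝ → E3) (N : ℕ) (d ε : ℝ) (y₀ Δ : ℕ → ℝ), ContDiff ℝ ∞ c' ∧ 0 < N ∧ 0 < d ∧
      b = a + N * d ∧ 0 < ε ∧ ε ≤ b - a ∧ (∀ t, c' t 0 = c t 0) ∧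
      (∀ t ∈ Icc a b, t < a + ε ∨ b - ε < t → c' t = c t) ∧
      (∀ t ∈ Icc a b, dist (c' t) (c t) ≤ 2 * κ) ∧ (∀ j < N, |Δ j| ≤ κ) ∧
      IsCellular c' a d N y₀ Δ := by
  have hx := contDiff_coord_comp hc 0
  have hy := contDiff_coord_comp hc 1
  have hz := contDiff_coord_comp hc 2
  have hxd : ContDiff ℝ ∞ (deriv fun t => c t 0) := (contDiff_infty_iff_deriv.1 hx).2
  obtain ⟨X, hX0, hX⟩ := exists_lipschitz_on_Icc hx a b
  obtain ⟨Y, hY0, hY⟩ := exists_lipschitz_on_Icc hy a b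
  obtain ⟨Z, hZ0, hZ⟩ := exists_lipschitz_on_Icc hz a b
  -- `Y` is a Lipschitz constant for `y` and `Z + 3YX` one for the error `E`, since `|y'| ≤ 3Y`.
  -- This many cells make both variations over a cell at most `κ`.
  obtain ⟨N, hN⟩ := exists_nat_gt (((Z + (3 * Y) * X) + Y) * (b - a) / κ)
  have hN0 : (0 : ℝ) < N := lt_of_le_of_lt (div_nonneg (mul_nonneg (by positivity)
    (by linarith)) hκ.le) hN
  have hNpos : 0 < N := by exact_mod_cast hN0
  set d := (b - a) / N with hd
  have hd0 : 0 < d := div_pos (by linarith) hN0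
  have hb : b = a + N * d := by rw [hd]; field_simp; ring
  have hLd : ((Z + (3 * Y) * X) + Y) * d ≤ κ := by
    rw [div_lt_iff₀ hκ] at hN
    rw [hd, ← mul_div_assoc, div_le_iff₀ hN0]
    linarith
  have hcell : ∀ j < N, ∀ t ∈ Icc (a + j * d) (a + (j + 1) * d), t ∈ Icc a b := by
    intro j hj t ht
    have h1 := cell_le (a := a) hd0 hj
    have h2 : 0 ≤ (j : ℝ) * d := by positivity
    exact ⟨by linarith [ht.1], by rw [hb]; linarith [ht.2]⟩
  set y' := flatten (fun t => c t 1) a d N with hy'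
  have hy's : ContDiff ℝ ∞ y' := contDiff_flatten hy
  have hy'y : ∀ t ∈ Icc a b, |y' t - c t 1| ≤ Y * d ∧ |y' t| ≤ 3 * Y := by
    intro t ht
    obtain ⟨j, hj, htj⟩ := exists_cell hd0 hNpos (hb ▸ ht)
    have hm : a + j * d + d / 2 ∈ Icc a b := hcell j hj _ ⟨by linarith, by linarith⟩
    have h1 := abs_flatten_sub_le (y := fun t => c t 1) hd0 hj htj
    have h2 := abs_sub_le_of_deriv_le (hy.differentiable (by simp)) (fun r hr => (hY r hr).2) hm ht
    have h3 : |a + j * d + d / 2 - t| ≤ d := by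
      rw [abs_le]; constructor <;> linarith [htj.1, htj.2]
    refine ⟨h1.trans (h2.trans (by gcongr)), ?_⟩
    have h4 := abs_sub_abs_le_abs_sub (y' t) (c t 1)
    have h5 := abs_sub (c (a + j * d + d / 2) 1) (c t 1)
    have h6 := (hY t ht).1
    have h7 := (hY _ hm).1
    change |y' t - c t 1| ≤ |c (a + j * d + d / 2) 1 - c t 1| at h1
    linarith
  set P : ℝ → ℝ := fun t => c a 2 + ∫ r in a..t, y' r * deriv (fun t => c t 0) r with hP
  have hPs : ContDiff ℝ ∞ P := contDiff_const.add (contDiff_primitive (hy's.mul hxd) a)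
  have hPd : ∀ t, HasDerivAt P (y' t * deriv (fun t => c t 0) t) t := fun t =>
    (hasDerivAt_primitive (hy's.mul hxd).continuous a t).const_add _
  set E : ℝ → ℝ := fun t => c t 2 - P t with hE
  have hEs : ContDiff ℝ ∞ E := hz.sub hPs
  have hEd : ∀ t, deriv E t = deriv (fun t => c t 2) t - y' t * deriv (fun t => c t 0) t :=
    fun t => ((hz.differentiable (by simp) t).hasDerivAt.sub (hPd t)).deriv
  have hELip : ∀ s ∈ Icc a b, ∀ t ∈ Icc a b, |s - t| ≤ d → |E s - E t| ≤ κ := by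
    intro s hs t ht hst
    refine (abs_sub_le_of_deriv_le (C := Z + 3 * Y * X) (hEs.differentiable (by simp))
      (fun r hr => ?_) hs ht).trans ?_
    · rw [hEd]
      refine (abs_sub _ _).trans (add_le_add (hZ r hr).2 ?_)
      rw [abs_mul]
      exact mul_le_mul (hy'y r hr).2 (hX r hr).2 (abs_nonneg _) (by positivity)
    · refine (mul_le_mul_of_nonneg_left hst (by positivity)).trans ?_
      nlinarith [mul_nonneg hY0 hd0.le]
  set E' := staircase E a d N with hE'
  have hE's : ContDiff ℝ ∞ E' := contDiff_staircase _ _ _ _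
  have hjI : ∀ j < N, a + j * d ∈ Icc a b := fun j hj => hcell j hj _ ⟨le_rfl, by linarith⟩
  have hjI' : ∀ j : ℕ, j < N → a + (j + 1) * d ∈ Icc a b := fun j hj =>
    hcell j hj _ ⟨by linarith, le_rfl⟩
  have hE'E : ∀ t ∈ Icc a b, |E' t - E t| ≤ κ := by
    intro t ht
    obtain ⟨j, hj, htj⟩ := exists_cell hd0 hNpos (hb ▸ ht)
    refine abs_staircase_sub_le hd0 hj htj (hELip _ (hjI j hj) _ ht ?_)
      (hELip _ (hjI' j hj) _ ht ?_) <;>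
    · rw [abs_le]; constructor <;> linarith [htj.1, htj.2]
  obtain ⟨ε, hε, hεd, hεa, hεb⟩ : ∃ ε > 0, ε ≤ d / 8 ∧
      (∀ t ∈ Icc a (a + ε), deriv (fun t => c t 2) t - c t 1 * deriv (fun t => c t 0) t = 0) ∧
      ∀ t ∈ Icc (b - ε) b, deriv (fun t => c t 2) t - c t 1 * deriv (fun t => c t 0) t = 0 := by
    obtain ⟨u, hu, hu'⟩ := Metric.eventually_nhds_iff.1 hla
    obtain ⟨v, hv, hv'⟩ := Metric.eventually_nhds_iff.1 hlb
    have m1 := min_le_left (d / 8) (min (u / 2) (v / 2))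
    have m2 := (min_le_right (d / 8) (min (u / 2) (v / 2))).trans (min_le_left _ _)
    have m3 := (min_le_right (d / 8) (min (u / 2) (v / 2))).trans (min_le_right _ _)
    refine ⟨min (d / 8) (min (u / 2) (v / 2)), by positivity, m1, fun t ht => hu' ?_,
      fun t ht => hv' ?_⟩
    · rw [Real.dist_eq, abs_of_nonneg (by linarith [ht.1])]; linarith [ht.2]
    · rw [Real.dist_eq, abs_of_nonpos (by linarith [ht.2])]; linarith [ht.1]
  have hdba : d ≤ b - a := by
    have : (1 : ℝ) ≤ N := by exact_mod_cast hNpos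
    nlinarith
  have hEa : ∀ t ∈ Icc a (a + ε), E t = E a := fun t ht =>
    eq_of_deriv_eq_zero_on (hEs.differentiable (by simp)) (fun r hr => by
      rw [hEd, hy', flatten_left hd0 (by linarith [hr.2])]; exact hεa r hr) ht
      ⟨le_rfl, by linarith⟩
  have hEb : ∀ t ∈ Icc (b - ε) b, E t = E b := fun t ht =>
    eq_of_deriv_eq_zero_on (hEs.differentiable (by simp)) (fun r hr => by
      rw [hEd, hy', flatten_right hd0 (by rw [← hb]; linarith [hr.1])]; exact hεb r hr) ht
      ⟨by linarith, le_rfl⟩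
  have hPE : ∀ t, P t + E t = c t 2 := fun t => by simp [hE]
  have hc'd : ∀ t, HasDerivAt (fun t => P t + E' t)
      (y' t * deriv (fun t => c t 0) t + deriv E' t) t := fun t =>
    (hPd t).add (hE's.differentiable (by simp) t).hasDerivAt
  have hstep : ∀ j < N, ∀ t ∈ Icc (a + j * d + d / 4) (a + j * d + 3 * d / 4),
      E' t = E (a + j * d) + (E (a + (j + 1) * d) - E (a + j * d)) * cellStep (a + j * d) d t :=
    fun j hj t ht => staircase_of_cell hd0 hj ⟨by linarith [ht.1], by linarith [ht.2]⟩
  refine ⟨fun t => vec3 (c t 0) (y' t) (P t + E' t), N, d, ε,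
    fun j => c (a + j * d + d / 2) 1, fun j => E (a + (j + 1) * d) - E (a + j * d),
    contDiff_vec3 hx hy's (hPs.add hE's), hNpos, hd0, hb, hε, by linarith, fun t => rfl, ?_, ?_,
    ?_, ?_, ?_, ?_⟩
  · rintro t ht (h | h)
    · have h1 : E' t = E t := by
        rw [hE', staircase_left hd0 (by linarith), hEa t ⟨ht.1, h.le⟩]
      have h2 : y' t = c t 1 := flatten_left hd0 (by linarith)
      simp only [h1, h2, hPE]
      exact vec3_eta _
    · have h1 : E' t = E t := by
        rw [hE', staircase_right hd0 (by rw [← hb]; linarith), hEb t ⟨h.le, ht.2⟩, ← hb]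
      have h2 : y' t = c t 1 := flatten_right hd0 (by rw [← hb]; linarith)
      simp only [h1, h2, hPE]
      exact vec3_eta _
  · intro t ht
    rw [dist_eq_norm]
    refine (E3.norm_le _).trans ?_
    simp only [PiLp.sub_apply, vec3_zero, vec3_one, vec3_two, sub_self, abs_zero, zero_add]
    have h1 := (hy'y t ht).1
    have h2 := hE'E t ht
    have h3 : P t + E' t - c t 2 = E' t - E t := by rw [← hPE]; ring
    rw [h3]
    have h4 : 0 ≤ (Z + 3 * Y * X) * d := by positivity
    linarith
  · intro j hj
    refine hELip _ (hjI' j hj) _ (hjI j hj) ?_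
    rw [abs_le]; constructor <;> linarith
  · intro j hj t ht
    exact flatten_of_mem (y := fun t => c t 1) hd0 hj ht
  · intro j hj t ht
    simp only [vec3_zero, vec3_one, vec3_two]
    rw [(hc'd t).deriv, hE', deriv_staircase_of_cell hd0 hj ht]
    ring
  · intro j hj t ht
    simp only [vec3_zero, vec3_two]
    set p := a + j * d + d / 4 with hp
    set q := a + j * d + 3 * d / 4 with hq
    have hpI : p ∈ Icc p q := ⟨le_rfl, by linarith⟩
    have h1 : P t - c (a + j * d + d / 2) 1 * c t 0 = P p - c (a + j * d + d / 2) 1 * c p 0 := by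
      have hd1 : ∀ r, HasDerivAt (fun t => P t - c (a + j * d + d / 2) 1 * c t 0)
          (y' r * deriv (fun t => c t 0) r -
            c (a + j * d + d / 2) 1 * deriv (fun t => c t 0) r) r := fun r =>
        (hPd r).sub ((hx.differentiable (by simp) r).hasDerivAt.const_mul _)
      refine eq_of_deriv_eq_zero_on (fun r => (hd1 r).differentiableAt) (fun r hr => ?_) ht hpI
      rw [(hd1 r).deriv, hy', flatten_of_mem hd0 hj hr, sub_self]
    rw [hstep j hj t ht, hstep j hj p hpI, cellStep_of_le (t := p) hd0 (by linarith)]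
    linear_combination h1

/-! ### Making an arc Legendrian -/

/-- The curve `f` lies in the chart `Φ` at time `t`, with increasing first coordinate. -/
def MonoAt (Φ : OpenPartialHomeomorph M E3) (f : ℝ → M) (t : ℝ) : Prop :=
  f t ∈ Φ.source ∧ 0 < deriv (fun t => Φ (f t) 0) t

theorem MonoAt.congr {Φ : OpenPartialHomeomorph M E3} {f g : ℝ → M} {t : ℝ} (h : MonoAt Φ f t)
    (hfg : g =ᶠ[𝓝 t] f) : MonoAt Φ g t := by
  refine ⟨hfg.self_of_nhds ▸ h.1, ?_⟩
  have h1 : (fun t => Φ (g t) 0) =ᶠ[𝓝 t] fun t => Φ (f t) 0 := hfg.fun_comp fun p => Φ p 0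
  rw [h1.deriv_eq]
  exact h.2

/-- The part of a knot over an interval can be made Legendrian if the knot is Legendrian near the
ends of the interval and the interval is covered by one Darboux chart with increasing first
coordinate. -/
theorem PKnot.exists_legendrian_arc [T2Space M] {α : ∀ x : M, TangentSpace (𝓡 3) x →L[ℝ] ℝ}
    {f : ℝ → M} (hf : PKnot f) {Φ : OpenPartialHomeomorph M E3} (hΦ : IsDarboux α Φ)
    {O : Set (Circle × M)} (hO : IsOpen O) (hfO : GraphIn O f) {a b : ℝ} (hab : a < b)
    (hb : b < a + 2 * Real.pi) (hmono : ∀ t ∈ Icc a b, MonoAt Φ f t)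
    (hla : ∀ᶠ t in 𝓝 a, lev α f t = 0) (hlb : ∀ᶠ t in 𝓝 b, lev α f t = 0) :
    ∃ g : ℝ → M, PIso f g ∧ GraphIn O g ∧ AgreeOff f g a b ∧ ∀ t ∈ Icc a b, lev α g t = 0 := by
  obtain ⟨c, hc, ε₀, hε₀, hcf⟩ := exists_chart_curve hf.smooth hΦ.toIsSmoothChart hab.le
    fun t ht => (hmono t ht).1
  have hev : ∀ t ∈ Icc a b, ∀ i : Fin 3, (fun t => Φ (f t) i) =ᶠ[𝓝 t] fun t => c t i := by
    intro t ht i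
    filter_upwards [Ioo_mem_nhds (show a - ε₀ < t by linarith [ht.1])
      (show t < b + ε₀ by linarith [ht.2])] with s hs
    rw [(hcf s ⟨hs.1.le, hs.2.le⟩).2]
  have hx : ∀ t ∈ Icc a b, 0 < deriv (fun t => c t 0) t := fun t ht => by
    rw [← (hev t ht 0).deriv_eq]; exact (hmono t ht).2
  have hcI : ∀ t ∈ Icc a b, f t ∈ Φ.source ∧ Φ (f t) = c t := fun t ht =>
    hcf t ⟨by linarith [ht.1], by linarith [ht.2]⟩
  have hleg : ∀ t ∈ Icc a b, (∀ᶠ t in 𝓝 t, lev α f t = 0) →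
      ∀ᶠ t in 𝓝 t, deriv (fun t => c t 2) t - c t 1 * deriv (fun t => c t 0) t = 0 := by
    intro t ht hl
    filter_upwards [hl, Ioo_mem_nhds (show a - ε₀ < t by linarith [ht.1])
      (show t < b + ε₀ by linarith [ht.2])] with s hs hsI
    obtain ⟨hs1, hs2⟩ := hcf s ⟨hsI.1.le, hsI.2.le⟩
    obtain ⟨G, hG, hGl⟩ := hΦ.lev hf.smooth.contMDiffAt hs1
    have e : ∀ i : Fin 3, deriv (fun t => Φ (f t) i) s = deriv (fun t => c t i) s := fun i => by
      refine Filter.EventuallyEq.deriv_eq ?_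
      filter_upwards [isOpen_Ioo.mem_nhds hsI] with r hr
      rw [(hcf r ⟨hr.1.le, hr.2.le⟩).2]
    rw [hs, e, e, hs2] at hGl
    exact (mul_eq_zero.1 hGl.symm).resolve_left hG.ne'
  have haI : a ∈ Icc a b := ⟨le_rfl, hab.le⟩
  have hbI : b ∈ Icc a b := ⟨hab.le, le_rfl⟩
  obtain ⟨η, hη, htube⟩ := hf.exists_tube hab hb hc hε₀ hcf hx hO hfO
  -- With `κ = η / 4` the new curve is `η / 2`-close to `c`, so its `η / 2`-tubes lie in the
  -- original `η`-tube; the steps, at most `η / 4`, are small enough for coils in these tubes.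
  obtain ⟨c', N, d, ε, y₀, Δ, hc', hN, hd, hbd, hε, hεab, hx', hcc', hdist, hΔ, hcell⟩ :=
    exists_cellular hc hab (show 0 < η / 4 by positivity) (hleg a haI hla) (hleg b hbI hlb)
  obtain ⟨F, hF1, hF2, hF3, hF4, hF5, hF6, hF7⟩ := hf.exists_graph_move hΦ.toIsSmoothChart hε hεab hb
    hfO hc hc' hcI hx htube hx' (fun t ht => hcc' t ⟨ht.1, ht.2.le⟩)
    fun t ht => (hdist t ht).trans_lt (by linarith)
  set f₁ : ℝ → M := fun t => F (1, t) with hf₁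
  have hf₁k : PKnot f₁ := hF2 1
  have hiso : PIso f f₁ := ⟨F, hF1, hF2, hF4, hF5⟩
  have hagree : AgreeOff f f₁ a b := ⟨ε, hε, hF7 1⟩
  have hf₁c : ∀ t ∈ Ioo a b, f₁ t ∈ Φ.source ∧ Φ (f₁ t) = c' t := fun t ht => by
    obtain ⟨h1, h2⟩ := hF6 1 t ht
    refine ⟨h1, ?_⟩
    rw [hf₁, h2, Real.smoothTransition.one, one_smul, add_sub_cancel]
  have hx0 : (fun t => c' t 0) = fun t => c t 0 := funext hx'
  have hxm : StrictMonoOn (fun t => c t 0) (Icc a b) := by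
    refine strictMonoOn_of_deriv_pos (convex_Icc _ _)
      (contDiff_coord_comp hc 0).continuous.continuousOn fun t ht => ?_
    rw [interior_Icc] at ht
    exact hx t ⟨ht.1.le, ht.2.le⟩
  set p : ℕ → ℝ := fun j => a + j * d + d / 4 with hp
  set q : ℕ → ℝ := fun j => a + j * d + 3 * d / 4 with hq
  have hpq : ∀ j < N, a < p j ∧ p j < q j ∧ q j < b := by
    intro j hj
    have h1 := cell_le (a := a) hd hj
    have h2 : 0 ≤ (j : ℝ) * d := by positivity
    simp only [hp, hq]
    exact ⟨by linarith, by linarith, by rw [hbd]; linarith⟩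
  have hwin : ∀ j < N, ∀ t ∈ Icc (p j) (q j), t ∈ Ioo a b := fun j hj t ht =>
    ⟨(hpq j hj).1.trans_le ht.1, ht.2.trans_lt (hpq j hj).2.2⟩
  have hwcell : ∀ j : ℕ, ∀ t ∈ Icc (p j) (q j), t ∈ Icc (a + j * d) (a + (j + 1) * d) := by
    intro j t ht
    simp only [hp, hq] at ht
    exact ⟨by linarith [ht.1], by linarith [ht.2]⟩
  have hy : ∀ j < N, ∀ t ∈ Icc (p j) (q j), c' t 1 = y₀ j := fun j hj t ht =>
    hcell.snd_eq j hj t ht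
  have h0d : ∀ t, DifferentiableAt ℝ (fun t => c' t 0) t := fun t =>
    (contDiff_coord_comp hc' 0).differentiable (by simp) t
  have h2d : ∀ t, DifferentiableAt ℝ (fun t => c' t 2) t := fun t =>
    (contDiff_coord_comp hc' 2).differentiable (by simp) t
  suffices h : ∃ g : ℝ → M, PIso f₁ g ∧ GraphIn O g ∧ AgreeOff f₁ g a b ∧
      ∀ t ∈ Icc a b, lev α g t = 0 by
    obtain ⟨g, hg1, hg2, hg3, hg4⟩ := h
    exact ⟨g, hiso.trans hg1, hg2, hagree.trans_mono hg3 le_rfl le_rfl, hg4⟩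
  -- The side of the coil follows the sign of the step. The margin `d / 8` separates the ends of a
  -- window from the middle quarter where the step takes place.
  refine hf₁k.exists_coil_moves hΦ (hF3 1) hc' (a := a) (b := b)
    (η := η / 2) hb (fun t ht => by rw [hx0]; exact hx t ht) (N := N) (p := p) (q := q)
    (y₀ := y₀) (s := fun j => if 0 ≤ Δ j then 1 else -1) (δ := fun _ => d / 8)
    (fun j hj => ⟨(hpq j hj).1.le, (hpq j hj).2.1, (hpq j hj).2.2.le⟩) (fun i j hij hj => by
      have := cell_le (a := a) hd hij
      simp only [hp, hq]
      linarith) (fun j hj t ht => hf₁c t (hwin j hj t ht)) (fun j hj t ht v hv => ?_) hy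
    (fun j _ => by split_ifs <;> norm_num) (fun j hj t ht => ?_)
    (fun _ _ => by positivity) (fun j hj t ht => ?_) (fun j hj t ht => ?_) (fun j hj => ?_)
    (fun t ht hnt => ?_)
  · have htab := hwin j hj t ht
    have htI : t ∈ Icc a b := ⟨htab.1.le, htab.2.le⟩
    obtain ⟨r1, r2, r3⟩ := hpq j hj
    have hpI : p j ∈ Icc a b := ⟨r1.le, (r2.trans r3).le⟩
    have hqI : q j ∈ Icc a b := ⟨(r1.trans r2).le, r3.le⟩
    have h1 : dist v (c t) < η := by
      have := dist_triangle v (c' t) (c t)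
      linarith [hdist t htI]
    obtain ⟨h2, h3, h4⟩ := htube t htI v h1
    refine ⟨h2, h3, fun hv1 hv2 t' ht' heq => ?_⟩
    rw [hx'] at hv1 hv2
    have hva : c a 0 < v 0 := (hxm.monotoneOn haI hpI r1.le).trans_lt hv1
    have hvb : v 0 < c b 0 := hv2.trans_le (hxm.monotoneOn hqI hbI r3.le)
    -- On the arc, the rest of the knot has its first coordinate outside the range of the window;
    -- off the arc the knot is still `f`, and the original tube applies.
    have key : ∀ r ∈ Ioo a b, Φ.symm v = f₁ r → v 0 = c r 0 := by
      intro r hr h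
      rw [← hx', ← (hf₁c r hr).2, ← h, Φ.right_inv h2]
    have hper : f₁ (t' - 2 * Real.pi) = f₁ t' := hf₁k.periodic.sub_eq t'
    rcases lt_or_ge t' b with h5 | h5
    · have hr : t' ∈ Ioo a b := ⟨by linarith [ht'.1], h5⟩
      have h6 := key t' hr heq
      have h7 : c (q j) 0 ≤ c t' 0 := hxm.monotoneOn hqI ⟨hr.1.le, hr.2.le⟩ ht'.1
      linarith
    · rcases le_or_gt t' (a + 2 * Real.pi) with h6 | h6
      · have h7 : f₁ t' = f t' :=
          (hagree.eventuallyEq hf.periodic hf₁k.periodic 0 (by simpa using ⟨h5, h6⟩)).self_of_nhds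
        exact h4 hva hvb t' ⟨h5, h6⟩ (heq.trans h7)
      · have hr : t' - 2 * Real.pi ∈ Ioo a b := ⟨by linarith, by linarith [ht'.2]⟩
        have h7 := key _ hr (heq.trans hper.symm)
        have h8 : c (t' - 2 * Real.pi) 0 ≤ c (p j) 0 :=
          hxm.monotoneOn ⟨hr.1.le, hr.2.le⟩ hpI (by linarith [ht'.2])
        linarith
  · have h1 := hcell.deriv_eq j hj t (hwcell j t ht)
    rw [hy j hj t ht] at h1
    have h2 : deriv (fun t => c' t 2 - y₀ j * c' t 0) t =
        deriv (fun t => c' t 2) t - y₀ j * deriv (fun t => c' t 0) t :=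
      ((h2d t).hasDerivAt.sub ((h0d t).hasDerivAt.const_mul (y₀ j))).deriv
    rw [h2, h1]
    have h3 := deriv_cellStep_nonneg hd (a + j * d) t
    split_ifs with h4
    · rw [one_mul]; exact mul_nonneg h4 h3
    · have : 0 ≤ -Δ j := by linarith
      nlinarith [mul_nonneg this h3]
  · have ht' : t ∈ Icc (p j) (q j) := ⟨ht.1, by simp only [hp, hq] at ht ⊢; linarith [ht.2]⟩
    have h1 := hcell.sub_eq j hj t ht'
    rw [cellStep_of_le hd (by simp only [hp] at ht; linarith [ht.2]), mul_zero, add_zero] at h1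
    exact h1
  · have ht' : t ∈ Icc (p j) (q j) := ⟨by simp only [hp, hq] at ht ⊢; linarith [ht.1], ht.2⟩
    have h1 := hcell.sub_eq j hj t ht'
    have h2 := hcell.sub_eq j hj (q j) ⟨(hpq j hj).2.1.le, le_rfl⟩
    rw [cellStep_of_ge hd (by simp only [hq] at ht; linarith [ht.1])] at h1
    rw [cellStep_of_ge hd (by simp only [hq]; linarith)] at h2
    rw [h1, h2]
  · have h2 := hcell.sub_eq j hj (q j) ⟨(hpq j hj).2.1.le, le_rfl⟩
    rw [cellStep_of_ge hd (by simp only [hq]; linarith)] at h2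
    rw [h2]
    simp only [hp]
    rw [add_sub_cancel_left, mul_one]
    exact (hΔ j hj).trans_lt (by linarith)
  · by_cases hti : t ∈ Ioo a b
    · obtain ⟨h1, h2⟩ := hf₁c t hti
      obtain ⟨G, -, hG⟩ := hΦ.lev hf₁k.smooth.contMDiffAt h1
      have e : ∀ i : Fin 3, deriv (fun t => Φ (f₁ t) i) t = deriv (fun t => c' t i) t := fun i => by
        refine Filter.EventuallyEq.deriv_eq ?_
        filter_upwards [isOpen_Ioo.mem_nhds hti] with r hr
        rw [(hf₁c r hr).2]
      obtain ⟨j, hj, htj⟩ := exists_cell hd hN (hbd ▸ ht)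
      have h3 : deriv (cellStep (a + j * d) d) t = 0 := by
        have := hnt j hj
        rw [mem_Ioo, not_and_or, not_lt, not_lt] at this
        rcases this with h | h
        · exact deriv_cellStep_of_le hd (by simp only [hp] at h; linarith)
        · exact deriv_cellStep_of_ge hd (by simp only [hq] at h; linarith)
      rw [hG, e, e, h2, hcell.deriv_eq j hj t htj, h3, mul_zero, mul_zero]
    · rw [lev_congr (hagree.eventuallyEq_of_notMem hf.periodic hf₁k.periodic le_rfl le_rfl hb ht hti)]
      have : t = a ∨ t = b := by
        rw [mem_Ioo, not_and_or, not_lt, not_lt] at hti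
        rcases hti with h | h
        · exact Or.inl (le_antisymm h ht.1)
        · exact Or.inr (le_antisymm ht.2 h)
      rcases this with rfl | rfl
      · exact hla.self_of_nhds
      · exact hlb.self_of_nhds

/-! ### Legendrian junctions between two charts -/

/-- A smooth bump equal to one on `[-1/4, 1/4]` and vanishing outside `(-1/2, 1/2)`. -/
def unitBump (τ : ℝ) : ℝ :=
  Real.smoothTransition (2 - 4 * τ) * Real.smoothTransition (2 + 4 * τ)

theorem contDiff_unitBump : ContDiff ℝ ∞ unitBump := by
  refine ContDiff.mul ?_ ?_ <;> refine Real.smoothTransition.contDiff.comp ?_ <;> fun_prop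

theorem unitBump_nonneg (τ : ℝ) : 0 ≤ unitBump τ :=
  mul_nonneg (Real.smoothTransition.nonneg _) (Real.smoothTransition.nonneg _)

theorem unitBump_le_one (τ : ℝ) : unitBump τ ≤ 1 :=
  mul_le_one₀ (Real.smoothTransition.le_one _) (Real.smoothTransition.nonneg _)
    (Real.smoothTransition.le_one _)

theorem unitBump_of_abs_le {τ : ℝ} (h : |τ| ≤ 1 / 4) : unitBump τ = 1 := by
  have := abs_le.1 h
  rw [unitBump, Real.smoothTransition.one_of_one_le (by linarith),
    Real.smoothTransition.one_of_one_le (by linarith), one_mul]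

theorem unitBump_of_le_abs {τ : ℝ} (h : 1 / 2 ≤ |τ|) : unitBump τ = 0 := by
  rcases le_abs'.1 h with h | h
  · rw [unitBump, Real.smoothTransition.zero_of_nonpos (x := 2 + 4 * τ) (by linarith), mul_zero]
  · rw [unitBump, Real.smoothTransition.zero_of_nonpos (x := 2 - 4 * τ) (by linarith), zero_mul]

/-- A cut-off at scale `δ` has derivative of order `1/δ`. Multiplied by a function vanishing at the
centre, it becomes `τ u'(τ)` times a difference quotient, which is bounded uniformly in `δ`. -/
theorem exists_bound_mul_deriv_unitBump : ∃ K > 0, ∀ τ, |τ| ≤ 1 → |τ * deriv unitBump τ| ≤ K := by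
  obtain ⟨K, hK⟩ := isCompact_Icc.exists_bound_of_continuousOn (s := Icc (-1 : ℝ) 1)
    (f := fun τ => τ * deriv unitBump τ)
    (continuous_id.mul (contDiff_unitBump.continuous_deriv (by simp))).continuousOn
  exact ⟨max K 1, lt_max_of_lt_right one_pos, fun τ hτ =>
    (hK τ (abs_le.1 hτ)).trans (le_max_left _ _)⟩

/-- The difference between `c` and a Legendrian curve through `c t₀` with the same first
coordinate, with prescribed velocity at `t₀`. -/
theorem exists_legendrian_through {c : ℝ → E3} (hc : ContDiff ℝ ∞ c) (t₀ : ℝ) {W : E3}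
    (hW0 : W 0 = 0) (hW2 : W 2 ≠ 0) :
    ∃ D : ℝ → E3, ContDiff ℝ ∞ D ∧ D t₀ = 0 ∧ (∃ r : ℝ, deriv D t₀ = r • W) ∧
      (∀ t, D t 0 = 0) ∧ ∀ t, deriv (fun t => c t 2 + D t 2) t =
        (c t 1 + D t 1) * deriv (fun t => c t 0) t := by
  have hx := contDiff_coord_comp hc 0
  have hy := contDiff_coord_comp hc 1
  have hz := contDiff_coord_comp hc 2
  have hxd : ContDiff ℝ ∞ (deriv fun t => c t 0) := (contDiff_infty_iff_deriv.1 hx).2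
  -- The defect `y x' - z'` at `t₀`. Adding `(m / W 2) W` to the velocity cures it. The slope `k`
  -- gives the second coordinate this corrected velocity, and the third coordinate is then obtained
  -- by integration.
  set m := c t₀ 1 * deriv (fun t => c t 0) t₀ - deriv (fun t => c t 2) t₀ with hm
  set k := deriv (fun t => c t 1) t₀ + m / W 2 * W 1 with hk
  set l : ℝ → ℝ := fun t => c t₀ 1 + k * (t - t₀) with hl
  have hls : ContDiff ℝ ∞ l := by
    simp only [hl]; fun_prop
  have hld : HasDerivAt l k t₀ := by
    exact ((((hasDerivAt_id t₀).sub_const t₀).const_mul k).const_add (c t₀ 1)).congr_deriv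
      (mul_one k)
  set P : ℝ → ℝ := fun t => c t₀ 2 + ∫ r in t₀..t, l r * deriv (fun t => c t 0) r with hP
  have hPs : ContDiff ℝ ∞ P := contDiff_const.add (contDiff_primitive (hls.mul hxd) t₀)
  have hPd : ∀ t, HasDerivAt P (l t * deriv (fun t => c t 0) t) t := fun t =>
    (hasDerivAt_primitive (hls.mul hxd).continuous t₀ t).const_add _
  set D : ℝ → E3 := fun t => vec3 0 (l t - c t 1) (P t - c t 2) with hD
  have hDs : ContDiff ℝ ∞ D := contDiff_vec3 contDiff_const (hls.sub hy) (hPs.sub hz)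
  have hDd : DifferentiableAt ℝ D t₀ := hDs.differentiable (by simp) t₀
  refine ⟨D, hDs, ?_, ⟨m / W 2, ?_⟩, fun t => rfl, fun t => ?_⟩
  · apply E3.ext3 <;> simp [hD, hl, hP]
  · apply E3.ext3
    · rw [← deriv_coord hDd 0]
      simp [hD, hW0]
    · rw [← deriv_coord hDd 1]
      have : HasDerivAt (fun t => D t 1) (k - deriv (fun t => c t 1) t₀) t₀ :=
        hld.sub (hy.differentiable (by simp) t₀).hasDerivAt
      rw [this.deriv, hk]
      simp
    · rw [← deriv_coord hDd 2]
      have : HasDerivAt (fun t => D t 2)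
          (l t₀ * deriv (fun t => c t 0) t₀ - deriv (fun t => c t 2) t₀) t₀ :=
        (hPd t₀).sub (hz.differentiable (by simp) t₀).hasDerivAt
      rw [this.deriv]
      simp [hl, hm, hW2]
  · have h1 : (fun t => c t 2 + D t 2) = P := by
      funext t; simp [hD]
    rw [h1, (hPd t).deriv]
    simp [hD]

/-- Interpolate between `c` and the Legendrian curve `c + D` by a cut-off at a small scale. The
velocity changes by a bounded amount, but nearly along `W`, which `dφ` kills at the centre; hence
`φ` keeps increasing although the change is only `C⁰`-small. -/
theorem exists_junction_curve {c : ℝ → E3} (hc : ContDiff ℝ ∞ c) {t₀ : ℝ} {φ : E3 → ℝ}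
    (hφ : ContDiffAt ℝ ∞ φ (c t₀)) (hφc : 0 < fderiv ℝ φ (c t₀) (deriv c t₀)) {W : E3}
    (hW0 : W 0 = 0) (hW2 : W 2 ≠ 0) (hφW : fderiv ℝ φ (c t₀) W = 0) {η δ₀ : ℝ} (hη : 0 < η)
    (hδ₀ : 0 < δ₀) {U : Set E3} (hU : U ∈ 𝓝 (c t₀)) :
    ∃ (c' : ℝ → E3) (δ : ℝ), 0 < δ ∧ δ < δ₀ ∧ ContDiff ℝ ∞ c' ∧ (∀ t, c' t 0 = c t 0) ∧
      (∀ t, δ / 2 ≤ |t - t₀| → c' t = c t) ∧ (∀ t, dist (c' t) (c t) < η) ∧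
      (∀ t, |t - t₀| ≤ δ → c' t ∈ U ∧ 0 < deriv (fun t => φ (c' t)) t) ∧
      ∀ t, |t - t₀| < δ / 4 →
        deriv (fun t => c' t 2) t = c' t 1 * deriv (fun t => c' t 0) t := by
  obtain ⟨D, hD, hD0, ⟨r, hDr⟩, hDx, hDl⟩ := exists_legendrian_through hc t₀ hW0 hW2
  obtain ⟨K, hK, hKb⟩ := exists_bound_mul_deriv_unitBump
  have hcd : Differentiable ℝ c := hc.differentiable (by simp)
  have hDd : Differentiable ℝ D := hD.differentiable (by simp)
  have hφ' : ContinuousAt (fderiv ℝ φ) (c t₀) := (hφ.fderiv_right (m := ∞) (by simp)).continuousAt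
  have hφd : ∀ᶠ v in 𝓝 (c t₀), DifferentiableAt ℝ φ v := by
    have h1 : ContDiffAt ℝ 1 φ (c t₀) := hφ.of_le (WithTop.coe_le_coe.2 le_top)
    filter_upwards [h1.eventually (by simp)] with v hv using hv.differentiableAt (by simp)
  set A₀ := fderiv ℝ φ (c t₀) (deriv c t₀) with hA₀
  have hcont : ∀ g : ℝ → E3, ContinuousAt g t₀ →
      ContinuousAt (fun x : ℝ × E3 => fderiv ℝ φ x.2 (g x.1)) (t₀, c t₀) := fun g hg =>
    (ContinuousAt.comp (g := fderiv ℝ φ) (f := Prod.snd) (x := ((t₀, c t₀) : ℝ × E3)) hφ'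
      continuousAt_snd).clm_apply
      (ContinuousAt.comp (g := g) (f := Prod.fst) (x := ((t₀, c t₀) : ℝ × E3)) hg continuousAt_fst)
  have hDφ : fderiv ℝ φ (c t₀) (deriv D t₀) = 0 := by rw [hDr, map_smul, hφW, smul_zero]
  -- Budget for the derivative of `φ`: more than `A₀ / 2` from `c`, against at most `A₀ / 4` from
  -- the derivative of the cut-off and less than `A₀ / 4` from that of `D`.
  have e1 : ∀ᶠ x : ℝ × E3 in 𝓝 (t₀, c t₀), A₀ / 2 < fderiv ℝ φ x.2 (deriv c x.1) :=
    (hcont _ (hc.continuous_deriv (by simp)).continuousAt).eventually_const_lt (by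
      change A₀ / 2 < A₀; linarith)
  have e2 : ∀ᶠ x : ℝ × E3 in 𝓝 (t₀, c t₀), |fderiv ℝ φ x.2 (dslope D t₀ x.1)| < A₀ / (4 * K) :=
    (hcont _ (continuousAt_dslope_same.2 (hDd t₀))).abs.eventually_lt_const (by
      change |fderiv ℝ φ (c t₀) (dslope D t₀ t₀)| < _
      rw [dslope_same, hDφ, abs_zero]; positivity)
  have e3 : ∀ᶠ x : ℝ × E3 in 𝓝 (t₀, c t₀), |fderiv ℝ φ x.2 (deriv D x.1)| < A₀ / 4 :=
    (hcont _ (hD.continuous_deriv (by simp)).continuousAt).abs.eventually_lt_const (by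
      change |fderiv ℝ φ (c t₀) (deriv D t₀)| < _
      rw [hDφ, abs_zero]; positivity)
  have hUd : ∀ᶠ v in 𝓝 (c t₀), v ∈ U ∧ DifferentiableAt ℝ φ v := Filter.Eventually.and hU hφd
  have e4 : ∀ᶠ x : ℝ × E3 in 𝓝 (t₀, c t₀), x.2 ∈ U ∧ DifferentiableAt ℝ φ x.2 :=
    (continuousAt_snd (p := ((t₀, c t₀) : ℝ × E3))).eventually hUd
  obtain ⟨ρ, hρ, hρ'⟩ := Metric.eventually_nhds_iff.1 (e1.and (e2.and (e3.and e4)))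
  have hclose : ∀ᶠ t in 𝓝 t₀, dist (c t) (c t₀) + ‖D t‖ < min ρ η := by
    have h1 : ContinuousAt (fun t => dist (c t) (c t₀) + ‖D t‖) t₀ :=
      ((hc.continuous.dist continuous_const).add hD.continuous.norm).continuousAt
    refine h1.eventually_lt_const ?_
    change dist (c t₀) (c t₀) + ‖D t₀‖ < _
    rw [dist_self, hD0, norm_zero, add_zero]
    exact lt_min hρ hη
  obtain ⟨σ, hσ, hσ'⟩ := Metric.eventually_nhds_iff.1 hclose
  obtain ⟨δ, hδ, hδ1, hδ2, hδ3⟩ : ∃ δ > 0, δ < δ₀ ∧ δ < σ ∧ δ < ρ := by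
    obtain ⟨δ, h1, h2⟩ := exists_between (show 0 < min δ₀ (min σ ρ) by positivity)
    exact ⟨δ, h1, h2.trans_le (min_le_left _ _),
      h2.trans_le ((min_le_right _ _).trans (min_le_left _ _)),
      h2.trans_le ((min_le_right _ _).trans (min_le_right _ _))⟩
  have hus : ContDiff ℝ ∞ fun t => unitBump ((t - t₀) / δ) :=
    contDiff_unitBump.comp (by fun_prop)
  have hudist : ∀ t, ‖unitBump ((t - t₀) / δ) • D t‖ ≤ ‖D t‖ := by
    intro t
    rw [norm_smul, Real.norm_eq_abs, abs_of_nonneg (unitBump_nonneg _)]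
    exact mul_le_of_le_one_left (norm_nonneg _) (unitBump_le_one _)
  have hout : ∀ t, δ / 2 ≤ |t - t₀| → unitBump ((t - t₀) / δ) = 0 := by
    intro t ht
    refine unitBump_of_le_abs ?_
    rw [abs_div, abs_of_pos hδ, le_div_iff₀ hδ]
    linarith
  refine ⟨fun t => c t + unitBump ((t - t₀) / δ) • D t, δ, hδ, hδ1, hc.add (hus.smul hD),
    fun t => ?_, fun t ht => ?_, fun t => ?_, fun t ht => ?_, fun t ht => ?_⟩
  · simp [hDx]
  · simp only [hout t ht, zero_smul, add_zero]
  · rw [dist_eq_norm, add_sub_cancel_left]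
    rcases le_or_gt (δ / 2) |t - t₀| with h | h
    · rw [hout t h, zero_smul, norm_zero]; exact hη
    · have := hσ' (show dist t t₀ < σ by rw [Real.dist_eq]; linarith)
      have h2 := dist_nonneg (x := c t) (y := c t₀)
      exact (hudist t).trans_lt (by linarith [min_le_right ρ η])
  · have h1 := hσ' (show dist t t₀ < σ by rw [Real.dist_eq]; linarith)
    have h2 : dist (t, c t + unitBump ((t - t₀) / δ) • D t) (t₀, c t₀) < ρ := by
      rw [Prod.dist_eq]
      refine max_lt ?_ ?_
      · change dist t t₀ < ρ
        rw [Real.dist_eq]; linarith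
      · change dist (c t + unitBump ((t - t₀) / δ) • D t) (c t₀) < ρ
        have h3 := dist_triangle (c t + unitBump ((t - t₀) / δ) • D t) (c t) (c t₀)
        have h4 : dist (c t + unitBump ((t - t₀) / δ) • D t) (c t) =
            ‖unitBump ((t - t₀) / δ) • D t‖ := by rw [dist_eq_norm, add_sub_cancel_left]
        linarith [hudist t, min_le_left ρ η]
    obtain ⟨g1, g2, g3, g4, g5⟩ := hρ' h2
    refine ⟨g4, ?_⟩
    set τ := (t - t₀) / δ with hτ
    have hτ1 : |τ| ≤ 1 := by
      rw [hτ, abs_div, abs_of_pos hδ, div_le_one hδ]; exact ht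
    have hu : HasDerivAt (fun t => unitBump ((t - t₀) / δ)) (deriv unitBump τ * (1 / δ)) t :=
      HasDerivAt.comp (h₂ := unitBump) (h := fun t => (t - t₀) / δ) t
        ((contDiff_unitBump.differentiable (by simp) τ).hasDerivAt)
        (((hasDerivAt_id t).sub_const t₀).div_const δ)
    have h4 := (hcd t).hasDerivAt.add (hu.smul (hDd t).hasDerivAt)
    have h5 : HasDerivAt (fun t => φ (c t + unitBump ((t - t₀) / δ) • D t)) _ t :=
      HasFDerivAt.comp_hasDerivAt (l := φ) t g5.hasFDerivAt h4
    rw [h5.deriv]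
    -- As `D` vanishes at `t₀`, the factor `t - t₀` absorbs the `1/δ` of the cut-off; `dslope`
    -- extends the quotient continuously by `D'(t₀)`, a multiple of `W`.
    have h6 : D t = (t - t₀) • dslope D t₀ t := by
      rw [sub_smul_dslope, hD0, sub_zero]
    have h7 : (deriv unitBump τ * (1 / δ)) • D t =
        (τ * deriv unitBump τ) • dslope D t₀ t := by
      conv_lhs => rw [h6]
      rw [smul_smul]
      congr 1
      rw [hτ]; field_simp
    change 0 < fderiv ℝ φ (c t + unitBump τ • D t)
      (deriv c t + (unitBump τ • deriv D t + (deriv unitBump τ * (1 / δ)) • D t))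
    rw [h7, map_add, map_add, map_smul, map_smul, smul_eq_mul, smul_eq_mul]
    have k1 := hKb τ hτ1
    have k2 : |τ * deriv unitBump τ * fderiv ℝ φ (c t + unitBump τ • D t) (dslope D t₀ t)| ≤
        A₀ / 4 := by
      rw [abs_mul]
      refine (mul_le_mul k1 g2.le (abs_nonneg _) hK.le).trans (le_of_eq ?_)
      field_simp
    have k3 : |unitBump τ * fderiv ℝ φ (c t + unitBump τ • D t) (deriv D t)| < A₀ / 4 := by
      rw [abs_mul, abs_of_nonneg (unitBump_nonneg τ)]
      exact (mul_le_of_le_one_left (abs_nonneg _) (unitBump_le_one τ)).trans_lt g3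
    have k4 := (abs_le.1 k2).1
    have k5 := (abs_lt.1 k3).1
    change A₀ / 2 < fderiv ℝ φ (c t + unitBump τ • D t) (deriv c t) at g1
    linarith
  · have h1 : ∀ᶠ s in 𝓝 t, unitBump ((s - t₀) / δ) = 1 := by
      have : ∀ᶠ s in 𝓝 t, |s - t₀| < δ / 4 :=
        (by fun_prop : Continuous fun s => |s - t₀|).continuousAt.eventually_lt_const ht
      filter_upwards [this] with s hs
      refine unitBump_of_abs_le ?_
      rw [abs_div, abs_of_pos hδ, div_le_iff₀ hδ]
      linarith
    have h2 : (fun t => (c t + unitBump ((t - t₀) / δ) • D t) 2) =ᶠ[𝓝 t]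
        fun t => c t 2 + D t 2 := by
      filter_upwards [h1] with s hs
      simp [hs]
    have h3 : (fun t => (c t + unitBump ((t - t₀) / δ) • D t) 0) = fun t => c t 0 := by
      funext s; simp [hDx]
    have h4 : unitBump ((t - t₀) / δ) = 1 := h1.self_of_nhds
    rw [h2.deriv_eq, h3, hDl t]
    simp [h4]

theorem MonoAt.eventually {f : ℝ → M} (hf : ContMDiff 𝓘(ℝ, ℝ) (𝓡 3) ∞ f)
    {Φ : OpenPartialHomeomorph M E3} (hΦ : IsSmoothChart Φ) {t : ℝ} (h : MonoAt Φ f t) :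
    ∀ᶠ s in 𝓝 t, MonoAt Φ f s := by
  obtain ⟨c, hc, ε, hε, hcf⟩ := exists_chart_curve hf hΦ (le_refl t) fun s hs => by
    rw [Icc_self, mem_singleton_iff] at hs; rw [hs]; exact h.1
  have h1 : ∀ᶠ s in 𝓝 t, f s ∈ Φ.source ∧ Φ (f s) = c s := by
    filter_upwards [Icc_mem_nhds (show t - ε < t by linarith) (show t < t + ε by linarith)]
      with s hs using hcf s hs
  have h2 : (fun s => Φ (f s) 0) =ᶠ[𝓝 t] fun s => c s 0 := by
    filter_upwards [h1] with s hs
    rw [hs.2]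
  have h3 : 0 < deriv (fun s => c s 0) t := by rw [← h2.deriv_eq]; exact h.2
  have h4 := ((contDiff_coord_comp hc 0).continuous_deriv (by simp)).continuousAt.eventually_const_lt
    h3
  filter_upwards [h1, h2.deriv, h4] with s hs hs' hs''
  exact ⟨hs.1, by rw [hs']; exact hs''⟩

theorem fderiv_coord_comp_symm {Φ Φ' : OpenPartialHomeomorph M E3} (hΦ : IsSmoothChart Φ)
    (hΦ' : IsSmoothChart Φ') {p : M} (hp : p ∈ Φ.source) (hp' : p ∈ Φ'.source) (i : Fin 3) :
    ContDiffAt ℝ ∞ (fun v => Φ' (Φ.symm v) i) (Φ p) ∧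
      ∀ w : TangentSpace (𝓡 3) p, dcoord Φ' i p w =
        fderiv ℝ (fun v => Φ' (Φ.symm v) i) (Φ p) (mfderiv (𝓡 3) 𝓘(ℝ, E3) Φ p w) := by
  have h1 : ContMDiffAt 𝓘(ℝ, E3) (𝓡 3) ∞ Φ.symm (Φ p) :=
    hΦ.smooth_symm.contMDiffAt (Φ.open_target.mem_nhds (Φ.map_source hp))
  have h2 : ContMDiffAt (𝓡 3) 𝓘(ℝ, E3) ∞ Φ' (Φ.symm (Φ p)) := by
    rw [Φ.left_inv hp]
    exact hΦ'.smooth.contMDiffAt (Φ'.open_source.mem_nhds hp')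
  have h3 : ContDiffAt ℝ ∞ (fun v => Φ' (Φ.symm v)) (Φ p) :=
    contMDiffAt_iff_contDiffAt.1 (h2.comp _ h1)
  have h4 : ContDiffAt ℝ ∞ (fun v => Φ' (Φ.symm v) i) (Φ p) :=
    ContDiffAt.comp (g := fun v : E3 => v i) (Φ p) (contDiff_coord i).contDiffAt h3
  refine ⟨h4, fun w => ?_⟩
  have h5 : MDifferentiableAt (𝓡 3) 𝓘(ℝ, E3) Φ p :=
    (hΦ.smooth.contMDiffAt (Φ.open_source.mem_nhds hp)).mdifferentiableAt (by simp)
  have h6 : MDifferentiableAt 𝓘(ℝ, E3) 𝓘(ℝ, E3) (fun v => Φ' (Φ.symm v)) (Φ p) :=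
    (contMDiffAt_iff_contDiffAt.2 h3).mdifferentiableAt (by simp)
  have h7 := mfderiv_comp p h6 h5
  have h8 : ((fun v => Φ' (Φ.symm v)) ∘ Φ) =ᶠ[𝓝 p] Φ' := by
    filter_upwards [Φ.open_source.mem_nhds hp] with q hq
    simp only [Function.comp_apply]
    rw [Φ.left_inv hq]
  rw [h8.mfderiv_eq, mfderiv_eq_fderiv] at h7
  have h9 : fderiv ℝ (fun v => Φ' (Φ.symm v) i) (Φ p) =
      (EuclideanSpace.proj (𝕜 := ℝ) (ι := Fin 3) i).comp
        (fderiv ℝ (fun v => Φ' (Φ.symm v)) (Φ p)) :=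
    ((EuclideanSpace.proj (𝕜 := ℝ) (ι := Fin 3) i).hasFDerivAt.comp (Φ p)
      (h3.differentiableAt (by simp)).hasFDerivAt).fderiv
  rw [h9]
  exact congrArg (fun T : E3 →L[ℝ] E3 => T w i) h7

/-- At a point of a knot where it is monotone in two compatible charts, a small modification makes
the knot Legendrian near the point and keeps it monotone in both charts. -/
theorem PKnot.exists_legendrian_junction [T2Space M]
    {α : ∀ x : M, TangentSpace (𝓡 3) x →L[ℝ] ℝ} {f : ℝ → M} (hf : PKnot f)
    {Φ Φ' : OpenPartialHomeomorph M E3} (hΦ : IsDarboux α Φ) (hΦ' : IsSmoothChart Φ') {t₀ : ℝ}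
    (h : MonoAt Φ f t₀) (h' : MonoAt Φ' f t₀)
    (hw : ∃ w : TangentSpace (𝓡 3) (f t₀), dcoord Φ 0 (f t₀) w = 0 ∧ dcoord Φ' 0 (f t₀) w = 0 ∧
      α (f t₀) w ≠ 0) {O : Set (Circle × M)} (hO : IsOpen O) (hfO : GraphIn O f) {δ₀ : ℝ}
    (hδ₀ : 0 < δ₀) :
    ∃ (g : ℝ → M) (δ : ℝ), 0 < δ ∧ δ < δ₀ ∧ PIso f g ∧ GraphIn O g ∧
      AgreeOff f g (t₀ - δ) (t₀ + δ) ∧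
      (∀ t ∈ Icc (t₀ - δ) (t₀ + δ), MonoAt Φ g t ∧ MonoAt Φ' g t) ∧
      ∀ᶠ t in 𝓝 t₀, lev α g t = 0 := by
  obtain ⟨w, hw0, hw1, hw2⟩ := hw
  obtain ⟨c, hc, ε, hε, hcf⟩ := exists_chart_curve hf.smooth hΦ.toIsSmoothChart (le_refl t₀)
    fun s hs => by
      rw [Icc_self, mem_singleton_iff] at hs; rw [hs]; exact h.1
  have hct₀ : Φ (f t₀) = c t₀ := (hcf t₀ ⟨by linarith, by linarith⟩).2
  have hfc : ∀ᶠ s in 𝓝 t₀, f s ∈ Φ.source ∧ Φ (f s) = c s := by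
    filter_upwards [Icc_mem_nhds (show t₀ - ε < t₀ by linarith) (show t₀ < t₀ + ε by linarith)]
      with s hs using hcf s hs
  obtain ⟨hφ, hφd⟩ := fderiv_coord_comp_symm hΦ.toIsSmoothChart hΦ' h.1 h'.1 0
  set φ : E3 → ℝ := fun v => Φ' (Φ.symm v) 0 with hφdef
  set W : E3 := mfderiv (𝓡 3) 𝓘(ℝ, E3) Φ (f t₀) w with hW
  have hφW : fderiv ℝ φ (c t₀) W = 0 := by rw [← hct₀, ← hφd, hw1]
  -- In a Darboux chart `α w = G (W 2 - y W 0)`, and `W 0 = 0`.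
  have hW2 : W 2 ≠ 0 := by
    obtain ⟨G, hG, hGα⟩ := hΦ.form _ h.1
    have h1 := hGα w
    rw [hw0, mul_zero, sub_zero] at h1
    intro h2
    apply hw2
    rw [h1]
    exact mul_eq_zero_of_right _ h2
  have hφc : 0 < fderiv ℝ φ (c t₀) (deriv c t₀) := by
    have h1 : HasDerivAt (fun t => φ (c t)) (fderiv ℝ φ (c t₀) (deriv c t₀)) t₀ :=
      HasFDerivAt.comp_hasDerivAt (l := φ) t₀
        (by rw [← hct₀]; exact (hφ.differentiableAt (by simp)).hasFDerivAt)
        (hc.differentiable (by simp) t₀).hasDerivAt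
    have h2 : (fun t => Φ' (f t) 0) =ᶠ[𝓝 t₀] fun t => φ (c t) := by
      filter_upwards [hfc] with s hs
      rw [← hs.2, hφdef]
      simp only [Φ.left_inv hs.1]
    rw [← h1.deriv, ← h2.deriv_eq]
    exact h'.2
  obtain ⟨ρ, hρ, hρ'⟩ := Metric.eventually_nhds_iff.1 (h.eventually hf.smooth hΦ.toIsSmoothChart)
  obtain ⟨δ₁, hδ₁, hδ₁0, hδ₁ε, hδ₁ρ, hδ₁π⟩ :
      ∃ δ₁ > 0, δ₁ < δ₀ ∧ δ₁ < ε ∧ δ₁ < ρ ∧ δ₁ < Real.pi := by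
    obtain ⟨δ, h1, h2⟩ := exists_between
      (show 0 < min (min δ₀ ε) (min ρ Real.pi) from
        lt_min (lt_min hδ₀ hε) (lt_min hρ Real.pi_pos))
    exact ⟨δ, h1, h2.trans_le ((min_le_left _ _).trans (min_le_left _ _)),
      h2.trans_le ((min_le_left _ _).trans (min_le_right _ _)),
      h2.trans_le ((min_le_right _ _).trans (min_le_left _ _)),
      h2.trans_le ((min_le_right _ _).trans (min_le_right _ _))⟩
  have hmono : ∀ t ∈ Icc (t₀ - δ₁) (t₀ + δ₁), MonoAt Φ f t := fun t ht => hρ' (by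
    rw [Real.dist_eq, abs_lt]; constructor <;> linarith [ht.1, ht.2])
  have hcI : ∀ t ∈ Icc (t₀ - δ₁) (t₀ + δ₁), f t ∈ Φ.source ∧ Φ (f t) = c t := fun t ht =>
    hcf t ⟨by linarith [ht.1], by linarith [ht.2]⟩
  have hx : ∀ t ∈ Icc (t₀ - δ₁) (t₀ + δ₁), 0 < deriv (fun t => c t 0) t := fun t ht => by
    have h1 : (fun t => Φ (f t) 0) =ᶠ[𝓝 t] fun t => c t 0 := by
      filter_upwards [Ioo_mem_nhds (show t₀ - ε < t by linarith [ht.1])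
        (show t < t₀ + ε by linarith [ht.2])] with s hs
      rw [(hcf s ⟨hs.1.le, hs.2.le⟩).2]
    rw [← h1.deriv_eq]
    exact (hmono t ht).2
  have hπ : t₀ + δ₁ < t₀ - δ₁ + 2 * Real.pi := by linarith
  obtain ⟨η, hη, htube⟩ := hf.exists_tube (p := t₀ - δ₁) (q := t₀ + δ₁) (δ := ε - δ₁)
    (by linarith) hπ hc (by linarith)
    (fun t ht => hcf t ⟨by linarith [ht.1], by linarith [ht.2]⟩) hx hO hfO
  have hU : Φ.target ∩ Φ.symm ⁻¹' Φ'.source ∈ 𝓝 (c t₀) := by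
    rw [← hct₀]
    refine (Φ.isOpen_inter_preimage_symm Φ'.open_source).mem_nhds ⟨Φ.map_source h.1, ?_⟩
    rw [mem_preimage, Φ.left_inv h.1]
    exact h'.1
  obtain ⟨c', δ, hδ, hδδ₁, hc', hx', hout, hdist, hin, hleg⟩ :=
    exists_junction_curve hc (hct₀ ▸ hφ) hφc (W := W) hw0 hW2 hφW hη hδ₁ hU
  obtain ⟨F, hF1, hF2, hF3, hF4, hF5, hF6, hF7⟩ := hf.exists_graph_move hΦ.toIsSmoothChart
    (ε := δ₁ / 2) (by linarith) (by linarith) hπ hfO hc hc' hcI hx htube hx'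
    (fun t ht h1 => hout t (by
      rcases h1 with h1 | h1
      · exact le_abs.2 (Or.inr (by linarith))
      · exact le_abs.2 (Or.inl (by linarith)))) fun t _ => hdist t
  set g : ℝ → M := fun t => F (1, t) with hg
  have hgk : PKnot g := hF2 1
  have hgc : ∀ t ∈ Ioo (t₀ - δ₁) (t₀ + δ₁), g t ∈ Φ.source ∧ Φ (g t) = c' t := fun t ht => by
    obtain ⟨h1, h2⟩ := hF6 1 t ht
    refine ⟨h1, ?_⟩
    rw [hg, h2, Real.smoothTransition.one, one_smul, add_sub_cancel]
  -- The move was carried out over the larger interval of radius `δ₁`, but the curve changes only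
  -- within `δ / 2` of `t₀`, so the knot agrees with the old one off the smaller interval.
  have hgf : ∀ t ∈ Ioo (t₀ - δ₁) (t₀ + δ₁), δ / 2 ≤ |t - t₀| → g t = f t := fun t ht h1 => by
    obtain ⟨h2, h3⟩ := hgc t ht
    obtain ⟨h4, h5⟩ := hcI t ⟨ht.1.le, ht.2.le⟩
    exact Φ.injOn h2 h4 (by rw [h3, h5, hout t h1])
  have hge : ∀ t ∈ Icc (t₀ - δ) (t₀ + δ), ∀ᶠ s in 𝓝 t, g s ∈ Φ.source ∧ Φ (g s) = c' s := by
    intro t ht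
    filter_upwards [Ioo_mem_nhds (show t₀ - δ₁ < t by linarith [ht.1])
      (show t < t₀ + δ₁ by linarith [ht.2])] with s hs using hgc s hs
  have hgi : ∀ t ∈ Icc (t₀ - δ) (t₀ + δ), ∀ i : Fin 3,
      (fun s => Φ (g s) i) =ᶠ[𝓝 t] fun s => c' s i := by
    intro t ht i
    filter_upwards [hge t ht] with s hs
    rw [hs.2]
  have habs : ∀ t ∈ Icc (t₀ - δ) (t₀ + δ), |t - t₀| ≤ δ := fun t ht =>
    abs_le.2 ⟨by linarith [ht.1], by linarith [ht.2]⟩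
  refine ⟨g, δ, hδ, hδδ₁.trans hδ₁0, ⟨F, hF1, hF2, hF4, hF5⟩, hF3 1,
    ⟨δ / 2, by linarith, fun t ht => ?_⟩, fun t ht => ⟨?_, ?_⟩, ?_⟩
  · rcases lt_or_ge t (t₀ + δ₁) with h1 | h1
    · exact hgf t ⟨by linarith [ht.1], h1⟩ (le_abs.2 (Or.inl (by linarith [ht.1])))
    · rcases le_or_gt t (t₀ - δ₁ + 2 * Real.pi) with h2 | h2
      · exact hF7 1 t ⟨by linarith, by linarith⟩
      · have h3 := hgf (t - 2 * Real.pi) ⟨by linarith, by linarith [ht.2]⟩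
          (le_abs.2 (Or.inr (by linarith [ht.2])))
        rwa [hgk.periodic.sub_eq, hf.periodic.sub_eq] at h3
  · refine ⟨(hge t ht).self_of_nhds.1, ?_⟩
    rw [(hgi t ht 0).deriv_eq, show (fun s => c' s 0) = fun s => c s 0 from funext hx']
    exact hx t ⟨by linarith [ht.1], by linarith [ht.2]⟩
  · obtain ⟨h1, h2⟩ := hin t (habs t ht)
    have h3 := (hge t ht).self_of_nhds
    have h4 : g t = Φ.symm (c' t) := by rw [← h3.2, Φ.left_inv h3.1]
    have h5 : (fun s => Φ' (g s) 0) =ᶠ[𝓝 t] fun s => φ (c' s) := by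
      filter_upwards [hge t ht] with s hs
      rw [← hs.2, hφdef]
      simp only [Φ.left_inv hs.1]
    exact ⟨by rw [h4]; exact h1.2, by rw [h5.deriv_eq]; exact h2⟩
  · filter_upwards [Ioo_mem_nhds (show t₀ - δ / 4 < t₀ by linarith)
      (show t₀ < t₀ + δ / 4 by linarith)] with t ht
    have htI : t ∈ Icc (t₀ - δ) (t₀ + δ) := ⟨by linarith [ht.1], by linarith [ht.2]⟩
    obtain ⟨h1, h2⟩ := (hge t htI).self_of_nhds
    obtain ⟨G, -, hG⟩ := hΦ.lev hgk.smooth.contMDiffAt h1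
    rw [hG, (hgi t htI 0).deriv_eq, (hgi t htI 2).deriv_eq, h2,
      hleg t (abs_lt.2 ⟨by linarith [ht.1], by linarith [ht.2]⟩), sub_self, mul_zero]

/-! ### Darboux charts along a knot -/

theorem isSmoothChart_chartAt [IsManifold (𝓡 3) ∞ M] (p : M) : IsSmoothChart (chartAt E3 p) where
  smooth := contMDiffOn_chart (I := 𝓡 3)
  smooth_symm := contMDiffOn_chart_symm (I := 𝓡 3)

/-- `T` is the differential of `Φ.symm`, with values placed at `p` itself instead of at `Φ.symm (Φ
p)`; the last clause records that `α` does not see the difference. -/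
theorem IsSmoothChart.exists_inverse {Φ : OpenPartialHomeomorph M E3} (hΦ : IsSmoothChart Φ)
    {p : M} (hp : p ∈ Φ.source) (α : ∀ x : M, TangentSpace (𝓡 3) x →L[ℝ] ℝ) :
    ∃ T : E3 →L[ℝ] TangentSpace (𝓡 3) p, (∀ e, mfderiv (𝓡 3) 𝓘(ℝ, E3) Φ p (T e) = e) ∧
      (∀ v, T (mfderiv (𝓡 3) 𝓘(ℝ, E3) Φ p v) = v) ∧
      ∀ e : E3, α p (T e) = α (Φ.symm (Φ p)) (mfderiv 𝓘(ℝ, E3) (𝓡 3) Φ.symm (Φ p) e) := by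
  set A : E3 →L[ℝ] E3 := mfderiv (𝓡 3) 𝓘(ℝ, E3) Φ p with hA
  set B : E3 →L[ℝ] E3 := mfderiv 𝓘(ℝ, E3) (𝓡 3) Φ.symm (Φ p) with hB
  have h1 : HasMFDerivAt (𝓡 3) 𝓘(ℝ, E3) Φ p A :=
    ((hΦ.smooth.contMDiffAt (Φ.open_source.mem_nhds hp)).mdifferentiableAt
      (by simp)).hasMFDerivAt
  have h2 : HasMFDerivAt 𝓘(ℝ, E3) (𝓡 3) Φ.symm (Φ p) B :=
    ((hΦ.smooth_symm.contMDiffAt (Φ.open_target.mem_nhds (Φ.map_source hp))).mdifferentiableAt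
      (by simp)).hasMFDerivAt
  have h3 : ∀ q, q = p → HasMFDerivAt (𝓡 3) 𝓘(ℝ, E3) Φ q A := by rintro _ rfl; exact h1
  have h4 := (h3 _ (Φ.left_inv hp)).comp (Φ p) h2
  have h5 := h2.comp p h1
  have h6 : (Φ ∘ Φ.symm) =ᶠ[𝓝 (Φ p)] id := by
    filter_upwards [Φ.open_target.mem_nhds (Φ.map_source hp)] with v hv using Φ.right_inv hv
  have h7 : (Φ.symm ∘ Φ) =ᶠ[𝓝 p] id := by
    filter_upwards [Φ.open_source.mem_nhds hp] with v hv using Φ.left_inv hv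
  have h8 : A.comp B = ContinuousLinearMap.id ℝ E3 := by
    have := h4.mfderiv.symm.trans h6.mfderiv_eq
    rw [mfderiv_id] at this
    exact this
  have h9 : B.comp A = ContinuousLinearMap.id ℝ E3 := by
    have := h5.mfderiv.symm.trans h7.mfderiv_eq
    rw [mfderiv_id] at this
    exact this
  have key : ∀ q, q = p → ∀ e : E3, α p e = α q e := by rintro _ rfl e; rfl
  exact ⟨B, fun e => congrArg (fun T : E3 →L[ℝ] E3 => T e) h8,
    fun e => congrArg (fun T : E3 →L[ℝ] E3 => T e) h9, fun e => key _ (Φ.left_inv hp) _⟩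

theorem localForm_apply {p m : M} (α : ∀ x : M, TangentSpace (𝓡 3) x →L[ℝ] ℝ) (e : E3) :
    localForm α p (chartAt E3 p m) e = α ((chartAt E3 p).symm (chartAt E3 p m))
      (mfderiv 𝓘(ℝ, E3) (𝓡 3) (chartAt E3 p).symm (chartAt E3 p m) e) := rfl

/-- The chart at `p` followed by Darboux coordinates for the local form; the prescribed linear first
coordinate survives as `l` of the differential of the original chart. -/
theorem exists_darboux_chart [IsManifold (𝓡 3) ∞ M]
    {α : ∀ x : M, TangentSpace (𝓡 3) x →L[ℝ] ℝ} (hα : IsContactForm α) (p : M)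
    {l : E3 →L[ℝ] ℝ} (hl : ∃ v, localForm α p (chartAt E3 p p) v = 0 ∧ l v ≠ 0) :
    ∃ Φ : OpenPartialHomeomorph M E3, IsDarboux α Φ ∧ p ∈ Φ.source ∧
      Φ.source ⊆ (chartAt E3 p).source ∧
      ∀ m ∈ Φ.source, ∀ v, dcoord Φ 0 m v = l (mfderiv (𝓡 3) 𝓘(ℝ, E3) (chartAt E3 p) m v) := by
  set C := chartAt E3 p with hC
  have hCs : IsSmoothChart C := isSmoothChart_chartAt p
  have hp : p ∈ C.source := mem_chart_source E3 p
  have htar : (extChartAt (𝓡 3) p).target = C.target := by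
    rw [extChartAt_target]; simp [hC]
  obtain ⟨D, hD1, hD2, hD3, hD4, hD5, hD6⟩ := exists_darboux_coordinates (β := localForm α p)
    C.open_target (C.map_source hp) (htar ▸ hα.smooth p)
    (hα.wedge_ne_zero p _ (by rw [htar]; exact C.map_source hp)) hl
  have hsm : ∀ m ∈ (C.trans D).source, m ∈ C.source ∧ C m ∈ D.source := fun m hm => by
    simpa using hm
  have hder : ∀ m ∈ (C.trans D).source, ∀ v, mfderiv (𝓡 3) 𝓘(ℝ, E3) (C.trans D) m v =
      fderiv ℝ D (C m) (mfderiv (𝓡 3) 𝓘(ℝ, E3) C m v) := by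
    intro m hm v
    obtain ⟨h1, h2⟩ := hsm m hm
    have h3 : MDifferentiableAt (𝓡 3) 𝓘(ℝ, E3) C m :=
      (hCs.smooth.contMDiffAt (C.open_source.mem_nhds h1)).mdifferentiableAt (by simp)
    have h4 : MDifferentiableAt 𝓘(ℝ, E3) 𝓘(ℝ, E3) D (C m) :=
      ((hD3.contDiffAt (D.open_source.mem_nhds h2)).differentiableAt (by simp)).mdifferentiableAt
    have h5 := mfderiv_comp m h4 h3
    rw [mfderiv_eq_fderiv] at h5
    exact congrArg (fun T : E3 →L[ℝ] E3 => T v) h5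
  have hD0 : ∀ x ∈ D.source, ∀ v, fderiv ℝ D x v 0 = l v := by
    intro x hx v
    have h1 := (EuclideanSpace.proj (𝕜 := ℝ) (ι := Fin 3) 0).hasFDerivAt.comp x
      ((hD3.contDiffAt (D.open_source.mem_nhds hx)).differentiableAt (by simp)).hasFDerivAt
    have h2 : HasFDerivAt (fun x => D x 0) l x := by
      rw [show (fun x => D x 0) = l from funext hD5]
      exact l.hasFDerivAt
    exact congrArg (fun T : E3 →L[ℝ] ℝ => T v) (h1.unique h2)
  refine ⟨C.trans D, ⟨⟨?_, ?_⟩, fun m hm => ?_⟩, by simpa using ⟨hp, hD1⟩,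
    fun m hm => (hsm m hm).1, fun m hm v => ?_⟩
  · intro m hm
    obtain ⟨h1, h2⟩ := hsm m hm
    exact (ContMDiffAt.comp m (hD3.contDiffAt (D.open_source.mem_nhds h2)).contMDiffAt
      (hCs.smooth.contMDiffAt (C.open_source.mem_nhds h1))).contMDiffWithinAt
  · intro v hv
    have h1 : v ∈ D.target ∧ D.symm v ∈ C.target := by simpa using hv
    exact (ContMDiffAt.comp v (hCs.smooth_symm.contMDiffAt (C.open_target.mem_nhds h1.2))
      (hD4.contDiffAt (D.open_target.mem_nhds h1.1)).contMDiffAt).contMDiffWithinAt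
  · obtain ⟨h1, h2⟩ := hsm m hm
    obtain ⟨T, -, hT2, hT3⟩ := hCs.exists_inverse h1 α
    obtain ⟨G, hG, hGv⟩ := hD6 (C m) h2
    refine ⟨G, hG, fun v => ?_⟩
    have h3 := hT3 (mfderiv (𝓡 3) 𝓘(ℝ, E3) C m v)
    rw [hT2] at h3
    have h4 := h3.trans ((localForm_apply α _).symm.trans (hGv _))
    rw [← hder m hm v] at h4
    exact h4
  · obtain ⟨h1, h2⟩ := hsm m hm
    have h3 := hD0 _ h2 (mfderiv (𝓡 3) 𝓘(ℝ, E3) C m v)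
    rw [← hder m hm v] at h3
    exact h3

/-- A frame `(e₀, e₁, R)` with `b R ≠ 0`, and two forms of its dual coframe adapted to `u`. -/
structure AdaptedFrame (b : E3 →L[ℝ] ℝ) (c₀ c₁ : E3 →L[ℝ] ℝ) (e₀ e₁ R : E3) : Prop where
  c₀_e₀ : c₀ e₀ = 1
  c₁_e₀ : c₁ e₀ = 0
  c₀_e₁ : c₀ e₁ = 0
  c₁_e₁ : c₁ e₁ = 1
  c₀_R : c₀ R = 0
  c₁_R : c₁ R = 0
  b_R : b R ≠ 0

/-- As `u i ≠ 0`, the vector `u` and the basis vectors `j`, `k` form a basis. If `b` is nonzero on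
one of the latter, that vector serves as `R`. -/
theorem exists_adaptedFrame_aux {u : E3} {b : E3 →L[ℝ] ℝ} (hb : b ≠ 0) {i j k : Fin 3}
    (hij : i ≠ j) (hik : i ≠ k) (hjk : j ≠ k) (huniv : ∀ a, a = i ∨ a = j ∨ a = k)
    (hu : u i ≠ 0) : ∃ (c₀ c₁ : E3 →L[ℝ] ℝ) (e₁ R : E3), AdaptedFrame b c₀ c₁ u e₁ R := by
  set P : Fin 3 → E3 →L[ℝ] ℝ := fun a => EuclideanSpace.proj a with hP
  set e : Fin 3 → E3 := fun a => EuclideanSpace.single a 1 with he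
  have hPe : ∀ a c, P a (e c) = if a = c then 1 else 0 := fun a c => by simp [hP, he]
  have hPu : ∀ a, P a u = u a := fun a => rfl
  have hone : ∀ j k : Fin 3, i ≠ j → i ≠ k → j ≠ k → b (e j) ≠ 0 →
      ∃ (c₀ c₁ : E3 →L[ℝ] ℝ) (e₁ R : E3), AdaptedFrame b c₀ c₁ u e₁ R := by
    intro j k hij hik hjk hbj
    refine ⟨(u i)⁻¹ • P i, P k - (u k / u i) • P i, e k, e j, ?_, ?_, ?_, ?_, ?_, ?_, hbj⟩ <;>
      simp [hPe, hPu, hu, hik, hij, hjk.symm]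
  by_cases h1 : b (e j) = 0
  · by_cases h2 : b (e k) = 0
    · have hu' : u = u i • e i + u j • e j + u k • e k := by
        ext a
        rcases huniv a with rfl | rfl | rfl <;>
          simp [he, hij, hik, hjk, hij.symm, hik.symm, hjk.symm]
      have hbi : b (e i) ≠ 0 := by
        intro h3
        apply hb
        ext v
        have hv : v = v i • e i + v j • e j + v k • e k := by
          ext a
          rcases huniv a with rfl | rfl | rfl <;>
            simp [he, hij, hik, hjk, hij.symm, hik.symm, hjk.symm]
        rw [hv, map_add, map_add, map_smul, map_smul, map_smul, h1, h2, h3]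
        simp
      have hbu : b u ≠ 0 := by
        rw [hu', map_add, map_add, map_smul, map_smul, map_smul, h1, h2]
        simp [hu, hbi]
      -- Now `b` is nonzero on `u` but vanishes on `e j`, so `R = e j + u`; the correction in the
      -- first form makes it vanish on this `R`.
      refine ⟨(u i)⁻¹ • P i - (P j - (u j / u i) • P i), P k - (u k / u i) • P i, e k, e j + u,
        ?_, ?_, ?_, ?_, ?_, ?_, by rwa [map_add, h1, zero_add]⟩ <;>
        simp [hPe, hPu, hu, hik, hij, hjk.symm, hjk]
    · exact hone k j hik hij hjk.symm h2
  · exact hone j k hij hik hjk h1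

theorem exists_adaptedFrame {u : E3} (hu : u ≠ 0) {b : E3 →L[ℝ] ℝ} (hb : b ≠ 0) :
    ∃ (c₀ c₁ : E3 →L[ℝ] ℝ) (e₁ R : E3), AdaptedFrame b c₀ c₁ u e₁ R := by
  obtain ⟨i, hi⟩ : ∃ i, u i ≠ 0 := by
    by_contra! h
    exact hu (by ext i; exact h i)
  have hperm : ∀ i : Fin 3, ∃ j k : Fin 3, i ≠ j ∧ i ≠ k ∧ j ≠ k ∧
      ∀ a, a = i ∨ a = j ∨ a = k := by decide
  obtain ⟨j, k, h1, h2, h3, h4⟩ := hperm i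
  exact exists_adaptedFrame_aux hb h1 h2 h3 h4 hi

/-- At `p` the first coordinates of `Φ` and `Φ'` are constant on a line transverse to `ker α`. -/
def Compatible (α : ∀ x : M, TangentSpace (𝓡 3) x →L[ℝ] ℝ) (Φ Φ' : OpenPartialHomeomorph M E3)
    (p : M) : Prop :=
  ∃ w : TangentSpace (𝓡 3) p, dcoord Φ 0 p w = 0 ∧ dcoord Φ' 0 p w = 0 ∧ α p w ≠ 0

theorem Compatible.symm {α : ∀ x : M, TangentSpace (𝓡 3) x →L[ℝ] ℝ}
    {Φ Φ' : OpenPartialHomeomorph M E3} {p : M} (h : Compatible α Φ Φ' p) :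
    Compatible α Φ' Φ p := by
  obtain ⟨w, h0, h1, h2⟩ := h
  exact ⟨w, h1, h0, h2⟩

/-- On `ker a` the forms `m` and `m'` are independent and `l` is nonzero, so `l` is independent of
at least one of them there. For an independent pair, correcting `R` by vectors of `ker a` kills both
forms without changing `a R`. -/
theorem exists_common_kernel {V : Type*} [AddCommGroup V] [Module ℝ V] {a l m m' : V →ₗ[ℝ] ℝ}
    {e e' v R : V} (he : a e = 0) (hme : m e = 0) (hme' : m' e ≠ 0) (he' : a e' = 0)
    (hm'e' : m' e' = 0) (hmm : m e' ≠ 0) (hv : a v = 0) (hlv : l v ≠ 0) (hR : a R ≠ 0) :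
    (∃ w, l w = 0 ∧ m w = 0 ∧ a w ≠ 0) ∨ ∃ w, l w = 0 ∧ m' w = 0 ∧ a w ≠ 0 := by
  have two : ∀ (m : V →ₗ[ℝ] ℝ) (x y : V), a x = 0 → a y = 0 → l x ≠ 0 → m y ≠ 0 →
      l y = 0 ∨ m x = 0 → ∃ w, l w = 0 ∧ m w = 0 ∧ a w ≠ 0 := by
    intro m x y hx hy hlx hmy h
    rcases h with h | h
    · refine ⟨R - (l R / l x) • x - ((m R - l R / l x * m x) / m y) • y, ?_, ?_, ?_⟩
      · simp [h, hlx]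
      · simp only [map_sub, map_smul, smul_eq_mul]; field_simp; ring
      · simpa [hx, hy] using hR
    · refine ⟨R - ((l R - m R / m y * l y) / l x) • x - (m R / m y) • y, ?_, ?_, ?_⟩
      · simp only [map_sub, map_smul, smul_eq_mul]; field_simp; ring
      · simp [h, hmy]
      · simpa [hx, hy] using hR
  by_cases h1 : l e = 0
  · by_cases h2 : l e' = 0
    · exact Or.inl (two m v e' hv he' hlv hmm (Or.inl h2))
    · exact Or.inr (two m' e' e he' he h2 hme' (Or.inr hm'e'))
  · exact Or.inl (two m e e' he he' h1 hmm (Or.inr hme))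

/-- Near each of its points a knot is monotone with respect to the first coordinates of three
Darboux charts, any two of which are independent on the contact planes. -/
theorem exists_darboux_triple [IsManifold (𝓡 3) ∞ M]
    {α : ∀ x : M, TangentSpace (𝓡 3) x →L[ℝ] ℝ} (hα : IsContactForm α) {f : ℝ → M}
    (hf : PKnot f) (s : ℝ) :
    ∃ Φ : Fin 3 → OpenPartialHomeomorph M E3, (∀ k, IsDarboux α (Φ k)) ∧ ∀ᶠ t in 𝓝 s,
      (∀ k, MonoAt (Φ k) f t) ∧ (∀ k, ∃ v, α (f t) v = 0 ∧ dcoord (Φ k) 0 (f t) v ≠ 0) ∧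
      ∀ Ψ : OpenPartialHomeomorph M E3, (∃ v, α (f t) v = 0 ∧ dcoord Ψ 0 (f t) v ≠ 0) →
        ∀ k k', k ≠ k' → Compatible α Ψ (Φ k) (f t) ∨ Compatible α Ψ (Φ k') (f t) := by
  set p := f s with hp
  set C := chartAt E3 p with hC
  have hCs : IsSmoothChart C := isSmoothChart_chartAt p
  have hpC : p ∈ C.source := mem_chart_source E3 p
  have htar : (extChartAt (𝓡 3) p).target = C.target := by
    rw [extChartAt_target]; simp [hC]
  set u : E3 := mfderiv (𝓡 3) 𝓘(ℝ, E3) C p (vel f s) with hu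
  have hu0 : u ≠ 0 := by
    obtain ⟨T, -, hT, -⟩ := hCs.exists_inverse hpC α
    intro h
    have h1 := hT (vel f s)
    rw [← hu, h] at h1
    exact hf.imm s (h1.symm.trans (map_zero T))
  have hb0 : localForm α p (C p) ≠ 0 := by
    obtain ⟨x, y, z, h⟩ := hα.wedge_ne_zero p (C p) (by rw [htar]; exact C.map_source hpC)
    intro h0
    apply h
    rw [wedge₁₂, h0]
    simp
  obtain ⟨c₀, c₁, e₁, R, hfr⟩ := exists_adaptedFrame hu0 hb0
  -- All three forms are one on the velocity `u`, so all three coordinates increase along the knot.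
  -- All vanish on `R`, and their values `0, 1, 2` on `e₁` make them pairwise independent.
  set l : Fin 3 → E3 →L[ℝ] ℝ := fun k => c₀ + (k : ℝ) • c₁ with hl
  have hlu : ∀ k, l k u = 1 := fun k => by simp [hl, hfr.c₀_e₀, hfr.c₁_e₀]
  have hle : ∀ k, l k e₁ = k := fun k => by simp [hl, hfr.c₀_e₁, hfr.c₁_e₁]
  have hlR : ∀ k, l k R = 0 := fun k => by simp [hl, hfr.c₀_R, hfr.c₁_R]
  have hex : ∀ k, ∃ v, localForm α p (C p) v = 0 ∧ l k v ≠ 0 := fun k =>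
    ⟨u - (localForm α p (C p) u / localForm α p (C p) R) • R, by simp [hfr.b_R], by
      simp [hlu, hlR]⟩
  choose Φ hΦ hpΦ hΦC hΦl using fun k => exists_darboux_chart hα p (hex k)
  refine ⟨Φ, hΦ, ?_⟩
  have hfs : ContinuousAt f s := hf.smooth.continuous.continuousAt
  have h1 : ∀ᶠ t in 𝓝 s, ∀ k, MonoAt (Φ k) f t := by
    rw [eventually_all]
    intro k
    refine MonoAt.eventually hf.smooth (hΦ k).toIsSmoothChart ⟨hpΦ k, ?_⟩
    rw [(hΦ k).toIsSmoothChart.deriv_coord_comp hf.smooth.contMDiffAt (hpΦ k), hΦl k p (hpΦ k),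
      ← hu, hlu]
    exact one_pos
  have h2 : ∀ᶠ t in 𝓝 s, localForm α p (C (f t)) R ≠ 0 := by
    have hc1 : ContinuousAt (localForm α p) (C p) :=
      ((hα.smooth p).continuousOn.continuousAt (by
        rw [htar]; exact C.open_target.mem_nhds (C.map_source hpC)))
    have hc2 : ContinuousAt (fun t => C (f t)) s :=
      ContinuousAt.comp (g := C) (C.continuousAt hpC) hfs
    have hc3 : ContinuousAt (fun t => localForm α p (C (f t))) s :=
      ContinuousAt.comp (g := localForm α p) hc1 hc2
    exact (hc3.clm_apply continuousAt_const).eventually_ne hfr.b_R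
  filter_upwards [h1, h2] with t ht1 ht2
  have htC : f t ∈ C.source := hΦC 0 (ht1 0).1
  obtain ⟨T, hT1, hT2, hT3⟩ := hCs.exists_inverse htC α
  have hαT : ∀ e, α (f t) (T e) = localForm α p (C (f t)) e := fun e =>
    (hT3 e).trans (localForm_apply α e).symm
  have hdT : ∀ k e, dcoord (Φ k) 0 (f t) (T e) = l k e := fun k e =>
    (hΦl k _ (ht1 k).1 _).trans (congrArg (l k) (hT1 e))
  generalize localForm α p (C (f t)) = b at ht2 hαT
  -- Projection along `R` to `ker b` preserves the values of all `l k`, so independence passes to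
  -- the contact plane at nearby points. The vectors `e₁ - k u` test it.
  set E : E3 → E3 := fun e => e - (b e / b R) • R with hE
  have hbE : ∀ e, b (E e) = 0 := fun e => by simp [hE, ht2]
  have hlE : ∀ k e, l k (E e) = l k e := fun k e => by simp [hE, hlR]
  refine ⟨ht1, fun k => ⟨T (E u), by rw [hαT, hbE], by rw [hdT, hlE, hlu]; exact one_ne_zero⟩,
    fun Ψ ⟨v, hv0, hv1⟩ k k' hkk => ?_⟩
  have hkk' : (k : ℝ) ≠ (k' : ℝ) := by
    intro h
    exact hkk (Fin.ext (by exact_mod_cast h))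
  have hlk : ∀ i j : Fin 3, l i (e₁ - (j : ℝ) • u) = i - j := fun i j => by
    simp [hle, hlu]
  exact exists_common_kernel (a := (α (f t)).toLinearMap) (l := (dcoord Ψ 0 (f t)).toLinearMap)
    (m := (dcoord (Φ k) 0 (f t)).toLinearMap) (m' := (dcoord (Φ k') 0 (f t)).toLinearMap)
    (e := T (E (e₁ - (k : ℝ) • u))) (e' := T (E (e₁ - (k' : ℝ) • u))) (v := v) (R := T R)
    ((hαT _).trans (hbE _)) ((hdT _ _).trans (by rw [hlE, hlk, sub_self]))
    (fun h => sub_ne_zero.2 hkk'.symm (by rw [← hlk, ← hlE, ← hdT]; exact h))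
    ((hαT _).trans (hbE _)) ((hdT _ _).trans (by rw [hlE, hlk, sub_self]))
    (fun h => sub_ne_zero.2 hkk' (by rw [← hlk, ← hlE, ← hdT]; exact h)) hv0 hv1
    (fun h => ht2 (by rw [← hαT]; exact h))

/-- Each condition excludes at most one of the three candidates; this is why three charts are needed
at each point. -/
theorem exists_and_of_fin_three {P Q : Fin 3 → Prop} (hP : ∀ a b, a ≠ b → P a ∨ P b)
    (hQ : ∀ a b, a ≠ b → Q a ∨ Q b) : ∃ a, P a ∧ Q a := by
  have h1 := hP 0 1 (by decide)
  have h2 := hP 0 2 (by decide)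
  have h3 := hP 1 2 (by decide)
  have h4 := hQ 0 1 (by decide)
  have h5 := hQ 0 2 (by decide)
  have h6 := hQ 1 2 (by decide)
  by_contra! h
  have h7 := h 0
  have h8 := h 1
  have h9 := h 2
  tauto

/-- A greedy choice starting from `0`. Only the last choice has two neighbours to satisfy, its
predecessor and the initial `0`. -/
theorem exists_cyclic_choice {N : ℕ} (hN : 2 ≤ N) {good : ℕ → Fin 3 → Fin 3 → Prop}
    {closing : Fin 3 → Fin 3 → Prop}
    (hg : ∀ i, i + 1 < N → ∀ a b b', b ≠ b' → good i a b ∨ good i a b')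
    (hc : ∀ b a a', a ≠ a' → closing a b ∨ closing a' b) :
    ∃ k : ℕ → Fin 3, (∀ i, i + 1 < N → good i (k i) (k (i + 1))) ∧ closing (k (N - 1)) (k 0) := by
  have step : ∀ i a, ∃ b, (i + 1 < N → good i a b) ∧ (i + 2 = N → closing b 0) := fun i a =>
    exists_and_of_fin_three (fun b b' hb => by
      by_cases h : i + 1 < N
      · exact (hg i h a b b' hb).imp (fun h _ => h) fun h _ => h
      · exact Or.inl fun h' => absurd h' h) fun b b' hb =>
      (hc 0 b b' hb).imp (fun h _ => h) fun h _ => h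
  choose next hnext using step
  let k : ℕ → Fin 3 := fun n => Nat.rec 0 (fun i a => next i a) n
  refine ⟨k, fun i hi => (hnext i (k i)).1 hi, ?_⟩
  obtain ⟨m, rfl⟩ : ∃ m, N = m + 2 := ⟨N - 2, by omega⟩
  exact (hnext m (k m)).2 rfl

theorem monoAt_add_int_mul {Φ : OpenPartialHomeomorph M E3} {f : ℝ → M}
    (hf : Function.Periodic f (2 * Real.pi)) (k : ℤ) (t : ℝ) :
    MonoAt Φ f (t + k * (2 * Real.pi)) ↔ MonoAt Φ f t := by
  have h1 : f (t + k * (2 * Real.pi)) = f t := hf.int_mul k t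
  have h2 : (fun t => Φ (f (t + k * (2 * Real.pi))) 0) = fun t => Φ (f t) 0 := by
    funext s
    rw [show f (s + k * (2 * Real.pi)) = f s from hf.int_mul k s]
  have h3 := deriv_comp_add_const (fun t => Φ (f t) 0) (k * (2 * Real.pi)) t
  rw [h2] at h3
  rw [MonoAt, MonoAt, h1, h3]

/-! ### Cyclic covers by Darboux charts -/

/-- A cyclic cover of a knot by arcs of length `h`, each monotone in a Darboux chart. -/
structure IsDarbouxCover (α : ∀ x : M, TangentSpace (𝓡 3) x →L[ℝ] ℝ) (f : ℝ → M) (N : ℕ) (h : ℝ)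
    (Φ : ℤ → OpenPartialHomeomorph M E3) : Prop where
  two_le : 2 ≤ N
  mul_eq : N * h = 2 * Real.pi
  darboux : ∀ j, IsDarboux α (Φ j)
  periodic : ∀ j k : ℤ, Φ (j + k * N) = Φ j
  mono : ∀ j : ℤ, ∀ t ∈ Icc (j * h) ((j + 1) * h), MonoAt (Φ j) f t
  compat : ∀ j : ℤ, Compatible α (Φ (j - 1)) (Φ j) (f (j * h))

theorem IsDarbouxCover.pos {α : ∀ x : M, TangentSpace (𝓡 3) x →L[ℝ] ℝ} {f : ℝ → M} {N : ℕ} {h : ℝ}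
    {Φ : ℤ → OpenPartialHomeomorph M E3} (H : IsDarbouxCover α f N h Φ) : 0 < h := by
  have h1 := H.mul_eq
  have h2 := Real.two_pi_pos
  have h3 : (0 : ℝ) < N := by exact_mod_cast (by have := H.two_le; omega : 0 < N)
  exact pos_of_mul_pos_right (h1 ▸ h2) h3.le

theorem exists_darbouxCover [IsManifold (𝓡 3) ∞ M]
    {α : ∀ x : M, TangentSpace (𝓡 3) x →L[ℝ] ℝ} (hα : IsContactForm α) {f : ℝ → M}
    (hf : PKnot f) : ∃ N h Φ, IsDarbouxCover α f N h Φ := by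
  choose Φ hΦ hev using fun s => exists_darboux_triple hα hf s
  choose U hU hUo hsU using fun s => eventually_nhds_iff.1 (hev s)
  -- Arcs shorter than a Lebesgue number each lie in one neighbourhood carrying a triple of charts.
  obtain ⟨δ, hδ, hδU⟩ := lebesgue_number_lemma_of_metric
    (isCompact_Icc (a := (0 : ℝ)) (b := 2 * Real.pi)) hUo fun s _ => mem_iUnion.2 ⟨s, hsU s⟩
  obtain ⟨n, hn⟩ := exists_nat_gt (2 * Real.pi / δ)
  set N := n + 2 with hN
  have hN0 : (0 : ℝ) < N := by positivity
  have hNn : (n : ℝ) < N := by simp [hN]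
  set h := 2 * Real.pi / N with hh
  have hh0 : 0 < h := div_pos Real.two_pi_pos hN0
  have hhδ : h < δ := by
    rw [div_lt_iff₀ hδ] at hn
    rw [hh, div_lt_iff₀ hN0]
    nlinarith
  have hNh : N * h = 2 * Real.pi := by rw [hh]; field_simp
  have hnode : ∀ r : ℕ, r < N → ((r : ℝ) + 1) * h ≤ 2 * Real.pi := fun r hr => by
    rw [← hNh]
    have : (r : ℝ) + 1 ≤ N := by exact_mod_cast hr
    gcongr
  have hcen : ∀ r : ℕ, ∃ s, r < N → ∀ t ∈ Icc (r * h) ((r + 1) * h), t ∈ U s := by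
    intro r
    by_cases hr : r < N
    · obtain ⟨s, hs⟩ := hδU (r * h) ⟨by positivity, by linarith [hnode r hr]⟩
      refine ⟨s, fun _ t ht => hs ?_⟩
      rw [Metric.mem_ball, Real.dist_eq, abs_of_nonneg (by linarith [ht.1])]
      linarith [ht.2]
    · exact ⟨0, fun h => absurd h hr⟩
  choose s hs using hcen
  have hs' := fun r (hr : r < N) t ht => hU (s r) t (hs r hr t ht)
  have hf0 : f (N * h) = f 0 := by rw [hNh]; simpa using hf.periodic 0
  obtain ⟨k, hk, hkc⟩ := exists_cyclic_choice (N := N) (by omega)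
    (good := fun i a b => Compatible α (Φ (s i) a) (Φ (s (i + 1)) b) (f ((i + 1 : ℕ) * h)))
    (closing := fun a b => Compatible α (Φ (s (N - 1)) a) (Φ (s 0) b) (f (N * h)))
    (fun i hi a b b' hb => by
      obtain ⟨-, h1, -⟩ := hs' i (by omega) ((i + 1 : ℕ) * h)
        ⟨by push_cast; nlinarith, by push_cast; exact le_rfl⟩
      obtain ⟨-, -, h2⟩ := hs' (i + 1) hi ((i + 1 : ℕ) * h) ⟨le_rfl, by nlinarith⟩
      exact h2 _ (h1 a) b b' hb)
    (fun b a a' ha => by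
      obtain ⟨-, h1, -⟩ := hs' 0 (by omega) 0 ⟨by simp, by simpa using hh0.le⟩
      obtain ⟨-, -, h2⟩ := hs' (N - 1) (by omega) (N * h) (by
        rw [hN]; push_cast; constructor <;> nlinarith)
      have h3 := h1 b
      rw [← hf0] at h3
      exact (h2 _ h3 a a' ha).imp Compatible.symm Compatible.symm)
  have hNz : (N : ℤ) ≠ 0 := by positivity
  -- The charts are extended to all integer indices by residues, so that the last arc and the first
  -- become ordinary neighbours.
  have hr : ∀ j : ℤ, ∃ r : ℕ, r < N ∧ (r : ℤ) = j % N := fun j => by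
    have h1 := Int.emod_nonneg j hNz
    have h2 := Int.emod_lt_of_pos j (show (0 : ℤ) < N by positivity)
    exact ⟨(j % N).toNat, by omega, by omega⟩
  choose r hrN hrj using hr
  have hrq : ∀ j : ℤ, (j : ℝ) = r j + (j / N : ℤ) * N := fun j => by
    have h1 := Int.emod_add_mul_ediv j N
    rw [← hrj] at h1
    have h2 : ((r j : ℤ) : ℝ) + (N : ℝ) * ((j / N : ℤ) : ℝ) = j := by exact_mod_cast h1
    push_cast at h2
    linarith
  have hshift : ∀ j : ℤ, (j : ℝ) * h = r j * h + (j / N : ℤ) * (2 * Real.pi) := fun j => by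
    rw [← hNh, hrq j]
    have h1 : ((r j : ℝ) + (j / N : ℤ) * N) * h = r j * h + (j / N : ℤ) * (N * h) := by ring
    rw [← h1, ← hrq j]
  refine ⟨N, h, fun j => Φ (s (r j)) (k (r j)), by omega, hNh, fun j => hΦ _ _, fun j m => ?_,
    fun j t ht => ?_, fun j => ?_⟩
  · have h1 : r (j + m * N) = r j := by
      have h1 := hrj (j + m * N)
      rw [Int.add_mul_emod_self_right, ← hrj] at h1
      exact_mod_cast h1
    simp only [h1]
  · have h1 := hshift j
    obtain ⟨h2, -⟩ := hs' (r j) (hrN j) (t - (j / N : ℤ) * (2 * Real.pi))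
      ⟨by linarith [ht.1], by linarith [ht.2]⟩
    have h3 := (monoAt_add_int_mul hf.periodic (j / N) _).2 (h2 (k (r j)))
    rwa [sub_add_cancel] at h3
  · have h1 : f (j * h) = f (r j * h) := by
      rw [hshift j]; exact hf.periodic.int_mul _ _
    have h2 := hrj j
    have h3 := hrj (j - 1)
    have h4 := hrN j
    rw [h1]
    rcases Nat.eq_zero_or_pos (r j) with h0 | h0
    · have h5 : r (j - 1) = N - 1 := by
        have h6 : (j - 1) % N = N - 1 := by
          have h7 := Int.emod_add_mul_ediv j N
          have h8 : j - 1 = (N - 1 : ℤ) + N * (j / N - 1) := by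
            rw [mul_sub]; omega
          rw [h8, Int.add_mul_emod_self_left, Int.emod_eq_of_lt (by omega) (by omega)]
        omega
      rw [h5, h0]
      rw [hf0] at hkc
      simpa using hkc
    · have h5 : r (j - 1) + 1 = r j := by
        have h6 : (j - 1) % N = r j - 1 := by
          have h7 := Int.emod_add_mul_ediv j N
          have h8 : j - 1 = (r j - 1 : ℤ) + N * (j / N) := by omega
          rw [h8, Int.add_mul_emod_self_left, Int.emod_eq_of_lt (by omega) (by omega)]
        omega
      have := hk (r (j - 1)) (by omega)
      rw [h5] at this
      exact this

/-! ### Legendrian approximation -/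

section Approximation

variable {α : ∀ x : M, TangentSpace (𝓡 3) x →L[ℝ] ℝ} {f : ℝ → M} {N : ℕ} {h : ℝ}
  {Φ : ℤ → OpenPartialHomeomorph M E3} {O : Set (Circle × M)}

/-- Within `h` of a node only the two adjacent arcs occur, up to the period. -/
theorem IsDarbouxCover.eq_of_near (H : IsDarbouxCover α f N h Φ) {n : ℕ} {δ : ℝ} (hδ : δ < h)
    {j k : ℤ} {t : ℝ} (ht : t ∈ Icc (j * h) ((j + 1) * h))
    (ht' : t + k * (2 * Real.pi) ∈ Ioo (n * h - δ) (n * h + δ)) :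
    Φ j = Φ n ∨ Φ j = Φ (n - 1) := by
  have hh := H.pos
  have h1 : (k : ℝ) * (2 * Real.pi) = k * N * h := by rw [mul_assoc, H.mul_eq]
  rw [h1] at ht'
  have h2 : ((j + k * N : ℤ) : ℝ) < n + 1 := by
    push_cast
    nlinarith [ht.1, ht'.2]
  have h3 : (n : ℝ) - 2 < ((j + k * N : ℤ) : ℝ) := by
    push_cast
    nlinarith [ht.2, ht'.1]
  have h2' : j + k * N < n + 1 := by exact_mod_cast h2
  have h3' : (n : ℤ) - 2 < j + k * N := by exact_mod_cast h3
  rw [← H.periodic j k]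
  rcases (by omega : j + k * N = n ∨ j + k * N = n - 1) with h4 | h4
  · exact Or.inl (by rw [h4])
  · exact Or.inr (by rw [h4])

theorem mul_le_mul_of_lt {h : ℝ} (hh : 0 < h) {i j : ℕ} (hij : i < j) : ((i : ℝ) + 1) * h ≤ j * h := by
  have : (i : ℝ) + 1 ≤ j := by exact_mod_cast hij
  gcongr

/-- Junctions are installed node by node. Each alters the knot only near its node and keeps it
monotone in both adjacent charts. Compatibility is a statement about the point `f (n h)`, so the
induction also records that untreated nodes have not moved. -/
theorem IsDarbouxCover.exists_nodes_aux [T2Space M] (H : IsDarbouxCover α f N h Φ) (hf : PKnot f)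
    (hO : IsOpen O) (hfO : GraphIn O f) (n : ℕ) (hn : n ≤ N) :
    ∃ g : ℝ → M, PIso f g ∧ GraphIn O g ∧
      (∀ j : ℤ, ∀ t ∈ Icc (j * h) ((j + 1) * h), MonoAt (Φ j) g t) ∧
      (∀ i < n, ∀ᶠ t in 𝓝 ((i : ℝ) * h), lev α g t = 0) ∧
      ∀ i < N, n ≤ i → g =ᶠ[𝓝 ((i : ℝ) * h)] f := by
  have hh := H.pos
  induction n with
  | zero => exact ⟨f, PIso.refl hf, hfO, H.mono, fun i hi => absurd hi (Nat.not_lt_zero i),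
      fun _ _ _ => EventuallyEq.rfl⟩
  | succ n ih =>
    obtain ⟨g, hg1, hgO, hgm, hgl, hgf⟩ := ih (by omega)
    have hgk := hg1.right
    have hgn : g (n * h) = f (n * h) := (hgf n (by omega) le_rfl).self_of_nhds
    have hm1 : MonoAt (Φ n) g (n * h) := hgm n _ ⟨by push_cast; exact le_rfl, by push_cast; nlinarith⟩
    have hm2 : MonoAt (Φ (n - 1)) g (n * h) := hgm (n - 1) _
      ⟨by push_cast; nlinarith, by push_cast; linarith⟩
    have hw : Compatible α (Φ n) (Φ (n - 1)) (g (n * h)) := by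
      rw [hgn]; exact (H.compat n).symm
    obtain ⟨g', δ, hδ, hδh, hgg', hg'O, hagree, hmono, hleg⟩ := hgk.exists_legendrian_junction
      (H.darboux n) (H.darboux (n - 1)).toIsSmoothChart hm1 hm2 hw hO hgO hh
    have hg'k := hgg'.right
    have hnN : ((n : ℝ) + 1) * h ≤ 2 * Real.pi := by
      rw [← H.mul_eq]; exact mul_le_mul_of_lt hh hn
    have hn0 : 0 ≤ (n : ℝ) * h := by positivity
    have hnode : ∀ i < N, i ≠ n → g' =ᶠ[𝓝 ((i : ℝ) * h)] g := by
      intro i hi hin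
      have h0 : 0 ≤ (i : ℝ) * h := by positivity
      have h1 := mul_le_mul_of_lt hh hi
      rw [H.mul_eq] at h1
      rcases lt_or_gt_of_ne hin with h2 | h2
      · have h3 := mul_le_mul_of_lt hh h2
        exact hagree.eventuallyEq hgk.periodic hg'k.periodic 1
          (by push_cast; constructor <;> linarith)
      · have h3 := mul_le_mul_of_lt hh h2
        exact hagree.eventuallyEq hgk.periodic hg'k.periodic 0
          (by push_cast; constructor <;> linarith)
    have hπ : n * h + δ < n * h - δ + 2 * Real.pi := by
      have h1 : (2 : ℝ) ≤ N := by exact_mod_cast H.two_le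
      have h2 := H.mul_eq
      nlinarith
    refine ⟨g', hg1.trans hgg', hg'O, fun j t ht => ?_, fun i hi => ?_, fun i hi hni => ?_⟩
    · obtain ⟨k, hk | hk⟩ := exists_int_mem_Ioo_or_Icc hπ t
      · rw [← monoAt_add_int_mul hg'k.periodic k]
        obtain ⟨h1, h2⟩ := hmono _ ⟨hk.1.le, hk.2.le⟩
        rcases H.eq_of_near hδh ht hk with h3 | h3
        · rw [h3]; exact h1
        · rw [h3]; exact h2
      · exact (hgm j t ht).congr (hagree.eventuallyEq hgk.periodic hg'k.periodic k hk)
    · rcases Nat.lt_succ_iff_lt_or_eq.1 hi with h1 | rfl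
      · filter_upwards [hgl i h1, (hnode i (by omega) (by omega)).eventuallyEq_nhds] with t ht ht'
        rw [lev_congr ht', ht]
      · exact hleg
    · exact (hnode i hi (by omega)).trans (hgf i hi (by omega))

/-- Each arc is changed only on a compact part of its interior, so the knot stays Legendrian near
all nodes. Coiling destroys monotonicity, which is therefore kept only for the arcs still to be
treated. -/
theorem IsDarbouxCover.exists_arcs_aux [T2Space M] {f₀ : ℝ → M}
    (H : IsDarbouxCover α f₀ N h Φ) (hf : PKnot f)
    (hm : ∀ j : ℤ, ∀ t ∈ Icc (j * h) ((j + 1) * h), MonoAt (Φ j) f t)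
    (hO : IsOpen O) (hfO : GraphIn O f)
    (hl : ∀ i ≤ N, ∀ᶠ t in 𝓝 ((i : ℝ) * h), lev α f t = 0) (n : ℕ) (hn : n ≤ N) :
    ∃ g : ℝ → M, PIso f g ∧ GraphIn O g ∧
      (∀ i < N, n ≤ i → ∀ t ∈ Icc (i * h) ((i + 1) * h), MonoAt (Φ i) g t) ∧
      (∀ i ≤ N, ∀ᶠ t in 𝓝 ((i : ℝ) * h), lev α g t = 0) ∧
      ∀ i < n, ∀ t ∈ Icc (i * h) ((i + 1) * h), lev α g t = 0 := by
  have hh := H.pos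
  induction n with
  | zero => exact ⟨f, PIso.refl hf, hfO, fun i _ _ t ht => hm i t (by exact_mod_cast ht), hl,
      fun i hi => absurd hi (Nat.not_lt_zero i)⟩
  | succ n ih =>
    obtain ⟨g, hg1, hgO, hgm, hgl, hgf⟩ := ih (by omega)
    have hgk := hg1.right
    have hnN : ((n : ℝ) + 1) * h ≤ 2 * Real.pi := by
      rw [← H.mul_eq]; exact mul_le_mul_of_lt hh hn
    have hn0 : 0 ≤ (n : ℝ) * h := by positivity
    have hπ : ((n : ℝ) + 1) * h < n * h + 2 * Real.pi := by
      have h1 : (2 : ℝ) ≤ N := by exact_mod_cast H.two_le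
      have h2 := H.mul_eq
      nlinarith
    obtain ⟨g', hgg', hg'O, hagree, hleg⟩ := hgk.exists_legendrian_arc (H.darboux n) hO hgO
      (a := n * h) (b := (n + 1) * h) (by nlinarith) hπ (hgm n (by omega) le_rfl)
      (hgl n (by omega)) (by exact_mod_cast hgl (n + 1) (by omega))
    have hg'k := hgg'.right
    have harc : ∀ i < N, i ≠ n → ∀ t ∈ Icc (i * h) ((i + 1) * h), g' =ᶠ[𝓝 t] g := by
      intro i hi hin t ht
      have h0 : 0 ≤ (i : ℝ) * h := by positivity
      have h1 := mul_le_mul_of_lt hh hi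
      rw [H.mul_eq] at h1
      rcases lt_or_gt_of_ne hin with h2 | h2
      · have h3 := mul_le_mul_of_lt hh h2
        exact hagree.eventuallyEq hgk.periodic hg'k.periodic 1
          (by push_cast; constructor <;> linarith [ht.1, ht.2])
      · have h3 := mul_le_mul_of_lt hh h2
        exact hagree.eventuallyEq hgk.periodic hg'k.periodic 0
          (by push_cast; constructor <;> linarith [ht.1, ht.2])
    have hnode : ∀ i ≤ N, g' =ᶠ[𝓝 ((i : ℝ) * h)] g := by
      intro i hi
      have h0 : 0 ≤ (i : ℝ) * h := by positivity
      have h1 : (i : ℝ) * h ≤ 2 * Real.pi := by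
        rw [← H.mul_eq]
        have : (i : ℝ) ≤ N := by exact_mod_cast hi
        gcongr
      rcases Nat.lt_or_ge n i with h2 | h2
      · have h3 := mul_le_mul_of_lt hh h2
        exact hagree.eventuallyEq hgk.periodic hg'k.periodic 0
          (by push_cast; constructor <;> linarith)
      · have h3 : (i : ℝ) * h ≤ n * h := by gcongr
        exact hagree.eventuallyEq hgk.periodic hg'k.periodic 1
          (by push_cast; constructor <;> linarith)
    refine ⟨g', hg1.trans hgg', hg'O, fun i hi hni t ht => ?_, fun i hi => ?_, fun i hi t ht => ?_⟩
    · exact (hgm i hi (by omega) t ht).congr (harc i hi (by omega) t ht)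
    · filter_upwards [hgl i hi, (hnode i hi).eventuallyEq_nhds] with t ht ht'
      rw [lev_congr ht', ht]
    · rcases Nat.lt_succ_iff_lt_or_eq.1 hi with h1 | rfl
      · rw [lev_congr (harc i (by omega) (by omega) t ht), hgf i h1 t ht]
      · exact hleg t ht

theorem lev_add_int_mul (hf : PKnot f) (k : ℤ) (t : ℝ) :
    lev α f (t + k * (2 * Real.pi)) = lev α f t :=
  lev_eq_of_periodic hf.smooth (fun t => hf.periodic.int_mul k t) t

theorem IsDarbouxCover.exists_arc (H : IsDarbouxCover α f N h Φ) (t : ℝ) :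
    ∃ (k : ℤ) (i : ℕ), i < N ∧ t + k * (2 * Real.pi) ∈ Icc (i * h) ((i + 1) * h) := by
  have hh := H.pos
  obtain ⟨k, hk⟩ := exists_int_mem_Ico 0 t
  rw [zero_add, ← H.mul_eq] at hk
  have h1 : 0 ≤ (t + k * (2 * Real.pi)) / h := div_nonneg (by rw [← H.mul_eq]; exact hk.1) hh.le
  have h2 := Nat.floor_le h1
  have h3 := Nat.lt_floor_add_one ((t + k * (2 * Real.pi)) / h)
  rw [le_div_iff₀ hh] at h2
  rw [div_lt_iff₀ hh] at h3
  refine ⟨k, _, ?_, h2, h3.le⟩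
  have h4 : (⌊(t + k * (2 * Real.pi)) / h⌋₊ : ℝ) < N := by
    refine lt_of_mul_lt_mul_right (lt_of_le_of_lt h2 ?_) hh.le
    rw [← H.mul_eq]; exact hk.2
  exact_mod_cast h4

/-- Every knot is isotopic to a Legendrian knot through knots close to it. -/
theorem PKnot.exists_legendrian [T2Space M] [IsManifold (𝓡 3) ∞ M] (hα : IsContactForm α)
    (hf : PKnot f) (hO : IsOpen O) (hfO : GraphIn O f) :
    ∃ g : ℝ → M, PIso f g ∧ GraphIn O g ∧ ∀ t, lev α g t = 0 := by
  obtain ⟨N, h, Φ, H⟩ := exists_darbouxCover hα hf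
  obtain ⟨g, hfg, hgO, hgm, hgl, -⟩ := H.exists_nodes_aux hf hO hfO N le_rfl
  have hgk := hfg.right
  suffices hc : ∃ g' : ℝ → M, PIso g g' ∧ GraphIn O g' ∧ ∀ i < N, ∀ t ∈ Icc (i * h) ((i + 1) * h),
      lev α g' t = 0 by
    obtain ⟨g', hgg', hg'O, hl⟩ := hc
    refine ⟨g', hfg.trans hgg', hg'O, fun t => ?_⟩
    obtain ⟨k, i, hi, ht⟩ := H.exists_arc t
    rw [← lev_add_int_mul hgg'.right k]
    exact hl i hi _ ht
  obtain ⟨g', h1, h2, -, -, h3⟩ := H.exists_arcs_aux hgk hgm hO hgO (fun i hi => by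
    rcases lt_or_eq_of_le hi with hi | rfl
    · exact hgl i hi
    -- Node `N` is node `0` shifted by the period.
    · have h1 := hgl 0 (by have := H.two_le; omega)
      rw [Nat.cast_zero, zero_mul] at h1
      have h2 : Tendsto (fun t : ℝ => t - 2 * Real.pi) (𝓝 (i * h)) (𝓝 0) := by
        have h3 : (i * h : ℝ) - 2 * Real.pi = 0 := sub_eq_zero.2 H.mul_eq
        exact h3 ▸ ((continuous_id.sub (continuous_const (y := 2 * Real.pi))).tendsto (i * h : ℝ))
      filter_upwards [h2.eventually h1] with t ht
      have h3 := lev_add_int_mul (α := α) hgk (-1) t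
      rw [← h3, ← ht]
      congr 1
      push_cast
      ring) N le_rfl
  exact ⟨g', h1, h2, h3⟩

end Approximation

/-! ### Transverse approximation -/

/-- Openness jointly in time and parameter: by compactness of an arc, a small enough push in one
chart keeps the knot monotone in the others. -/
theorem MonoAt.eventually_family {F : ℝ × ℝ → M} (hF : ContMDiff 𝓘(ℝ, ℝ × ℝ) (𝓡 3) ∞ F)
    {Φ : OpenPartialHomeomorph M E3} (hΦ : IsSmoothChart Φ) {τ t : ℝ}
    (h : MonoAt Φ (fun t => F (τ, t)) t) :
    ∀ᶠ x : ℝ × ℝ in 𝓝 (τ, t), MonoAt Φ (fun t => F (x.1, t)) x.2 := by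
  set ψ : ℝ × ℝ → ℝ := fun x => Φ (F x) 0 with hψ
  have hs : ∀ x, F x ∈ Φ.source → ContDiffAt ℝ ∞ ψ x := fun x hx =>
    ContDiffAt.comp (g := fun v : E3 => v 0) x (contDiff_coord 0).contDiffAt
      (contMDiffAt_iff_contDiffAt.1
        ((hΦ.smooth.contMDiffAt (Φ.open_source.mem_nhds hx)).comp x hF.contMDiffAt))
  have hd : ∀ x, F x ∈ Φ.source → deriv (fun t => Φ (F (x.1, t)) 0) x.2 =
      fderiv ℝ ψ x (0, 1) := fun x hx => by
    have h1 : HasDerivAt (fun t : ℝ => (x.1, t)) ((0 : ℝ), (1 : ℝ)) x.2 :=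
      (hasDerivAt_const _ _).prodMk (hasDerivAt_id _)
    exact (HasFDerivAt.comp_hasDerivAt (l := ψ) x.2
      ((hs x hx).differentiableAt (by simp)).hasFDerivAt h1).deriv
  have h1 : ∀ᶠ x in 𝓝 (τ, t), F x ∈ Φ.source :=
    hF.continuous.continuousAt.eventually (Φ.open_source.mem_nhds h.1)
  have h2 : ContinuousAt (fun x => fderiv ℝ ψ x (0, 1)) (τ, t) :=
    ((hs _ h.1).fderiv_right (m := ∞) (by simp)).continuousAt.clm_apply continuousAt_const
  have h3 := h2.eventually_const_lt (u := 0)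
    (h.2.trans_eq (hd _ h.1))
  filter_upwards [h1, h3] with x hx1 hx2
  exact ⟨hx1, by rw [hd x hx1]; exact hx2⟩

theorem unitBump_pos {τ : ℝ} (h : |τ| < 1 / 2) : 0 < unitBump τ := by
  have := abs_lt.1 h
  exact mul_pos (Real.smoothTransition.pos_of_pos (by linarith))
    (Real.smoothTransition.pos_of_pos (by linarith))

/-- Translating an arc in the direction `∂/∂y` of a Darboux chart makes it more transverse. -/
theorem PKnot.exists_push [T2Space M] {α : ∀ x : M, TangentSpace (𝓡 3) x →L[ℝ] ℝ} {f : ℝ → M}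
    (hf : PKnot f) {Φ : OpenPartialHomeomorph M E3} (hΦ : IsDarboux α Φ) {a b ε : ℝ} (hε : 0 < ε)
    (hab : 2 * ε < b - a) (hb : b < a + 2 * Real.pi) (hmono : ∀ t ∈ Icc a b, MonoAt Φ f t)
    {O : Set (Circle × M)} (hO : IsOpen O) (hfO : GraphIn O f) {σ : ℝ} (hσ : σ * σ = 1) :
    ∃ F : ℝ × ℝ → M, ContMDiff 𝓘(ℝ, ℝ × ℝ) (𝓡 3) ∞ F ∧ (∀ τ, PKnot fun t => F (τ, t)) ∧
      (∀ τ, GraphIn O fun t => F (τ, t)) ∧ (∀ t, F (0, t) = f t) ∧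
      ∀ τ > 0, ∀ t, 0 ≤ σ * lev α f t → 0 ≤ σ * lev α (fun t => F (τ, t)) t ∧
        (0 < σ * lev α f t ∨ t ∈ Icc (a + ε) (b - ε) → 0 < σ * lev α (fun t => F (τ, t)) t) := by
  have hab' : a < b := by linarith
  obtain ⟨c, hc, ε₀, hε₀, hcf⟩ := exists_chart_curve hf.smooth hΦ.toIsSmoothChart hab'.le
    fun t ht => (hmono t ht).1
  have hcI : ∀ t ∈ Icc a b, f t ∈ Φ.source ∧ Φ (f t) = c t := fun t ht =>
    hcf t ⟨by linarith [ht.1], by linarith [ht.2]⟩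
  have hev : ∀ t ∈ Icc a b, ∀ i : Fin 3, (fun t => Φ (f t) i) =ᶠ[𝓝 t] fun t => c t i := by
    intro t ht i
    filter_upwards [Ioo_mem_nhds (show a - ε₀ < t by linarith [ht.1])
      (show t < b + ε₀ by linarith [ht.2])] with s hs
    rw [(hcf s ⟨hs.1.le, hs.2.le⟩).2]
  have hx : ∀ t ∈ Icc a b, 0 < deriv (fun t => c t 0) t := fun t ht => by
    rw [← (hev t ht 0).deriv_eq]; exact (hmono t ht).2
  obtain ⟨η, hη, htube⟩ := hf.exists_tube hab' hb hc hε₀ hcf hx hO hfO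
  -- With this width the bump `ρ` is positive on `[a + ε, b - ε]` and zero within `ε / 2` of the
  -- ends.
  set w := b - a - ε with hw
  have hw0 : 0 < w := by linarith
  set ρ : ℝ → ℝ := fun t => unitBump ((t - (a + b) / 2) / w) with hρ
  have hρs : ContDiff ℝ ∞ ρ := contDiff_unitBump.comp (by fun_prop)
  have hρ0 : ∀ t, w / 2 ≤ |t - (a + b) / 2| → ρ t = 0 := fun t ht =>
    unitBump_of_le_abs (by rw [abs_div, abs_of_pos hw0, le_div_iff₀ hw0]; linarith)
  have hρ1 : ∀ t, |t - (a + b) / 2| < w / 2 → 0 < ρ t := fun t ht =>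
    unitBump_pos (by rw [abs_div, abs_of_pos hw0, div_lt_iff₀ hw0]; linarith)
  have hσ1 : |σ| = 1 := by
    rcases mul_self_eq_one_iff.1 hσ with h | h <;> simp [h]
  -- Lowering `y` by `σ (η / 2) ρ` raises `dz - y dx` on the velocity by `σ (η / 2) ρ x'`, which has
  -- the sign of `σ` as `x' > 0`.
  set c' : ℝ → E3 := fun t => c t + (-(σ * (η / 2) * ρ t)) • EuclideanSpace.single 1 1 with hc'
  have hc's : ContDiff ℝ ∞ c' :=
    hc.add (((contDiff_const.mul hρs).neg).smul contDiff_const)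
  obtain ⟨F, hF1, hF2, hF3, hF4, hF5, hF6, hF7⟩ := hf.exists_graph_move hΦ.toIsSmoothChart
    (ε := ε / 2) (by linarith) (by linarith) hb hfO hc hc's hcI hx htube
    (fun t => by simp [hc']) (fun t ht h1 => by
      rw [hc']
      simp only
      rw [hρ0 t, mul_zero, neg_zero, zero_smul, add_zero]
      rcases h1 with h1 | h1
      · exact le_abs.2 (Or.inr (by linarith))
      · exact le_abs.2 (Or.inl (by linarith)))
    (fun t _ => by
      rw [dist_eq_norm, hc']
      simp only
      rw [add_sub_cancel_left, norm_smul, PiLp.norm_single, norm_one, mul_one,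
        Real.norm_eq_abs, abs_neg, abs_mul, abs_mul, hσ1, one_mul, abs_of_pos (half_pos hη),
        abs_of_nonneg (unitBump_nonneg _)]
      nlinarith [unitBump_le_one ((t - (a + b) / 2) / w)])
  refine ⟨F, hF1, hF2, hF3, fun t => hF4 0 le_rfl t, fun τ hτ => ?_⟩
  have hS : 0 < Real.smoothTransition τ := Real.smoothTransition.pos_of_pos hτ
  have hin : ∀ t ∈ Ioo a b, 0 ≤ σ * lev α f t → 0 ≤ σ * lev α (fun t => F (τ, t)) t ∧
      (0 < σ * lev α f t ∨ 0 < ρ t → 0 < σ * lev α (fun t => F (τ, t)) t) := by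
    intro t ht
    have htI : t ∈ Icc a b := ⟨ht.1.le, ht.2.le⟩
    obtain ⟨G, hG, hGl⟩ := hΦ.lev hf.smooth.contMDiffAt (hcI t htI).1
    obtain ⟨G', hG', hGl'⟩ := hΦ.lev (hF2 τ).smooth.contMDiffAt (hF6 τ t ht).1
    have hFc : ∀ i : Fin 3, (fun t => Φ (F (τ, t)) i) =ᶠ[𝓝 t] fun t =>
        (c t + Real.smoothTransition τ • (c' t - c t)) i := fun i => by
      filter_upwards [isOpen_Ioo.mem_nhds ht] with s hs
      rw [(hF6 τ s hs).2]
    have h0 : (fun t => (c t + Real.smoothTransition τ • (c' t - c t)) 0) = fun t => c t 0 := by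
      funext s; simp [hc']
    have h2 : (fun t => (c t + Real.smoothTransition τ • (c' t - c t)) 2) = fun t => c t 2 := by
      funext s; simp [hc']
    have h1 : Φ (F (τ, t)) 1 =
        c t 1 - Real.smoothTransition τ * (σ * (η / 2) * ρ t) := by
      rw [(hF6 τ t ht).2]; simp [hc']; ring
    rw [(hev t htI 0).deriv_eq, (hev t htI 2).deriv_eq, (hcI t htI).2] at hGl
    rw [(hFc 0).deriv_eq, (hFc 2).deriv_eq, h0, h2, h1] at hGl'
    set A := σ * (deriv (fun t => c t 2) t - c t 1 * deriv (fun t => c t 0) t) with hA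
    have e1 : σ * lev α f t = G * A := by rw [hGl, hA]; ring
    have e2 : σ * lev α (fun t => F (τ, t)) t = G' * (A + (σ * σ) *
        (Real.smoothTransition τ * (η / 2) * deriv (fun t => c t 0) t * ρ t)) := by
      rw [hGl', hA]; ring
    rw [e1, e2, hσ, one_mul]
    intro h3
    have h4 : 0 ≤ A := nonneg_of_mul_nonneg_right h3 hG
    have h5 : 0 < Real.smoothTransition τ * (η / 2) * deriv (fun t => c t 0) t := by
      have := hx t htI
      positivity
    have h6 : 0 ≤ ρ t := unitBump_nonneg _
    refine ⟨by positivity, fun h7 => mul_pos hG' ?_⟩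
    rcases h7 with h7 | h7
    · have := pos_of_mul_pos_right h7 hG.le
      positivity
    · positivity
  intro t h0
  have hgen : 0 ≤ σ * lev α (fun t => F (τ, t)) t ∧
      (0 < σ * lev α f t → 0 < σ * lev α (fun t => F (τ, t)) t) := by
    obtain ⟨k, hk⟩ := exists_int_mem_Ioo_or_Icc hb t
    rw [← lev_add_int_mul (hF2 τ) k t, ← lev_add_int_mul hf k t]
    rw [← lev_add_int_mul hf k t] at h0
    rcases hk with hk | hk
    · obtain ⟨h1, h2⟩ := hin _ hk h0
      exact ⟨h1, fun h => h2 (Or.inl h)⟩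
    · have h1 : (fun t => F (τ, t)) =ᶠ[𝓝 (t + k * (2 * Real.pi))] f := by
        filter_upwards [isOpen_Ioo.mem_nhds (show t + k * (2 * Real.pi) ∈
          Ioo (b - ε / 2) (a + ε / 2 + 2 * Real.pi) from
          ⟨by linarith [hk.1], by linarith [hk.2]⟩)] with s hs using hF7 τ s hs
      rw [lev_congr h1]
      exact ⟨h0, id⟩
  refine ⟨hgen.1, fun h => ?_⟩
  rcases h with h | h
  · exact hgen.2 h
  · exact (hin t ⟨by linarith [h.1], by linarith [h.2]⟩ h0).2 (Or.inr (hρ1 t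
      (abs_lt.2 ⟨by linarith [h.1], by linarith [h.2]⟩)))

section Transverse

variable {α : ∀ x : M, TangentSpace (𝓡 3) x →L[ℝ] ℝ} {f : ℝ → M} {N : ℕ} {h : ℝ}
  {Φ : ℤ → OpenPartialHomeomorph M E3} {O : Set (Circle × M)}

/-- A push loses a margin `ε` at each end of its interval, so it is applied to arcs enlarged by `ε`.
The bound `h / 4` keeps an enlarged arc shorter than the period. -/
theorem IsDarbouxCover.exists_margin (H : IsDarbouxCover α f N h Φ) (hf : PKnot f) :
    ∃ ε > 0, ε < h / 4 ∧ ∀ i < N, ∀ t ∈ Icc (i * h - ε) ((i + 1) * h + ε), MonoAt (Φ i) f t := by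
  have hh := H.pos
  have h1 : ∀ i ∈ {i | i < N}, ∀ᶠ ε in 𝓝[>] (0 : ℝ),
      ∀ t ∈ Icc (i * h - ε) ((i + 1) * h + ε), MonoAt (Φ i) f t := by
    intro i _
    obtain ⟨ε, hε, hεi⟩ := exists_Icc_subset_of_isOpen
      (isOpen_interior (s := {t | MonoAt (Φ i) f t})) (a := i * h) (b := (i + 1) * h)
      (by nlinarith) fun t ht => mem_interior_iff_mem_nhds.2
        ((H.mono i t (by exact_mod_cast ht)).eventually hf.smooth (H.darboux i).toIsSmoothChart)
    filter_upwards [Ioo_mem_nhdsGT hε] with δ hδ t ht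
    have hti : t ∈ Icc (i * h - ε) ((i + 1) * h + ε) :=
      ⟨by linarith [ht.1, hδ.2], by linarith [ht.2, hδ.2]⟩
    exact interior_subset (s := {t | MonoAt (Φ i) f t}) (hεi hti)
  have h2 := (eventually_all_finite (finite_lt_nat N)).2 h1
  obtain ⟨ε, h3, h4⟩ := (h2.and (Ioo_mem_nhdsGT (show 0 < h / 4 by positivity))).exists
  exact ⟨ε, h4.1, h4.2, h3⟩

/-- Pushing the arcs in turn never makes the form negative, keeps it positive wherever it already
was, and makes it positive on the current arc. Each push time is taken so small that all enlarged
arcs stay monotone. -/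
theorem IsDarbouxCover.exists_transverse_aux [T2Space M] (H : IsDarbouxCover α f N h Φ)
    (hf : PKnot f) (hO : IsOpen O) (hfO : GraphIn O f) {σ : ℝ} (hσ : σ * σ = 1)
    (hl : ∀ t, 0 ≤ σ * lev α f t) {ε : ℝ} (hε : 0 < ε) (hεh : ε < h / 4)
    (hm : ∀ i < N, ∀ t ∈ Icc (i * h - ε) ((i + 1) * h + ε), MonoAt (Φ i) f t)
    (n : ℕ) (hn : n ≤ N) :
    ∃ g : ℝ → M, PKnot g ∧ GraphIn O g ∧
      (∀ i < N, ∀ t ∈ Icc (i * h - ε) ((i + 1) * h + ε), MonoAt (Φ i) g t) ∧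
      (∀ t, 0 ≤ σ * lev α g t) ∧
      ∀ i < n, ∀ t ∈ Icc (i * h) ((i + 1) * h), 0 < σ * lev α g t := by
  have hh := H.pos
  induction n with
  | zero => exact ⟨f, hf, hfO, hm, hl, fun i hi => absurd hi (Nat.not_lt_zero i)⟩
  | succ n ih =>
    obtain ⟨g, hg, hgO, hgm, hgl, hgp⟩ := ih (by omega)
    have hπ : ((n : ℝ) + 1) * h + ε < n * h - ε + 2 * Real.pi := by
      have h1 : (2 : ℝ) ≤ N := by exact_mod_cast H.two_le
      have h2 := H.mul_eq
      nlinarith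
    obtain ⟨F, hF1, hF2, hF3, hF4, hF5⟩ := hg.exists_push (H.darboux n) hε
      (a := n * h - ε) (b := (n + 1) * h + ε) (by linarith) hπ (hgm n (by omega)) hO hgO hσ
    have h0 : (fun t => F (0, t)) = g := funext hF4
    have h1 : ∀ i ∈ {i | i < N}, ∀ᶠ τ in 𝓝 (0 : ℝ),
        ∀ t ∈ Icc (i * h - ε) ((i + 1) * h + ε), MonoAt (Φ i) (fun t => F (τ, t)) t := by
      intro i hi
      refine isCompact_Icc.eventually_forall_of_forall_eventually fun t ht => ?_
      refine MonoAt.eventually_family hF1 (H.darboux i).toIsSmoothChart ?_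
      rw [h0]
      exact hgm i hi t ht
    have h2 := (eventually_all_finite (finite_lt_nat N)).2 h1
    obtain ⟨τ, h3, h4⟩ := ((h2.filter_mono nhdsWithin_le_nhds).and
      (self_mem_nhdsWithin (s := Ioi (0 : ℝ)))).exists
    refine ⟨fun t => F (τ, t), hF2 τ, hF3 τ, h3, fun t => (hF5 τ h4 t (hgl t)).1,
      fun i hi t ht => (hF5 τ h4 t (hgl t)).2 ?_⟩
    rcases Nat.lt_succ_iff_lt_or_eq.1 hi with h5 | rfl
    · exact Or.inl (hgp i h5 t ht)
    · exact Or.inr ⟨by linarith [ht.1], by linarith [ht.2]⟩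

/-- Every knot is approximated by transverse knots of either sign. -/
theorem PKnot.exists_transverse [T2Space M] [IsManifold (𝓡 3) ∞ M] (hα : IsContactForm α)
    (hf : PKnot f) (hO : IsOpen O) (hfO : GraphIn O f) {σ : ℝ} (hσ : σ * σ = 1) :
    ∃ g : ℝ → M, PKnot g ∧ GraphIn O g ∧ ∀ t, 0 < σ * lev α g t := by
  obtain ⟨f', hff', hf'O, hl⟩ := hf.exists_legendrian hα hO hfO
  have hf' := hff'.right
  -- A fresh cover is needed: after coiling, the Legendrian knot need not be monotone in the charts
  -- used to construct it.
  obtain ⟨N, h, Φ, H⟩ := exists_darbouxCover hα hf'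
  obtain ⟨ε, hε, hεh, hm⟩ := H.exists_margin hf'
  obtain ⟨g, hg, hgO, -, -, hgp⟩ := H.exists_transverse_aux hf' hO hf'O hσ
    (fun t => by rw [hl, mul_zero]) hε hεh hm N le_rfl
  refine ⟨g, hg, hgO, fun t => ?_⟩
  obtain ⟨k, i, hi, ht⟩ := H.exists_arc t
  rw [← lev_add_int_mul hg k]
  exact hgp i hi _ ht

end Transverse

/-! ### From graphs to the compact-open topology -/

/-- Maps whose graph lies in a suitable neighbourhood of the graph of `γ` are close to `γ`. -/
theorem exists_isOpen_graph {U : Set C(Circle, M)} {γ : C(Circle, M)} (hU : U ∈ 𝓝 γ) :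
    ∃ O : Set (Circle × M), IsOpen O ∧ (∀ z, (z, γ z) ∈ O) ∧
      ∀ γ' : C(Circle, M), (∀ z, (z, γ' z) ∈ O) → γ' ∈ U := by
  obtain ⟨S, hS, hSγ, hSU⟩ := (ContinuousMap.mem_nhds_iff (f := γ) (s := U)).1 hU
  -- A subbasic condition, that `K` is mapped into `V`, says that the graph avoids the points over
  -- `K` outside `V`. The finite intersection is open since each compact `K` is closed.
  refine ⟨⋂ x ∈ S, (x.1ᶜ ×ˢ univ) ∪ (univ ×ˢ x.2), hS.isOpen_biInter fun x hx => ?_, fun z => ?_,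
    fun γ' h => hSU fun K V hKV z hz => ?_⟩
  · obtain ⟨h1, h2, -⟩ := hSγ x.1 x.2 hx
    exact (h1.isClosed.isOpen_compl.prod isOpen_univ).union (isOpen_univ.prod h2)
  · refine mem_iInter₂.2 fun x hx => ?_
    by_cases hz : z ∈ x.1
    · exact Or.inr ⟨mem_univ _, (hSγ x.1 x.2 hx).2.2 hz⟩
    · exact Or.inl ⟨hz, mem_univ _⟩
  · rcases mem_iInter₂.1 (h z) (K, V) hKV with h1 | h1
    · exact absurd hz h1.1
    · exact h1.2

theorem descend_comp_exp (γ : Circle → M) : (descend fun t => γ (Circle.exp t)) = γ := by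
  funext z
  exact congrArg γ (Circle.exp_arg z)

theorem GraphIn.descend_mem {O : Set (Circle × M)} {g : ℝ → M} (hg : GraphIn O g)
    (hp : Function.Periodic g (2 * Real.pi)) (z : Circle) : (z, descend g z) ∈ O := by
  obtain ⟨t, rfl⟩ := Circle.exp_surjective z
  rw [descend_exp hp]
  exact hg t

end

end ContactKnot

/-- Every neighbourhood of `γ` in `C(S¹, M)`, for the compact-open topology (the topology of
`C⁰`-convergence, as `S¹` is compact), contains a Legendrian knot isotopic to `γ`, a positively
transverse knot and a negatively transverse knot. -/
theorem mainTheorem5 {M : Type*} [TopologicalSpace M] [T2Space M] [SecondCountableTopology M]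
    [ChartedSpace (EuclideanSpace ℝ (Fin 3)) M] [IsManifold (𝓡 3) ∞ M]
    (ξ : ∀ x : M, Submodule ℝ (TangentSpace (𝓡 3) x))
    (α : ∀ x : M, TangentSpace (𝓡 3) x →L[ℝ] ℝ)
    (hα : ContactKnot.IsContactForm α)
    (hξ : ∀ (x : M) (v : TangentSpace (𝓡 3) x), v ∈ ξ x ↔ α x v = 0)
    (γ : C(Circle, M)) (hγ : ContactKnot.IsKnot γ)
    (U : Set C(Circle, M)) (hU : U ∈ 𝓝 γ) :
    (∃ γ' ∈ U, ContactKnot.IsLegendrianKnot ξ γ' ∧ ContactKnot.IsotopicKnots γ γ') ∧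
    (∃ γ' ∈ U, ContactKnot.IsPosTransverseKnot α γ') ∧
    (∃ γ' ∈ U, ContactKnot.IsNegTransverseKnot α γ') := by
  obtain ⟨O, hO, hγO, hOU⟩ := ContactKnot.exists_isOpen_graph hU
  have hf := hγ.pKnot
  have hfO : ContactKnot.GraphIn O fun t => γ (Circle.exp t) := fun t => hγO _
  have hmem : ∀ g : ℝ → M, ∀ hg : ContactKnot.PKnot g, ContactKnot.GraphIn O g →
      (⟨ContactKnot.descend g, hg.isKnot_descend.smooth.continuous⟩ : C(Circle, M)) ∈ U :=
    fun g hg hgO => hOU _ fun z => hgO.descend_mem hg.periodic z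
  refine ⟨?_, ?_, ?_⟩
  · obtain ⟨g, hfg, hgO, hl⟩ := hf.exists_legendrian hα hO hfO
    have hiso := hfg.isotopicKnots
    rw [ContactKnot.descend_comp_exp] at hiso
    exact ⟨_, hmem g hfg.right hgO, hfg.right.isLegendrianKnot_descend hξ hl, hiso⟩
  · obtain ⟨g, hg, hgO, hl⟩ := hf.exists_transverse hα hO hfO (σ := 1) (by norm_num)
    refine ⟨_, hmem g hg hgO, hg.isKnot_descend, fun t => ?_⟩
    have h1 := hl t
    rw [one_mul, ← ContactKnot.velocity_descend hg.periodic α t] at h1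
    exact h1
  · obtain ⟨g, hg, hgO, hl⟩ := hf.exists_transverse hα hO hfO (σ := -1) (by norm_num)
    refine ⟨_, hmem g hg hgO, hg.isKnot_descend, fun t => ?_⟩
    have h1 := hl t
    rw [neg_one_mul, Left.neg_pos_iff, ← ContactKnot.velocity_descend hg.periodic α t] at h1
    exact h1
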